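/- Let $G$ be an abelian group and let $\mathcal B=\bigoplus_{g\in G}\mathcal B_g$ be a $G$-graded finite-dimensional unital Jordan algebra over $\mathbb R$ that is graded-simple and has degree $2$ over its center $\mathbb L$. (Here $\mathbb L$ is a direct product of fields, $\mathcal B$ is the corresponding direct product of algebras over these fields, and the degree of $\mathcal B$ over $\mathbb L$ is the maximum of the degrees of the generic minimal polynomials of these factors.) Put $\mathbb L_g=\mathbb L\cap\mathcal B_g$. Then the support $H=\{g\in G:\mathbb L_g\ne 0\}$ of $\mathbb L$ is a subgroup of $G$, and either $\mathbb L_e=\mathbb R 1$ or $\mathbb L_e\cong\mathbb C$. Let $\overline G=G/H$, let $\pi:G\to\overline G$ be the natural homomorphism, and let $\overline G_{[2]}=\{\bar g\in\overline G:\bar g^2=\bar e\}$, $H^{[2]}=\{h^2:h\in H\}$, $U=\{z\in\mathbb C:|z|=1\}$. Notation. For a $\overline G$-graded algebra $\mathcal A$ over a field $\mathbb F$, $L_\pi(\mathcal A)=\bigoplus_{g\in G}\mathcal A_{\pi(g)}\otimes g\subset\mathcal A\otimes\mathbb F G$. For a $\overline G$-graded real algebra $\mathcal A$ and a character $\chi:G\to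 U$, $L_\pi^\chi(\mathcal A)=\bigoplus_{g\in G}\mathcal A_{\pi(g)}\otimes u_g\subset\mathcal A\otimes\mathbb C G$, where $u_g=z_g g$ with $0\ne z_g\in\mathbb C$, $z_g/\bar z_g=\chi(g)$. Both are $G$-graded algebras; $L_\pi^\chi(\mathbb R)$ is formed with the trivial grading on $\mathbb R$. A function $\kappa:\overline G\to\mathbb Z_{\ge0}$ is balanced if $\kappa(\bar g^{-1})=\kappa(\bar g)$ for all $\bar g$. A signature function for $\kappa$ is a function $\sigma:\overline G_{[2]}\to\mathbb Z$ with $|\sigma(\bar g)|\le\kappa(\bar g)$ and $\sigma(\bar g)\equiv\kappa(\bar g)\pmod 2$ for all $\bar g\in\overline G_{[2]}$. For a balanced $\kappa$ with finite support, let $V$ be a $\overline G$-graded vector space with $\dim V_{\bar g}=\kappa(\bar g)$ and let $b$ be a nondegenerate symmetric bilinear form on $V$ with $b(V_{\bar g_1},V_{\bar g_2})=0$ whenever $\bar g_1\bar g_2\ne\bar e$; over $\mathbb R$ require also that $b|_{V_{\bar g}}$ has signature $\sigma(\bar g)$ for all $\bar g\in\overline G_{[2]}$. The algebra $\mathbb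 F1\oplus V$ with $uv=b(u,v)1$ for $u,v\in V$, graded by $\deg 1=\bar e$ and the grading of $V$, is denoted $\mathcal J_{\mathbb C}(\kappa)$ for $\mathbb F=\mathbb C$ and $\mathcal J(\kappa,\sigma)$ for $\mathbb F=\mathbb R$ (it is unique up to graded isomorphism). Let $\tau:\overline G_{[2]}\to H/H^{[2]}$ be the homomorphism $gH\mapsto g^2H^{[2]}$. 1. If $\mathbb L_e=\mathbb R$, then there is a character $\chi:G\to U$ such that $\mathbb L\cong L_\pi^\chi(\mathbb R)$ as $G$-graded algebras, and for every such $\chi$ the algebra $\mathcal B$ is graded-isomorphic to $L_\pi^\chi(\mathcal J(\kappa,\sigma))$ for a unique balanced function $\kappa:\overline G\to\mathbb Z_{\ge0}$ with finite support and a signature function $\sigma$ for $\kappa$, which is determined up to multiplication by the characters $\overline G_{[2]}\to\{\pm1\}$ that are trivial on $\ker\tau$. That is, there are such $\kappa$ and $\sigma$, and for every balanced $\kappa'$ with finite support and every signature function $\sigma'$ for $\kappa'$, $\mathcal B$ is graded-isomorphic to $L_\pi^\chi(\mathcal J(\kappa',\sigma'))$ if and only if $\kappa'=\kappa$ and $\sigma'=\sigma\mu$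 for some character $\mu:\overline G_{[2]}\to\{\pm1\}$ that is trivial on $\ker\tau$. 2. If $\mathbb L_e\cong\mathbb C$, then $\mathcal B$ is graded-isomorphic (as a real algebra) to $L_\pi(\mathcal J_{\mathbb C}(\kappa))$ for a unique balanced function $\kappa:\overline G\to\mathbb Z_{\ge0}$ with finite support. -/

import Mathlib

open scoped TensorProduct

noncomputable section

namespace GradedJordan

/-! ### Graded algebras (not necessarily associative) -/

section Graded

variable {F : Type*} [Field F] {G : Type*} [CommGroup G]
  {A : Type*} [NonUnitalNonAssocRing A] [Module F A]

/-- The subspaces `𝒜 g` form a `G`-grading of the algebra `A`: `A` is their direct sum and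
`𝒜 g * 𝒜 h ⊆ 𝒜 (g * h)`. -/
structure IsGrading (𝒜 : G → Submodule F A) : Prop where
  indep : iSupIndep 𝒜
  iSup_eq_top : ⨆ g, 𝒜 g = ⊤
  mul_mem : ∀ {g h : G} {a b : A}, a ∈ 𝒜 g → b ∈ 𝒜 h → a * b ∈ 𝒜 (g * h)

/-- A subspace `I` is a graded (two-sided) ideal: it absorbs multiplication on both sides and it is
the sum of its homogeneous components `I ∩ 𝒜 g`. -/
structure IsGradedIdeal (𝒜 : G → Submodule F A) (I : Submodule F A) : Prop where
  mul_left : ∀ (a : A) {x : A}, x ∈ I → a * x ∈ I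
  mul_right : ∀ (a : A) {x : A}, x ∈ I → x * a ∈ I
  graded : I = ⨆ g, I ⊓ 𝒜 g

/-- A graded algebra is graded-simple if its multiplication is nonzero and its only graded ideals
are `0` and the whole algebra. -/
structure IsGradedSimple (𝒜 : G → Submodule F A) : Prop where
  mul_ne_zero : ∃ a b : A, a * b ≠ 0
  eq_bot_or_eq_top : ∀ I : Submodule F A, IsGradedIdeal 𝒜 I → I = ⊥ ∨ I = ⊤

/-- Two real `G`-graded algebras are graded-isomorphic: there is an isomorphism of algebras that
preserves degrees. -/
def GradedIso {A B : Type*} [NonUnitalNonAssocSemiring A] [Module ℝ A]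
    [NonUnitalNonAssocSemiring B] [Module ℝ B]
    (𝒜 : G → Submodule ℝ A) (ℬ : G → Submodule ℝ B) : Prop :=
  ∃ ψ : A →ₙₐ[ℝ] B, Function.Bijective ψ ∧ ∀ g, ∀ a ∈ 𝒜 g, ψ a ∈ ℬ g

/-- The subalgebra `⨁ g, 𝒞 g` of an algebra `R`, for a family of subspaces `𝒞 g` such that
`𝒞 g * 𝒞 h ⊆ 𝒞 (g * h)`. -/
def sumSubalgebra {R : Type*} [NonUnitalNonAssocRing R] [Module F R] [SMulCommClass F R R]
    [IsScalarTower F R R] (𝒞 : G → Submodule F R)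
    (hmul : ∀ {g h : G} {x y : R}, x ∈ 𝒞 g → y ∈ 𝒞 h → x * y ∈ 𝒞 (g * h)) :
    NonUnitalSubalgebra F R :=
  { (⨆ g, 𝒞 g : Submodule F R) with
    mul_mem' := by
      intro x y hx hy
      change x ∈ (⨆ g, 𝒞 g : Submodule F R) at hx
      change y ∈ (⨆ g, 𝒞 g : Submodule F R) at hy
      change x * y ∈ (⨆ g, 𝒞 g : Submodule F R)
      induction hx using Submodule.iSup_induction' with
      | zero => simp
      | add x₁ x₂ _ _ h₁ h₂ => rw [add_mul]; exact add_mem h₁ h₂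
      | mem g x hx =>
        induction hy using Submodule.iSup_induction' with
        | zero => simp
        | add y₁ y₂ _ _ h₁ h₂ => rw [mul_add]; exact add_mem h₁ h₂
        | mem h y hy => exact Submodule.mem_iSup_of_mem (g * h) (hmul hx hy) }

end Graded

/-! ### The center -/

section Center

variable (F : Type*) [Field F] (B : Type*) [NonAssocRing B] [Module F B] [SMulCommClass F B B]
  [IsScalarTower F B B]

/-- The center of a unital algebra: the elements that commute and associate with all elements. -/
abbrev Center : NonUnitalSubalgebra F B := NonUnitalSubalgebra.center F B

instance Center.instCommRing : CommRing (Center F B) :=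
  { (inferInstance : NonUnitalCommRing (Center F B)) with
    one := ⟨1, Set.one_mem_center⟩
    one_mul := fun x => Subtype.ext (one_mul (x : B))
    mul_one := fun x => Subtype.ext (mul_one (x : B)) }

/-- The algebra as a module over its center. -/
instance Center.instModule : Module (Center F B) B where
  smul c x := (c : B) * x
  one_smul x := one_mul x
  mul_smul c d x := (c.2.left_assoc (d : B) x).symm
  smul_zero c := mul_zero (c : B)
  smul_add c x y := mul_add (c : B) x y
  add_smul c d x := add_mul (c : B) (d : B) x
  zero_smul x := zero_mul x

instance Center.instIsScalarTower : IsScalarTower (Center F B) B B where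
  smul_assoc c x y := (c.2.left_assoc x y).symm

instance Center.instSMulCommClass : SMulCommClass (Center F B) B B where
  smul_comm c x y := by
    change (c : B) * (x * y) = x * ((c : B) * y)
    rw [c.2.left_assoc, (c.2.comm x).eq, c.2.mid_assoc]

variable {F B}
variable {G : Type*} [CommGroup G]

/-- The homogeneous components of the center `L`, `L_g = L ∩ B_g`. -/
def centerGrading (ℬ : G → Submodule F B) (g : G) : Submodule F (Center F B) :=
  (ℬ g).comap (Center F B).toSubmodule.subtype

/-- The support of the center. -/
def centerSupport (ℬ : G → Submodule F B) : Set G :=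
  {g | centerGrading ℬ g ≠ ⊥}

/-- `L_e = ℝ`, where `L` is the center: the central elements of degree `e` are the scalars. -/
def CenterOneIsReal {B : Type*} [NonAssocRing B] [Module ℝ B] [SMulCommClass ℝ B B]
    [IsScalarTower ℝ B B] (ℬ : G → Submodule ℝ B) : Prop :=
  centerGrading ℬ 1 = Submodule.span ℝ {1}

/-- `L_e ≅ ℂ` as real algebras, where `L` is the center. -/
def CenterOneIsComplex {B : Type*} [NonAssocRing B] [Module ℝ B] [SMulCommClass ℝ B B]
    [IsScalarTower ℝ B B] (ℬ : G → Submodule ℝ B) : Prop :=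
  ∃ ψ : ℂ →ₙₐ[ℝ] Center ℝ B, Function.Injective ψ ∧ Set.range ψ = centerGrading ℬ 1

end Center

/-! ### The degree -/

/-- The generic element `∑ i, ξ i • u i` of an algebra `A` with basis `u` over `F`: it lives in the
extension of `A` to the field of rational functions in the indeterminates `ξ i`. -/
def genericElement {F A : Type*} [CommRing F] [NonAssocRing A] [Module F A] {n : ℕ}
    (u : Module.Basis (Fin n) F A) : FractionRing (MvPolynomial (Fin n) F) ⊗[F] A :=
  ∑ i, algebraMap (MvPolynomial (Fin n) F) (FractionRing (MvPolynomial (Fin n) F))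
    (MvPolynomial.X i) ⊗ₜ[F] u i

/-- `d` is the degree of the generic minimal polynomial of the finite-dimensional (strictly
power-associative, unital) algebra `A` over the field `F`, that is, the least degree of a monic
polynomial over the field of rational functions that annihilates the generic element `x`. The power
`x ^ n` is the `n`-th iterate of the multiplication by `x`, applied to `1`. -/
def HasGenericDegree (F A : Type*) [CommRing F] [NonAssocRing A] [Module F A]
    [SMulCommClass F A A] [IsScalarTower F A A] (d : ℕ) : Prop :=
  ∃ (n : ℕ) (u : Module.Basis (Fin n) F A),
    IsLeast {k : ℕ | ∃ p : Polynomial (FractionRing (MvPolynomial (Fin n) F)),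
      p.Monic ∧ p.natDegree = k ∧
      Polynomial.aeval (LinearMap.mulLeft (FractionRing (MvPolynomial (Fin n) F))
        (genericElement u)) p 1 = 0} d

/-- The algebra `B` has degree `d` over its center `L`. Here `L` is a direct product of fields; its
factors are the fields `L ⧸ m`, with `m` a maximal ideal, the corresponding factor of `B` is the
algebra `(L ⧸ m) ⊗ B` (tensor product over `L`) over `L ⧸ m`, and the degree of `B` is the maximum of
the degrees of these factors. -/
def HasDegreeOverCenter (F B : Type*) [Field F] [NonAssocRing B] [Module F B]
    [SMulCommClass F B B] [IsScalarTower F B B] (d : ℕ) : Prop :=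
  (∀ m : MaximalSpectrum (Center F B), ∃ k ≤ d, HasGenericDegree (Center F B ⧸ m.asIdeal)
      ((Center F B ⧸ m.asIdeal) ⊗[Center F B] B) k) ∧
  ∃ m : MaximalSpectrum (Center F B), HasGenericDegree (Center F B ⧸ m.asIdeal)
      ((Center F B ⧸ m.asIdeal) ⊗[Center F B] B) d

/-! ### Loop algebras -/

section Loop

variable {G Γ : Type*} [CommGroup G] [CommGroup Γ]

/-- The homogeneous component `A_{π(g)} ⊗ g` of the loop algebra, as a subspace of `A ⊗ F G`. -/
def loopComponent {F A : Type*} [Field F] [NonUnitalNonAssocRing A] [Module F A] (π : G →* Γ)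
    (𝒜 : Γ → Submodule F A) (g : G) : Submodule F (A ⊗[F] MonoidAlgebra F G) :=
  Submodule.span F {x | ∃ a ∈ 𝒜 (π g), x = a ⊗ₜ[F] MonoidAlgebra.single g (1 : F)}

/-- The loop algebra `L_π(A) = ⨁ g, A_{π(g)} ⊗ g ⊆ A ⊗ F G` of a `Γ`-graded algebra `A`. -/
def loop {F A : Type*} [Field F] [NonUnitalNonAssocRing A] [Module F A] [SMulCommClass F A A]
    [IsScalarTower F A A] (π : G →* Γ) {𝒜 : Γ → Submodule F A} (h𝒜 : IsGrading 𝒜) :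
    NonUnitalSubalgebra F (A ⊗[F] MonoidAlgebra F G) :=
  sumSubalgebra (loopComponent π 𝒜) (by
    intro g h x y hx hy
    induction hx, hy using Submodule.span_induction₂ with
    | mem_mem x y hx hy =>
      obtain ⟨a, ha, rfl⟩ := hx
      obtain ⟨b, hb, rfl⟩ := hy
      refine Submodule.subset_span ⟨a * b, ?_, ?_⟩
      · rw [map_mul]; exact h𝒜.mul_mem ha hb
      · rw [Algebra.TensorProduct.tmul_mul_tmul, MonoidAlgebra.single_mul_single, mul_one]
    | zero_left y _ => simp
    | zero_right x _ => simp
    | add_left x y z _ _ _ h₁ h₂ => rw [add_mul]; exact add_mem h₁ h₂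
    | add_right x y z _ _ _ h₁ h₂ => rw [mul_add]; exact add_mem h₁ h₂
    | smul_left r x y _ _ h => rw [smul_mul_assoc]; exact Submodule.smul_mem _ _ h
    | smul_right r x y _ _ h => rw [mul_smul_comm]; exact Submodule.smul_mem _ _ h)

/-- The `G`-grading of the loop algebra `L_π(A)`. -/
def loopGrading {F A : Type*} [Field F] [NonUnitalNonAssocRing A] [Module F A]
    [SMulCommClass F A A] [IsScalarTower F A A] (π : G →* Γ) {𝒜 : Γ → Submodule F A}
    (h𝒜 : IsGrading 𝒜) (g : G) : Submodule F (loop π h𝒜) :=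
  (loopComponent π 𝒜 g).comap (loop π h𝒜).toSubmodule.subtype

/-- The `G`-grading of the loop algebra `L_π(A)` of a complex graded algebra, where `L_π(A)` is
considered as an algebra over `ℝ`. -/
def loopGradingReal {A : Type*} [NonUnitalNonAssocRing A] [Module ℂ A]
    [SMulCommClass ℂ A A] [IsScalarTower ℂ A A] (π : G →* Γ) {𝒜 : Γ → Submodule ℂ A}
    (h𝒜 : IsGrading 𝒜) (g : G) : Submodule ℝ (loop π h𝒜) :=
  (loopGrading π h𝒜 g).restrictScalars ℝ

/-- The homogeneous component `A_{π(g)} ⊗ u_g` of the real loop algebra with character `χ`, as a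
subspace of `A ⊗ ℂ G`. The real multiples of `u_g` are the elements `z g` with `z = χ(g) * conj z`,
that is, the fixed points in degree `g` of the semilinear action `z g ↦ conj z * χ(g) g` on `ℂ G`. -/
def realLoopComponent {A : Type*} [NonUnitalNonAssocRing A] [Module ℝ A] (π : G →* Γ)
    (χ : G →* Circle) (𝒜 : Γ → Submodule ℝ A) (g : G) :
    Submodule ℝ (A ⊗[ℝ] MonoidAlgebra ℂ G) :=
  Submodule.span ℝ {x | ∃ a ∈ 𝒜 (π g), ∃ z : ℂ, z = (χ g : ℂ) * (starRingEnd ℂ) z ∧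
    x = a ⊗ₜ[ℝ] MonoidAlgebra.single g z}

/-- The real loop algebra `L_π^χ(A) = ⨁ g, A_{π(g)} ⊗ u_g ⊆ A ⊗ ℂ G` of a `Γ`-graded real
algebra `A` and a character `χ` of `G` with values in the unit circle. -/
def realLoop {A : Type*} [NonUnitalNonAssocRing A] [Module ℝ A] [SMulCommClass ℝ A A]
    [IsScalarTower ℝ A A] (π : G →* Γ) (χ : G →* Circle) {𝒜 : Γ → Submodule ℝ A}
    (h𝒜 : IsGrading 𝒜) : NonUnitalSubalgebra ℝ (A ⊗[ℝ] MonoidAlgebra ℂ G) :=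
  sumSubalgebra (realLoopComponent π χ 𝒜) (by
    intro g h x y hx hy
    induction hx, hy using Submodule.span_induction₂ with
    | mem_mem x y hx hy =>
      obtain ⟨a, ha, z, hz, rfl⟩ := hx
      obtain ⟨b, hb, w, hw, rfl⟩ := hy
      refine Submodule.subset_span ⟨a * b, ?_, z * w, ?_, ?_⟩
      · rw [map_mul]; exact h𝒜.mul_mem ha hb
      · rw [map_mul, map_mul, Circle.coe_mul, mul_mul_mul_comm, ← hz, ← hw]
      · rw [Algebra.TensorProduct.tmul_mul_tmul, MonoidAlgebra.single_mul_single]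
    | zero_left y _ => simp
    | zero_right x _ => simp
    | add_left x y z _ _ _ h₁ h₂ => rw [add_mul]; exact add_mem h₁ h₂
    | add_right x y z _ _ _ h₁ h₂ => rw [mul_add]; exact add_mem h₁ h₂
    | smul_left r x y _ _ h => rw [smul_mul_assoc]; exact Submodule.smul_mem _ _ h
    | smul_right r x y _ _ h => rw [mul_smul_comm]; exact Submodule.smul_mem _ _ h)

/-- The `G`-grading of the real loop algebra `L_π^χ(A)`. -/
def realLoopGrading {A : Type*} [NonUnitalNonAssocRing A] [Module ℝ A] [SMulCommClass ℝ A A]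
    [IsScalarTower ℝ A A] (π : G →* Γ) (χ : G →* Circle) {𝒜 : Γ → Submodule ℝ A}
    (h𝒜 : IsGrading 𝒜) (g : G) : Submodule ℝ (realLoop π χ h𝒜) :=
  (realLoopComponent π χ 𝒜 g).comap (realLoop π χ h𝒜).toSubmodule.subtype

end Loop

open Classical in
/-- The trivial grading of a field `F`: every element has degree `e`. -/
def trivialGrading (F : Type*) [Field F] (Γ : Type*) [CommGroup Γ] (g : Γ) : Submodule F F :=
  if g = 1 then ⊤ else ⊥

theorem isGrading_trivialGrading (F : Type*) [Field F] (Γ : Type*) [CommGroup Γ] :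
    IsGrading (trivialGrading F Γ) where
  indep := by
    intro g
    by_cases hg : g = 1
    · have : (⨆ j, ⨆ (_ : j ≠ g), trivialGrading F Γ j) = ⊥ := by
        simp only [iSup_eq_bot]
        intro j hj
        exact if_neg (fun h => hj (h.trans hg.symm))
      rw [this]; exact disjoint_bot_right
    · have : trivialGrading F Γ g = ⊥ := if_neg hg
      rw [this]; exact disjoint_bot_left
  iSup_eq_top := by
    refine top_le_iff.mp (le_trans (le_of_eq ?_) (le_iSup _ (1 : Γ)))
    exact (if_pos rfl).symm
  mul_mem := by
    intro g h a b ha hb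
    unfold trivialGrading at *
    by_cases hg : g = 1
    · by_cases hh : h = 1
      · simp [hg, hh]
      · rw [if_neg hh, Submodule.mem_bot] at hb
        simp [hb]
    · rw [if_neg hg, Submodule.mem_bot] at ha
      simp [ha]

/-! ### Jordan algebras of symmetric bilinear forms -/

section BilinearForm

variable {F V : Type*} [Field F] [AddCommGroup V] [Module F V]

/-- The algebra `J(V, b) = F 1 ⊕ V` of a bilinear form `b` on `V`. -/
@[ext]
structure FormAlgebra (b : LinearMap.BilinForm F V) where
  /-- the coefficient of `1` -/
  scalar : F
  /-- the component in `V` -/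
  vector : V

variable {b : LinearMap.BilinForm F V}

namespace FormAlgebra

/-- The underlying vector space is `F × V`. -/
def equivProd (b : LinearMap.BilinForm F V) : FormAlgebra b ≃ F × V where
  toFun x := (x.scalar, x.vector)
  invFun p := ⟨p.1, p.2⟩

instance : AddCommGroup (FormAlgebra b) := (equivProd b).addCommGroup

instance : Module F (FormAlgebra b) := (equivProd b).module F

/-- `(α 1 + u) (β 1 + v) = (α β + b(u, v)) 1 + (α v + β u)`. -/
instance : Mul (FormAlgebra b) where
  mul x y := ⟨x.scalar * y.scalar + b x.vector y.vector,
    x.scalar • y.vector + y.scalar • x.vector⟩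

instance : One (FormAlgebra b) where
  one := ⟨1, 0⟩

@[simp] theorem scalar_zero : (0 : FormAlgebra b).scalar = 0 := rfl
@[simp] theorem vector_zero : (0 : FormAlgebra b).vector = 0 := rfl
@[simp] theorem scalar_one : (1 : FormAlgebra b).scalar = 1 := rfl
@[simp] theorem vector_one : (1 : FormAlgebra b).vector = 0 := rfl
@[simp] theorem scalar_add (x y : FormAlgebra b) : (x + y).scalar = x.scalar + y.scalar := rfl
@[simp] theorem vector_add (x y : FormAlgebra b) : (x + y).vector = x.vector + y.vector := rfl
@[simp] theorem scalar_smul (r : F) (x : FormAlgebra b) : (r • x).scalar = r * x.scalar := rfl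
@[simp] theorem vector_smul (r : F) (x : FormAlgebra b) : (r • x).vector = r • x.vector := rfl
@[simp] theorem scalar_mul (x y : FormAlgebra b) :
    (x * y).scalar = x.scalar * y.scalar + b x.vector y.vector := rfl
@[simp] theorem vector_mul (x y : FormAlgebra b) :
    (x * y).vector = x.scalar • y.vector + y.scalar • x.vector := rfl

instance : NonAssocRing (FormAlgebra b) :=
  { (inferInstance : AddCommGroup (FormAlgebra b)), (inferInstance : Mul (FormAlgebra b)),
    (inferInstance : One (FormAlgebra b)) with
    left_distrib := fun x y z => by
      ext
      · simp; ring
      · simp; module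
    right_distrib := fun x y z => by
      ext
      · simp; ring
      · simp; module
    zero_mul := fun x => by ext <;> simp
    mul_zero := fun x => by ext <;> simp
    one_mul := fun x => by ext <;> simp
    mul_one := fun x => by ext <;> simp }

instance : IsScalarTower F (FormAlgebra b) (FormAlgebra b) where
  smul_assoc r x y := by
    ext
    · simp; ring
    · simp; module

instance : SMulCommClass F (FormAlgebra b) (FormAlgebra b) where
  smul_comm r x y := by
    ext
    · simp; ring
    · simp; module

/-- The grading of `J(V, b)` coming from a grading of the vector space `V`: the component of degree
`g` is `F_g 1 ⊕ V_g`, where `F` has the trivial grading. -/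
def grading {Γ : Type*} [CommGroup Γ] (b : LinearMap.BilinForm F V) (𝒱 : Γ → Submodule F V)
    (g : Γ) : Submodule F (FormAlgebra b) where
  carrier := {x | x.scalar ∈ trivialGrading F Γ g ∧ x.vector ∈ 𝒱 g}
  add_mem' hx hy := ⟨add_mem hx.1 hy.1, add_mem hx.2 hy.2⟩
  zero_mem' := ⟨zero_mem _, zero_mem _⟩
  smul_mem' r _ hx := ⟨Submodule.smul_mem _ r hx.1, Submodule.smul_mem _ r hx.2⟩

end FormAlgebra

end BilinearForm

/-! ### The graded Jordan algebras determined by dimensions and signatures -/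

section Standard

variable {Γ : Type*} [CommGroup Γ]

/-- The index set of a homogeneous basis with `κ g` elements of each degree `g`. -/
abbrev BasisIndex (κ : Γ → ℕ) : Type _ := Σ g : Γ, Fin (κ g)

/-- The graded vector space `V` with basis `e_{g,i}`, `i < κ g`. -/
abbrev StdSpace (F : Type*) [Field F] (κ : Γ → ℕ) : Type _ := BasisIndex κ →₀ F

/-- The component `V_g`, spanned by the `e_{g,i}`, `i < κ g`. -/
def stdSpaceGrading (F : Type*) [Field F] (κ : Γ → ℕ) (g : Γ) : Submodule F (StdSpace F κ) :=
  Finsupp.supported F F {x : BasisIndex κ | x.1 = g}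

open Classical in
/-- The bilinear form on `V` such that `b(e_{g,i}, e_{g⁻¹,i}) = ε g i` and all other values of `b` on
basis elements are zero. -/
def stdForm {F : Type*} [Field F] (κ : Γ → ℕ) (ε : Γ → ℕ → F) :
    LinearMap.BilinForm F (StdSpace F κ) :=
  Finsupp.linearCombination F fun x : BasisIndex κ =>
    Finsupp.linearCombination F fun y : BasisIndex κ =>
      if y.1 = x.1⁻¹ ∧ (x.2 : ℕ) = (y.2 : ℕ) then ε x.1 x.2 else 0

/-- The algebra `J(V, b)` for the graded space `V` with basis `e_{g,i}` and the form `stdForm κ ε`. -/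
abbrev StdJordan {F : Type*} [Field F] (κ : Γ → ℕ) (ε : Γ → ℕ → F) : Type _ :=
  FormAlgebra (stdForm κ ε)

/-- The `Γ`-grading of `StdJordan κ ε`. -/
abbrev stdJordanGrading {F : Type*} [Field F] (κ : Γ → ℕ) (ε : Γ → ℕ → F) :
    Γ → Submodule F (StdJordan κ ε) :=
  FormAlgebra.grading (stdForm κ ε) (stdSpaceGrading F κ)

/-- `κ` is balanced: `κ(g⁻¹) = κ(g)`. -/
def IsBalanced (κ : Γ → ℕ) : Prop := ∀ g, κ g⁻¹ = κ g

/-- The subgroup `Γ_[2]` of the elements with `g ^ 2 = e`. -/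
abbrev TwoTorsion (Γ : Type*) [CommGroup Γ] : Subgroup Γ := (powMonoidHom 2 : Γ →* Γ).ker

/-- `σ` is a signature function for `κ`: `|σ(g)| ≤ κ(g)` and `σ(g) ≡ κ(g) (mod 2)`. -/
def IsSignature (κ : Γ → ℕ) (σ : TwoTorsion Γ → ℤ) : Prop :=
  ∀ g, |σ g| ≤ (κ g : ℤ) ∧ σ g ≡ (κ g : ℤ) [ZMOD 2]

open Classical in
/-- The signs on the diagonal of `b` restricted to `V_g`: for `g ^ 2 = e`, the first
`p = (κ(g) + σ(g)) / 2` of the `κ(g)` signs are `1` and the other `q = (κ(g) - σ(g)) / 2` are `-1`, so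
that the signature is `p - q = σ(g)`. For `g ^ 2 ≠ e` the bases of `V_g` and `V_{g⁻¹}` are dual. -/
def realSign (κ : Γ → ℕ) (σ : TwoTorsion Γ → ℤ) (g : Γ) (i : ℕ) : ℝ :=
  if h : g ∈ TwoTorsion Γ then
    if 2 * (i : ℤ) < κ g + σ ⟨g, h⟩ then 1 else -1
  else 1

theorem stdForm_eq_zero {F : Type*} [Field F] (κ : Γ → ℕ) (ε : Γ → ℕ → F) {g h : Γ}
    {u v : StdSpace F κ} (hu : u ∈ stdSpaceGrading F κ g) (hv : v ∈ stdSpaceGrading F κ h)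
    (hgh : g * h ≠ 1) : stdForm κ ε u v = 0 := by
  rw [stdForm, Finsupp.linearCombination_apply, Finsupp.sum, LinearMap.sum_apply]
  refine Finset.sum_eq_zero fun x hx => ?_
  rw [LinearMap.smul_apply, Finsupp.linearCombination_apply, Finsupp.sum, Finset.sum_eq_zero,
    smul_zero]
  intro y hy
  have h1 : x.1 = g := (Finsupp.mem_supported F u).1 hu hx
  have h2 : y.1 = h := (Finsupp.mem_supported F v).1 hv hy
  rw [if_neg, smul_zero]
  rintro ⟨h3, -⟩
  rw [h1, h2] at h3
  exact hgh (by rw [h3, mul_inv_cancel])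

theorem isGrading_stdJordanGrading {F : Type*} [Field F] (κ : Γ → ℕ) (ε : Γ → ℕ → F) :
    IsGrading (stdJordanGrading κ ε) where
  indep := by
    intro g
    let N : Submodule F (StdJordan κ ε) :=
      { carrier := {x | (g = 1 → x.scalar = 0) ∧
          x.vector ∈ Finsupp.supported F F {y : BasisIndex κ | y.1 = g}ᶜ}
        add_mem' := fun {x y} hx hy => ⟨fun h => by simp [hx.1 h, hy.1 h], add_mem hx.2 hy.2⟩
        zero_mem' := ⟨fun _ => rfl, zero_mem _⟩
        smul_mem' := fun r x hx => ⟨fun h => by simp [hx.1 h], Submodule.smul_mem _ r hx.2⟩ }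
    have hN : (⨆ j, ⨆ (_ : j ≠ g), stdJordanGrading κ ε j) ≤ N := by
      refine iSup₂_le fun j hj x hx => ⟨fun h => ?_, ?_⟩
      · have h0 := hx.1
        rwa [trivialGrading, if_neg (fun h' => hj (h'.trans h.symm)), Submodule.mem_bot] at h0
      · refine Finsupp.supported_mono ?_ hx.2
        intro y hy hy'
        exact hj (Eq.trans (Eq.symm hy) hy')
    refine Disjoint.mono_right hN (Submodule.disjoint_def.2 fun x hx hx' => ?_)
    ext1
    · by_cases hg : g = 1
      · exact hx'.1 hg
      · have h0 := hx.1
        rwa [trivialGrading, if_neg hg, Submodule.mem_bot] at h0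
    · exact (Submodule.disjoint_def.1
        (Finsupp.disjoint_supported_supported (M := F) (R := F) disjoint_compl_right)) _ hx.2 hx'.2
  iSup_eq_top := by
    refine Submodule.eq_top_iff'.2 fun x => ?_
    have h1 : ∀ a : F, (⟨a, 0⟩ : StdJordan κ ε) ∈ ⨆ g, stdJordanGrading κ ε g := fun a =>
      Submodule.mem_iSup_of_mem 1 ⟨by simp [trivialGrading], zero_mem _⟩
    have h2 : ∀ v, (⟨0, v⟩ : StdJordan κ ε) ∈ ⨆ g, stdJordanGrading κ ε g := by
      intro v
      induction v using Finsupp.induction_linear with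
      | zero => exact h1 0
      | add u v hu hv =>
        have : (⟨0, u + v⟩ : StdJordan κ ε) = ⟨0, u⟩ + ⟨0, v⟩ := by ext1 <;> simp
        rw [this]
        exact add_mem hu hv
      | single i a =>
        exact Submodule.mem_iSup_of_mem i.1 ⟨zero_mem _, Finsupp.single_mem_supported F a rfl⟩
    have : x = (⟨x.scalar, 0⟩ : StdJordan κ ε) + ⟨0, x.vector⟩ := by ext1 <;> simp
    rw [this]
    exact add_mem (h1 _) (h2 _)
  mul_mem := by
    intro g h x y hx hy
    obtain ⟨hx1, hx2⟩ := hx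
    obtain ⟨hy1, hy2⟩ := hy
    have key : ∀ {k : Γ} {a : F}, a ∈ trivialGrading F Γ k → k = 1 ∨ a = 0 := by
      intro k a ha
      by_cases hk : k = 1
      · exact Or.inl hk
      · rw [trivialGrading, if_neg hk, Submodule.mem_bot] at ha
        exact Or.inr ha
    refine ⟨?_, ?_⟩
    · rw [FormAlgebra.scalar_mul]
      refine add_mem ((isGrading_trivialGrading F Γ).mul_mem hx1 hy1) ?_
      by_cases hgh : g * h = 1
      · simp [trivialGrading, hgh]
      · rw [stdForm_eq_zero κ ε hx2 hy2 hgh]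
        exact zero_mem _
    · rw [FormAlgebra.vector_mul]
      refine add_mem ?_ ?_
      · rcases key hx1 with rfl | h0
        · rw [one_mul]; exact Submodule.smul_mem _ _ hy2
        · rw [h0, zero_smul]; exact zero_mem _
      · rcases key hy1 with rfl | h0
        · rw [mul_one]; exact Submodule.smul_mem _ _ hx2
        · rw [h0, zero_smul]; exact zero_mem _

/-- The real `Γ`-graded Jordan algebra `J(κ, σ)`, as a type. -/
abbrev RealJordan (κ : Γ → ℕ) (σ : TwoTorsion Γ → ℤ) : Type _ := StdJordan κ (realSign κ σ)

/-- The `Γ`-grading of `J(κ, σ)`. -/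
abbrev realJordanGrading (κ : Γ → ℕ) (σ : TwoTorsion Γ → ℤ) :
    Γ → Submodule ℝ (RealJordan κ σ) :=
  stdJordanGrading κ (realSign κ σ)

theorem isGrading_realJordanGrading (κ : Γ → ℕ) (σ : TwoTorsion Γ → ℤ) :
    IsGrading (realJordanGrading κ σ) :=
  isGrading_stdJordanGrading κ (realSign κ σ)

/-- The complex `Γ`-graded Jordan algebra `J_ℂ(κ)`, as a type. -/
abbrev ComplexJordan (κ : Γ → ℕ) : Type _ := StdJordan κ (fun _ _ => (1 : ℂ))

/-- The `Γ`-grading of `J_ℂ(κ)`. -/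
abbrev complexJordanGrading (κ : Γ → ℕ) : Γ → Submodule ℂ (ComplexJordan κ) :=
  stdJordanGrading κ (fun _ _ => (1 : ℂ))

theorem isGrading_complexJordanGrading (κ : Γ → ℕ) : IsGrading (complexJordanGrading κ) :=
  isGrading_stdJordanGrading κ (fun _ _ => (1 : ℂ))

end Standard

/-! ### The homomorphism `τ` -/

section Tau

variable {G : Type*} [CommGroup G] (H : Subgroup G)

/-- The subgroup `H^[2]` of the squares of elements of `H`. -/
abbrev Squares (H : Type*) [CommGroup H] : Subgroup H := (powMonoidHom 2 : H →* H).range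

theorem sq_mem_of_mem_twoTorsion {g : G} (hg : (g : G ⧸ H) ∈ TwoTorsion (G ⧸ H)) : g ^ 2 ∈ H := by
  rw [MonoidHom.mem_ker, powMonoidHom_apply, ← QuotientGroup.mk_pow, QuotientGroup.eq_one_iff] at hg
  exact hg

theorem tau_aux {g g' : G} (hg : g ^ 2 ∈ H) (hg' : g' ^ 2 ∈ H) (h : (g : G ⧸ H) = g') :
    (QuotientGroup.mk (⟨g ^ 2, hg⟩ : H) : H ⧸ Squares H) = QuotientGroup.mk ⟨g' ^ 2, hg'⟩ := by
  rw [QuotientGroup.eq] at h ⊢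
  refine ⟨⟨g⁻¹ * g', h⟩, Subtype.ext ?_⟩
  simp [mul_pow]

/-- The homomorphism `τ : (G/H)_[2] → H/H^[2]`, `g H ↦ g ^ 2 H^[2]`. -/
def tau : TwoTorsion (G ⧸ H) →* H ⧸ Squares H :=
  MonoidHom.mk' (fun x => QuotientGroup.mk ⟨(Quotient.out (x : G ⧸ H)) ^ 2,
      sq_mem_of_mem_twoTorsion H (by rw [QuotientGroup.out_eq']; exact x.2)⟩) (by
    intro x y
    rw [← QuotientGroup.mk_mul]
    have hx : (Quotient.out (x : G ⧸ H)) ^ 2 ∈ H :=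
      sq_mem_of_mem_twoTorsion H (by rw [QuotientGroup.out_eq']; exact x.2)
    have hy : (Quotient.out (y : G ⧸ H)) ^ 2 ∈ H :=
      sq_mem_of_mem_twoTorsion H (by rw [QuotientGroup.out_eq']; exact y.2)
    have hxy : (Quotient.out (x : G ⧸ H) * Quotient.out (y : G ⧸ H)) ^ 2 ∈ H := by
      rw [mul_pow]; exact mul_mem hx hy
    refine (tau_aux H _ hxy ?_).trans ?_
    · rw [QuotientGroup.mk_mul, QuotientGroup.out_eq', QuotientGroup.out_eq',
        QuotientGroup.out_eq', Subgroup.coe_mul]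
    · congr 1
      exact Subtype.ext (mul_pow _ _ 2))

theorem tau_mk (g : G) (hg : (g : G ⧸ H) ∈ TwoTorsion (G ⧸ H)) :
    tau H ⟨g, hg⟩ = QuotientGroup.mk ⟨g ^ 2, sq_mem_of_mem_twoTorsion H hg⟩ :=
  tau_aux H _ _ (QuotientGroup.out_eq' _)

end Tau

end GradedJordan

end

open GradedJordan

open scoped TensorProduct

noncomputable section

namespace GradedJordan

/-! Let `L` be the center. The multiples of a nonzero homogeneous central element form a nonzero
graded ideal, so such an element is invertible. Hence the support `H` of `L` is a group, each `L_h`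
with `h ∈ H` is a line over the field `L_e`, and `L_e` is `ℝ` or `ℂ`. A trace argument shows that
`L` is reduced, so it is a product of fields, and the degree hypothesis on the factors glues to one
relation: every `a ∈ B` satisfies `a² = c a + l` with `c, l ∈ L` (`IsGradedSimple.sq_eq`).

Completing the square splits each homogeneous element into a central part and a part with central
square. The key fact is that products of the latter parts are central (`IsPure.mul_mem`), so they
span a graded `L`-module `V` with `B = L ⊕ V` and `V V ⊆ L`. The radical of `V × V → L` is a graded
ideal, hence zero (`IsGradedSimple.exists_isCenterProj`).

The `L`-valued form is turned into forms over `K = L_e` by a homomorphism `ρ : L → ℂ` and numbers `z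
g` with `ρ(L_g) ⊆ K z g`. In the complex case `z g = 1`; in the real case `z g` spans the line fixed
by `w ↦ χ(g) conj w`, where `χ(h) = ρ(l) / conj ρ(l)` for `0 ≠ l ∈ L_h`. Homogeneous units of `L`
carry `V_g` onto `V_{hg}`, so one representative of each coset of `H` suffices. The forms `ρ(t(v w))
/ (z g z k)` pair inverse cosets nondegenerately; dual and diagonal bases identify them with the
standard form (`exists_isometry_stdSpace`), and `IsLoopDatum.exists_hom` assembles the isomorphism
with the loop algebra.

For uniqueness in the real case, every isomorphism onto a loop algebra comes from some `ρ'` with the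
same `z` (`IsLoopEmbedding.exists_datum`). The dimensions of the `V_g` do not depend on `ρ'`. On
`L_h` one has `ρ' = c_h ρ` with `c_h` real, and the signs of the `c_h` form a homomorphism `ν : H →
{±1}`, trivial on squares. The form on `V_g` is rescaled by the ratio at `g²`, so the signature at
`gH` is multiplied by `ν(g²)`, that is, by `ν ∘ τ`. Conversely, a character trivial on `ker τ`
factors in this way, by linear algebra over the field with two elements, and twisting `ρ` by `ν`
realizes it. In the complex case `κ` is read off from the dimensions of the `B_g`. -/

set_option linter.unusedSectionVars false

/-! ### Homogeneous components and projections -/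

section Components

variable {F : Type*} [Field F] {G : Type*} [CommGroup G]
  {A : Type*} [NonUnitalNonAssocRing A] [Module F A] {𝒜 : G → Submodule F A}

open Classical in
theorem IsGrading.isInternal (h : IsGrading 𝒜) : DirectSum.IsInternal 𝒜 :=
  (DirectSum.isInternal_submodule_iff_iSupIndep_and_iSup_eq_top 𝒜).2 ⟨h.indep, h.iSup_eq_top⟩

open Classical in
/-- The projection onto the homogeneous component of degree `g`. -/
def IsGrading.proj (h : IsGrading 𝒜) (g : G) : A →ₗ[F] A :=
  (𝒜 g).subtype ∘ₗ DirectSum.component F G (fun g => 𝒜 g) g ∘ₗ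
    (LinearEquiv.ofBijective (DirectSum.coeLinearMap 𝒜) h.isInternal).symm.toLinearMap

theorem IsGrading.proj_mem (h : IsGrading 𝒜) (g : G) (x : A) : h.proj g x ∈ 𝒜 g := by
  simp [IsGrading.proj]

open Classical in
theorem IsGrading.proj_apply (h : IsGrading 𝒜) {g k : G} {x : A} (hx : x ∈ 𝒜 k) :
    h.proj g x = if k = g then x else 0 := by
  have h1 : (LinearEquiv.ofBijective (DirectSum.coeLinearMap 𝒜) h.isInternal).symm x =
      DirectSum.lof F G (fun g => 𝒜 g) k ⟨x, hx⟩ := by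
    rw [LinearEquiv.symm_apply_eq]
    exact (DirectSum.coeLinearMap_lof 𝒜 k ⟨x, hx⟩).symm
  simp only [IsGrading.proj, LinearMap.comp_apply, LinearEquiv.coe_coe, h1]
  by_cases hk : k = g
  · subst hk; simp
  · rw [if_neg hk, DirectSum.component.of, dif_neg hk]; simp

theorem IsGrading.proj_same (h : IsGrading 𝒜) {g : G} {x : A} (hx : x ∈ 𝒜 g) :
    h.proj g x = x := by rw [h.proj_apply hx, if_pos rfl]

theorem IsGrading.proj_ne (h : IsGrading 𝒜) {g k : G} {x : A} (hx : x ∈ 𝒜 k) (hk : k ≠ g) :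
    h.proj g x = 0 := by rw [h.proj_apply hx, if_neg hk]

@[elab_as_elim]
theorem IsGrading.induction (h : IsGrading 𝒜) {P : A → Prop} (x : A)
    (mem : ∀ g, ∀ x ∈ 𝒜 g, P x) (zero : P 0) (add : ∀ x y, P x → P y → P (x + y)) : P x :=
  Submodule.iSup_induction 𝒜 (motive := P) (h.iSup_eq_top ▸ Submodule.mem_top : x ∈ ⨆ g, 𝒜 g) mem zero add

/-- Every larger finite set is allowed, so that two elements can be expanded over a common set. -/
theorem IsGrading.exists_sum (h : IsGrading 𝒜) (x : A) :
    ∃ T : Finset G, ∀ S : Finset G, T ⊆ S → x = ∑ g ∈ S, h.proj g x := by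
  classical
  refine h.induction x (fun g x hx => ⟨{g}, fun S hS => ?_⟩) ⟨∅, fun S _ => by simp⟩ ?_
  · rw [Finset.sum_eq_single g, h.proj_same hx]
    · intro k _ hk; exact h.proj_ne hx hk.symm
    · intro hg; exact absurd (hS (Finset.mem_singleton_self g)) hg
  · rintro x y ⟨T, hT⟩ ⟨T', hT'⟩
    refine ⟨T ∪ T', fun S hS => ?_⟩
    simp only [map_add, Finset.sum_add_distrib]
    rw [← hT S (Finset.union_subset_left hS), ← hT' S (Finset.union_subset_right hS)]

theorem IsGrading.ext (h : IsGrading 𝒜) {x y : A} (hxy : ∀ g, h.proj g x = h.proj g y) :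
    x = y := by
  classical
  obtain ⟨T, hT⟩ := h.exists_sum x
  obtain ⟨T', hT'⟩ := h.exists_sum y
  rw [hT (T ∪ T') Finset.subset_union_left, hT' (T ∪ T') Finset.subset_union_right]
  exact Finset.sum_congr rfl fun g _ => hxy g

theorem IsGrading.proj_mul_left (h : IsGrading 𝒜) {k : G} {a : A} (ha : a ∈ 𝒜 k) (g : G) (x : A) :
    h.proj g (a * x) = a * h.proj (k⁻¹ * g) x := by
  refine h.induction x (fun m x hx => ?_) (by simp) (fun x y hx hy => ?_)
  · rw [h.proj_apply (h.mul_mem ha hx), h.proj_apply hx]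
    by_cases hm : k * m = g
    · rw [if_pos hm, if_pos (by rw [← hm]; group)]
    · rw [if_neg hm, if_neg (fun h' => hm (by rw [h']; group)), mul_zero]
  · simp only [mul_add, map_add, hx, hy]

theorem IsGrading.proj_mul_right (h : IsGrading 𝒜) {k : G} {a : A} (ha : a ∈ 𝒜 k) (g : G) (x : A) :
    h.proj g (x * a) = h.proj (g * k⁻¹) x * a := by
  refine h.induction x (fun m x hx => ?_) (by simp) (fun x y hx hy => ?_)
  · rw [h.proj_apply (h.mul_mem hx ha), h.proj_apply hx]
    by_cases hm : m * k = g
    · rw [if_pos hm, if_pos (by rw [← hm]; group)]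
    · rw [if_neg hm, if_neg (fun h' => hm (by rw [h']; group)), zero_mul]
  · simp only [add_mul, map_add, hx, hy]

/-- The component of degree `e` of `1` is a right identity: compare components of degree `g` in `x *
1 = x` for `x` of degree `g`. -/
theorem IsGrading.one_mem {A : Type*} [NonAssocRing A] [Module F A] {𝒜 : G → Submodule F A}
    (h : IsGrading 𝒜) : (1 : A) ∈ 𝒜 1 := by
  have key : h.proj 1 (1 : A) = 1 := by
    have : ∀ x : A, x * h.proj 1 1 = x := by
      intro x
      refine h.induction x (fun g x hx => ?_) (by simp) (fun x y hx hy => ?_)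
      · have := h.proj_mul_left hx g 1
        rwa [mul_one, h.proj_same hx, inv_mul_cancel, eq_comm] at this
      · rw [add_mul, hx, hy]
    simpa using this 1
  rw [← key]; exact h.proj_mem 1 1

end Components

/-! ### The center of a graded-simple algebra as a graded field -/

section CenterGrading

variable {F : Type*} [Field F] {G : Type*} [CommGroup G]
  {B : Type*} [NonAssocCommRing B] [Module F B] [SMulCommClass F B B] [IsScalarTower F B B]
  {ℬ : G → Submodule F B}

theorem mem_center_of_assoc {c : B} (h : ∀ y z : B, c * (y * z) = c * y * z) : c ∈ Center F B :=
  ⟨fun a => mul_comm c a, h, fun a b => by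
    rw [mul_comm, mul_comm a b, h, mul_comm (c * b), mul_comm c b]⟩

theorem center_smul_def (c : Center F B) (x : B) : c • x = (c : B) * x := rfl

theorem center_coe_mul (c d : Center F B) : ((c * d : Center F B) : B) = c * d := rfl

theorem center_smul_one (c : Center F B) : c • (1 : B) = c := mul_one (c : B)

/-- For `y`, `z` of degrees `m`, `n`, the component of degree `g m n` of `(c y) z = c (y z)`
involves only the component of `c` of degree `g`. -/
theorem IsGrading.proj_center_mem (h : IsGrading ℬ) (g : G) (c : Center F B) :
    h.proj g (c : B) ∈ Center F B := by
  refine mem_center_of_assoc fun y z => ?_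
  refine h.induction y (fun m y hy => ?_) (by simp) (fun x y hx hy => ?_)
  · refine h.induction z (fun n z hz => ?_) (by simp) (fun x y hx hy => ?_)
    · have := congrArg (h.proj (g * m * n)) (c.2.left_assoc y z)
      rw [h.proj_mul_right (h.mul_mem hy hz), h.proj_mul_right hz, h.proj_mul_right hy] at this
      have e1 : g * m * n * (m * n)⁻¹ = g := by group
      have e2 : g * m * n * n⁻¹ * m⁻¹ = g := by group
      rwa [e1, e2] at this
    · simp only [mul_add, hx, hy]
  · simp only [mul_add, add_mul, hx, hy]

theorem mem_centerGrading {g : G} {c : Center F B} : c ∈ centerGrading ℬ g ↔ (c : B) ∈ ℬ g :=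
  Iff.rfl

theorem IsGrading.center (h : IsGrading ℬ) : IsGrading (centerGrading ℬ) where
  indep := by
    rw [iSupIndep_def]
    intro g
    rw [Submodule.disjoint_def]
    intro x hx hx'
    have h1 := (Submodule.disjoint_def.1 (iSupIndep_def.1 h.indep g)) (x : B) hx ?_
    · exact Subtype.ext h1
    · have : (⨆ j, ⨆ (_ : j ≠ g), centerGrading ℬ j) ≤
          (⨆ j, ⨆ (_ : j ≠ g), ℬ j).comap (Center F B).toSubmodule.subtype :=
        iSup₂_le fun j hj x hx => Submodule.mem_iSup_of_mem j (Submodule.mem_iSup_of_mem hj hx)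
      exact this hx'
  iSup_eq_top := by
    refine Submodule.eq_top_iff'.2 fun x => ?_
    obtain ⟨T, hT⟩ := h.exists_sum (x : B)
    have : x = ∑ g ∈ T, (⟨h.proj g x, h.proj_center_mem g x⟩ : Center F B) := by
      apply Subtype.ext
      rw [AddSubmonoidClass.coe_finsetSum]
      exact hT T subset_rfl
    rw [this]
    exact Submodule.sum_mem _ fun g _ => Submodule.mem_iSup_of_mem g (h.proj_mem g (x : B))
  mul_mem := fun ha hb => h.mul_mem ha hb

theorem IsGrading.coe_proj_center (h : IsGrading ℬ) (g : G) (c : Center F B) :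
    ((h.center.proj g c : Center F B) : B) = h.proj g (c : B) := by
  refine h.center.induction c (fun m c hc => ?_) (by simp) (fun x y hx hy => ?_)
  · rw [h.center.proj_apply hc, h.proj_apply (mem_centerGrading.1 hc)]
    split_ifs <;> rfl
  · rw [map_add]
    change ((h.center.proj g x : Center F B) : B) + ((h.center.proj g y : Center F B) : B) =
      h.proj g ((x : B) + (y : B))
    rw [hx, hy, map_add]

theorem IsGrading.smul_mem (h : IsGrading ℬ) {g k : G} {c : Center F B}
    (hc : c ∈ centerGrading ℬ g) {x : B} (hx : x ∈ ℬ k) : c • x ∈ ℬ (g * k) :=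
  h.mul_mem hc hx

theorem IsGradedSimple.nontrivial (hs : IsGradedSimple ℬ) : Nontrivial B := by
  obtain ⟨a, b, hab⟩ := hs.mul_ne_zero
  exact ⟨⟨_, _, hab⟩⟩

/-- The image of multiplication by `c` is a nonzero graded ideal, so it contains `1`; the inverse is
the component of degree `g⁻¹` of a preimage of `1`. -/
theorem IsGradedSimple.exists_inv (h : IsGrading ℬ) (hs : IsGradedSimple ℬ) {g : G}
    {c : Center F B} (hc : c ∈ centerGrading ℬ g) (h0 : c ≠ 0) :
    ∃ d ∈ centerGrading ℬ g⁻¹, c * d = 1 := by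
  let I : Submodule F B := LinearMap.range (LinearMap.mulLeft F (c : B))
  have hI : IsGradedIdeal ℬ I := by
    have left : ∀ (a : B) {x : B}, x ∈ I → a * x ∈ I := by
      rintro a _ ⟨y, rfl⟩
      exact ⟨a * y, mul_smul_comm c a y |>.symm⟩
    refine ⟨left, fun a x hx => by rw [mul_comm]; exact left a hx, le_antisymm ?_ ?_⟩
    · rintro _ ⟨y, rfl⟩
      refine h.induction y (fun m y hy => ?_) (by simp) (fun x y hx hy => ?_)
      · exact Submodule.mem_iSup_of_mem (g * m) ⟨⟨y, rfl⟩, h.mul_mem hc hy⟩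
      · rw [map_add]; exact add_mem hx hy
    · exact iSup_le fun g => inf_le_left
  have htop : I = ⊤ := by
    refine (hs.eq_bot_or_eq_top I hI).resolve_left fun hbot => h0 ?_
    have : (c : B) ∈ I := ⟨1, mul_one _⟩
    rw [hbot, Submodule.mem_bot] at this
    exact Subtype.ext this
  obtain ⟨y, hy⟩ : (1 : B) ∈ I := htop ▸ Submodule.mem_top
  set d := h.proj g⁻¹ y with hd
  have hcd : (c : B) * d = 1 := by
    have := congrArg (h.proj 1) hy
    rw [LinearMap.mulLeft_apply, h.proj_mul_left (mem_centerGrading.1 hc), h.proj_same h.one_mem, mul_one] at this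
    exact this
  -- Multiplication by `c` is injective, so the associativity of `d` can be tested after multiplying
  -- by `c`, where `c d = 1`.
  have hinj : ∀ x y : B, c • x = c • y → x = y := by
    intro x y hxy
    have : ∀ x : B, d * (c • x) = x := fun x => by
      rw [mul_smul_comm, ← smul_mul_assoc, center_smul_def, hcd, one_mul]
    rw [← this x, hxy, this]
  have hdc : d ∈ Center F B := by
    refine mem_center_of_assoc fun y z => hinj _ _ ?_
    have h1 : c • d = (1 : B) := hcd
    rw [← smul_mul_assoc, ← smul_mul_assoc, ← smul_mul_assoc, h1, one_mul, one_mul]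
  exact ⟨⟨d, hdc⟩, h.proj_mem _ y, Subtype.ext hcd⟩

theorem IsGradedSimple.center_smul_eq_zero (h : IsGrading ℬ) (hs : IsGradedSimple ℬ) {g : G}
    {c : Center F B} (hc : c ∈ centerGrading ℬ g) {x : B} (hcx : c • x = 0) : c = 0 ∨ x = 0 := by
  refine or_iff_not_imp_left.2 fun h0 => ?_
  obtain ⟨d, -, hd⟩ := hs.exists_inv h hc h0
  rw [← one_smul (Center F B) x, ← hd, mul_comm, mul_smul, hcx, smul_zero]

theorem mem_centerSupport {g : G} : g ∈ centerSupport ℬ ↔ ∃ c ∈ centerGrading ℬ g, c ≠ 0 :=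
  Submodule.ne_bot_iff _

/-- The support of the center of a graded-simple algebra, as a subgroup. -/
def supportSubgroup (h : IsGrading ℬ) (hs : IsGradedSimple ℬ) : Subgroup G where
  carrier := centerSupport ℬ
  one_mem' := by
    have := hs.nontrivial
    exact mem_centerSupport.2 ⟨1, h.one_mem, fun h0 => one_ne_zero (congrArg Subtype.val h0 : (1 : B) = 0)⟩
  mul_mem' := by
    intro a b ha hb
    obtain ⟨c, hc, hc0⟩ := mem_centerSupport.1 ha
    obtain ⟨d, hd, hd0⟩ := mem_centerSupport.1 hb
    refine mem_centerSupport.2 ⟨c * d, h.mul_mem hc hd, fun h0 => ?_⟩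
    have h1 : c • (d : B) = 0 := congrArg Subtype.val h0
    rcases hs.center_smul_eq_zero h hc h1 with h2 | h2
    · exact hc0 h2
    · exact hd0 (Subtype.ext h2)
  inv_mem' := by
    intro a ha
    obtain ⟨c, hc, hc0⟩ := mem_centerSupport.1 ha
    obtain ⟨d, hd, hcd⟩ := hs.exists_inv h hc hc0
    refine mem_centerSupport.2 ⟨d, hd, ?_⟩
    rintro rfl
    rw [mul_zero] at hcd
    exact hc0 (by rw [← mul_one c, ← hcd, mul_zero])

end CenterGrading

/-! ### Reducedness of the center -/

section Reduced

variable {F : Type*} [Field F] {G : Type*} [CommGroup G]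
  {B : Type*} [NonAssocCommRing B] [Module F B] [SMulCommClass F B B] [IsScalarTower F B B]
  {ℬ : G → Submodule F B}

instance Center.instAlgebra : Algebra F (Center F B) :=
  Algebra.ofModule (fun r x y => smul_mul_assoc r x y) (fun r x y => mul_smul_comm r x y)

instance Center.instFinite [Module.Finite F B] : Module.Finite F (Center F B) :=
  Module.Finite.of_injective (Center F B).toSubmodule.subtype Subtype.val_injective

open Classical in
-- Multiplication by `a` shifts all degrees by `g ≠ 1`, so it has no diagonal blocks.
theorem IsGrading.trace_mulLeft {A : Type*} [NonUnitalNonAssocRing A] [Module F A]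
    [SMulCommClass F A A] [IsScalarTower F A A] [Module.Finite F A] {𝒜 : G → Submodule F A}
    (h : IsGrading 𝒜) {g : G} (hg : g ≠ 1) {a : A} (ha : a ∈ 𝒜 g) :
    LinearMap.trace F A (LinearMap.mulLeft F a) = 0 :=
  LinearMap.trace_eq_zero_of_mapsTo_ne h.isInternal (fun k => g * k) (by simpa using hg)
    fun _ _ hx => h.mul_mem ha hx

/-- A nonzero nilpotent `x` has a multiple `d x` whose component of degree `e` is `1`. The other
components do not contribute to the trace of multiplication by `d x`, which is therefore `dim L ≠ 0`
in characteristic zero; but a nilpotent operator has trace zero. -/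
theorem IsGradedSimple.center_isReduced [CharZero F] [Module.Finite F B] (h : IsGrading ℬ)
    (hs : IsGradedSimple ℬ) : IsReduced (Center F B) := by
  refine ⟨fun x hx => ?_⟩
  by_contra hx0
  obtain ⟨g, hg⟩ : ∃ g, h.center.proj g x ≠ 0 := by
    by_contra! hall
    exact hx0 (h.center.ext fun g => by rw [hall, map_zero])
  obtain ⟨d, hd, hdx⟩ := hs.exists_inv h (h.center.proj_mem g x) hg
  have h1 : h.center.proj 1 (d * x) = 1 := by
    rw [h.center.proj_mul_left hd, inv_inv, mul_one, mul_comm, hdx]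
  have hT : ∀ y : Center F B, LinearMap.trace F _ (LinearMap.mulLeft F y) =
      LinearMap.trace F _ (LinearMap.mulLeft F (h.center.proj 1 y)) := by
    intro y
    refine h.center.induction y (fun g y hy => ?_) (by simp) (fun y z hy hz => ?_)
    · by_cases hg : g = 1
      · subst hg; rw [h.center.proj_same hy]
      · rw [h.center.trace_mulLeft hg hy, h.center.proj_ne hy hg]; simp
    · have e : ∀ a b : Center F B, LinearMap.mulLeft F (a + b) =
          LinearMap.mulLeft F a + LinearMap.mulLeft F b := fun a b => by
        ext z; simp [add_mul]
      rw [e, map_add, hy, hz, map_add, e, map_add]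
  have hnil : IsNilpotent (LinearMap.mulLeft F (d * x)) := by
    have := ((Commute.all d x).isNilpotent_mul_left hx)
    exact this.map (Algebra.lmul F (Center F B))
  have h2 := (LinearMap.isNilpotent_trace_of_isNilpotent hnil).eq_zero
  rw [hT, h1, LinearMap.mulLeft_one, LinearMap.trace_id, Nat.cast_eq_zero] at h2
  have := Module.finrank_zero_iff.1 h2
  exact hx0 (Subsingleton.elim _ _)

/-- A reduced Artinian ring is semisimple, so `m` has a complementary ideal, and the component of
`1` in it annihilates `m`. -/
theorem exists_annihilator_notMem {R : Type*} [CommRing R] [IsReduced R] [IsArtinianRing R]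
    (m : Ideal R) [hm : m.IsMaximal] : ∃ ε ∉ m, ∀ x ∈ m, ε * x = 0 := by
  have : IsSemisimpleRing R := IsArtinianRing.isSemisimpleRing_of_isReduced R
  obtain ⟨J, hJ⟩ := exists_isCompl m
  obtain ⟨a, ha, b, hb, hab⟩ := Submodule.mem_sup.1 (hJ.sup_eq_top ▸ Submodule.mem_top :
    (1 : R) ∈ m ⊔ J)
  refine ⟨b, fun hbm => hm.ne_top ((Ideal.eq_top_iff_one _).2 (hab ▸ add_mem ha hbm)),
    fun x hx => ?_⟩
  exact (Submodule.mem_bot R).1 (hJ.inf_eq_bot ▸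
    ⟨m.mul_mem_left b hx, J.mul_mem_right x hb⟩)

end Reduced

/-! ### The quadratic relation over the center -/

section Quadratic

/-- In degree zero the algebra is trivial and in degree one `X` is a multiple of `1`; both give a
quadratic relation with `β = 0`. -/
theorem exists_sq_eq_of_aeval_mulLeft {E M : Type*} [Field E] [NonAssocRing M] [Module E M]
    [SMulCommClass E M M] [IsScalarTower E M M] (X : M) {p : Polynomial E} (hp : p.Monic)
    (hdeg : p.natDegree ≤ 2) (hp0 : Polynomial.aeval (LinearMap.mulLeft E X) p 1 = 0) :
    ∃ α β : E, X * X = α • X + β • (1 : M) := by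
  have hmonic := hp.coeff_natDegree
  rw [Polynomial.aeval_eq_sum_range, LinearMap.sum_apply] at hp0
  generalize p.natDegree = k at *
  interval_cases k
  · simp [hmonic] at hp0
    refine ⟨0, 0, ?_⟩
    rw [← mul_one (X * X), hp0]; simp
  · simp [Finset.sum_range_succ, hmonic] at hp0
    refine ⟨-p.coeff 0, 0, ?_⟩
    have hX : X = (-p.coeff 0) • (1 : M) := by
      rw [neg_smul, eq_neg_iff_add_eq_zero, add_comm]; exact hp0
    rw [zero_smul, add_zero]
    nth_rewrite 1 [hX]
    rw [smul_mul_assoc, one_mul]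
  · simp [Finset.sum_range_succ, hmonic, pow_two] at hp0
    refine ⟨-p.coeff 1, -p.coeff 0, ?_⟩
    rw [neg_smul, neg_smul, ← neg_add, eq_neg_iff_add_eq_zero, ← hp0]
    abel

/-- The coefficients `α`, `β` are rational functions whose denominators may vanish at `a`, so they
cannot be specialized. However, the relation makes the coordinate vectors of `1`, `X`, `X²`
dependent; the vanishing of their `3 × 3` minors is a polynomial identity, which can be evaluated at
`a`. -/
theorem sq_eq_of_genericDegree {F A : Type*} [Field F] [NonAssocRing A] [Module F A]
    [SMulCommClass F A A] [IsScalarTower F A A] {k : ℕ} (hk : k ≤ 2)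
    (h : HasGenericDegree F A k) (a : A) : ∃ s r : F, a * a = s • a + r • (1 : A) := by
  obtain ⟨n, u, ⟨p, hp, hpk, hp0⟩, -⟩ := h
  subst hpk
  obtain ⟨α, β, hαβ⟩ := exists_sq_eq_of_aeval_mulLeft _ hp hk hp0
  generalize hX : genericElement u = X at hαβ
  -- coordinates
  let c : Fin n → Fin n → Fin n → F := fun i j l => u.repr (u i * u j) l
  let o : Fin n → F := fun l => u.repr 1 l
  let q : Fin n → MvPolynomial (Fin n) F := fun l => ∑ i, ∑ j, MvPolynomial.X i * MvPolynomial.X j * MvPolynomial.C (c i j l)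
  have hXr : ∀ l, (u.baseChange (FractionRing (MvPolynomial (Fin n) F))).repr X l = algebraMap (MvPolynomial (Fin n) F) (FractionRing (MvPolynomial (Fin n) F)) (MvPolynomial.X l) := by
    intro l
    simp [← hX, genericElement, Finsupp.single_apply, Module.Basis.baseChange_repr_tmul]
  have hXX : ∀ l, (u.baseChange (FractionRing (MvPolynomial (Fin n) F))).repr (X * X) l = algebraMap (MvPolynomial (Fin n) F) (FractionRing (MvPolynomial (Fin n) F)) (q l) := by
    intro l
    simp only [← hX, genericElement, Finset.sum_mul_sum, Algebra.TensorProduct.tmul_mul_tmul,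
      map_sum, Finsupp.finsetSum_apply, Module.Basis.baseChange_repr_tmul, q, map_mul]
    refine Finset.sum_congr rfl fun i _ => Finset.sum_congr rfl fun j _ => ?_
    rw [Algebra.smul_def, mul_comm]
    congr 1
  have h1r : ∀ l, (u.baseChange (FractionRing (MvPolynomial (Fin n) F))).repr (1 : FractionRing (MvPolynomial (Fin n) F) ⊗[F] A) l =
      algebraMap (MvPolynomial (Fin n) F) (FractionRing (MvPolynomial (Fin n) F)) (MvPolynomial.C (o l)) := by
    intro l
    rw [Algebra.TensorProduct.one_def, Module.Basis.baseChange_repr_tmul, Algebra.smul_def, mul_one]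
    rfl
  have hcoord : ∀ l, algebraMap (MvPolynomial (Fin n) F) (FractionRing (MvPolynomial (Fin n) F)) (q l) = α * algebraMap (MvPolynomial (Fin n) F) (FractionRing (MvPolynomial (Fin n) F)) (MvPolynomial.X l) +
      β * algebraMap (MvPolynomial (Fin n) F) (FractionRing (MvPolynomial (Fin n) F)) (MvPolynomial.C (o l)) := by
    intro l
    rw [← hXX, hαβ, map_add, map_smul, map_smul, Finsupp.add_apply, Finsupp.smul_apply,
      Finsupp.smul_apply, hXr, h1r, smul_eq_mul, smul_eq_mul]
  -- vanishing of the minors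
  have hminor : ∀ i j l, (MvPolynomial.C (o i) * MvPolynomial.X j - MvPolynomial.C (o j) * MvPolynomial.X i) * q l
      = (MvPolynomial.C (o i) * q j - MvPolynomial.C (o j) * q i) * MvPolynomial.X l +
        (q i * MvPolynomial.X j - q j * MvPolynomial.X i) * MvPolynomial.C (o l) := by
    intro i j l
    apply IsFractionRing.injective (MvPolynomial (Fin n) F) (FractionRing (MvPolynomial (Fin n) F))
    simp only [map_mul, map_sub, map_add, hcoord]
    ring
  let v : Fin n → F := fun l => u.repr a l
  have hq : ∀ l, MvPolynomial.eval v (q l) = u.repr (a * a) l := by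
    intro l
    conv_rhs => rw [← u.sum_repr a]
    simp only [q, map_sum, map_mul, MvPolynomial.eval_X, MvPolynomial.eval_C, Finset.sum_mul_sum,
      Finsupp.finsetSum_apply, smul_mul_smul_comm, map_smul, Finsupp.smul_apply, smul_eq_mul, c, v]
  have hev : ∀ i j l, (o i * v j - o j * v i) * u.repr (a * a) l =
      (o i * u.repr (a * a) j - o j * u.repr (a * a) i) * v l +
        (u.repr (a * a) i * v j - u.repr (a * a) j * v i) * o l := by
    intro i j l
    have := congrArg (MvPolynomial.eval v) (hminor i j l)
    simpa only [map_mul, map_sub, map_add, MvPolynomial.eval_X, MvPolynomial.eval_C, hq] using this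
  -- A nonzero `2 × 2` minor of the coordinates of `1` and `a` permits Cramer's rule. If all of them
  -- vanish, then `a` is a multiple of `1`, or `1 = 0`.
  by_cases hδ : ∃ i j, o i * v j - o j * v i ≠ 0
  · obtain ⟨i, j, hij⟩ := hδ
    refine ⟨(o i * v j - o j * v i)⁻¹ * (o i * u.repr (a * a) j - o j * u.repr (a * a) i),
      (o i * v j - o j * v i)⁻¹ * (u.repr (a * a) i * v j - u.repr (a * a) j * v i), ?_⟩
    refine u.repr.injective (Finsupp.ext fun l => ?_)
    simp only [map_add, map_smul, Finsupp.add_apply, Finsupp.smul_apply, smul_eq_mul]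
    apply mul_left_cancel₀ hij
    rw [hev i j l, mul_add, mul_assoc, mul_assoc, mul_inv_cancel_left₀ hij,
      mul_inv_cancel_left₀ hij]
  · push Not at hδ
    by_cases ho : ∃ i, o i ≠ 0
    · obtain ⟨i, hi⟩ := ho
      have ha : a = (v i / o i) • (1 : A) := by
        refine u.repr.injective (Finsupp.ext fun l => ?_)
        simp only [map_smul, Finsupp.smul_apply, smul_eq_mul]
        change v l = v i / o i * o l
        have := hδ i l
        field_simp
        linear_combination this
      refine ⟨v i / o i, 0, ?_⟩
      conv_lhs => rw [ha, smul_mul_assoc, one_mul]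
      simp [← ha]
    · push Not at ho
      have h1 : (1 : A) = 0 := u.repr.injective (Finsupp.ext fun l => by simpa using ho l)
      exact ⟨0, 0, by rw [← mul_one (a * a), h1]; simp⟩

/-- The `c ∈ L` with `c a² ∈ L a + L 1` form an ideal. In the factor at a maximal ideal `m` the
relation holds modulo `m B`, which is annihilated by some `ε ∉ m`. So the ideal lies in no maximal
ideal and contains `1`. -/
theorem IsGradedSimple.sq_eq {F : Type*} [Field F] [CharZero F] {G : Type*} [CommGroup G]
    {B : Type*} [NonAssocCommRing B] [Module F B] [SMulCommClass F B B] [IsScalarTower F B B]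
    [Module.Finite F B] {ℬ : G → Submodule F B} (h : IsGrading ℬ) (hs : IsGradedSimple ℬ)
    (hdeg : HasDegreeOverCenter F B 2) (a : B) :
    ∃ c l : Center F B, a * a = c • a + l • (1 : B) := by
  have := hs.center_isReduced h
  have : IsArtinianRing (Center F B) := IsArtinianRing.of_finite F _
  let J : Ideal (Center F B) :=
    (Submodule.span (Center F B) {a, (1 : B)}).comap (LinearMap.toSpanSingleton _ _ (a * a))
  have hJ : J = ⊤ := by
    by_contra hne
    obtain ⟨m, hm, hJm⟩ := Ideal.exists_le_maximal J hne
    obtain ⟨ε, hε, hεm⟩ := exists_annihilator_notMem m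
    refine hε (hJm ?_)
    obtain ⟨k, hk, hgen⟩ := hdeg.1 ⟨m, hm⟩
    let _ : Field (Center F B ⧸ m) := Ideal.Quotient.field m
    obtain ⟨s, r, hsr⟩ := sq_eq_of_genericDegree hk hgen ((1 : Center F B ⧸ m) ⊗ₜ a)
    obtain ⟨s, rfl⟩ := Ideal.Quotient.mk_surjective s
    obtain ⟨r, rfl⟩ := Ideal.Quotient.mk_surjective r
    have e : ∀ (s : Center F B) (x : B), (1 : Center F B ⧸ m) ⊗ₜ[Center F B] (s • x) =
        Ideal.Quotient.mk m s • ((1 : Center F B ⧸ m) ⊗ₜ[Center F B] x) := fun s x => by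
      rw [← TensorProduct.smul_tmul, TensorProduct.smul_tmul']
      rfl
    have key : (1 : Center F B ⧸ m) ⊗ₜ[Center F B] (a * a - s • a - r • (1 : B)) = 0 := by
      rw [Algebra.TensorProduct.tmul_mul_tmul, one_mul] at hsr
      rw [TensorProduct.tmul_sub, TensorProduct.tmul_sub, hsr, e, e, sub_sub, sub_eq_zero]
      rfl
    have hmem : a * a - s • a - r • (1 : B) ∈ m • (⊤ : Submodule (Center F B) B) := by
      have := congrArg (TensorProduct.quotTensorEquivQuotSMul B m) key
      rwa [map_zero, ← map_one (Ideal.Quotient.mk m), TensorProduct.quotTensorEquivQuotSMul_mk_tmul,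
        one_smul, Submodule.Quotient.mk_eq_zero] at this
    have hann : ∀ y ∈ m • (⊤ : Submodule (Center F B) B), ε • y = 0 := by
      intro y hy
      refine Submodule.smul_induction_on hy (fun r hr n _ => ?_) (fun x y hx hy => ?_)
      · rw [smul_smul, hεm r hr, zero_smul]
      · rw [smul_add, hx, hy, add_zero]
    have h0 := hann _ hmem
    change ε • (a * a) ∈ Submodule.span (Center F B) {a, (1 : B)}
    refine Submodule.mem_span_pair.2 ⟨ε * s, ε * r, ?_⟩
    rw [smul_sub, smul_sub, sub_sub, sub_eq_zero, smul_smul, smul_smul] at h0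
    exact h0.symm
  have h1 : (1 : Center F B) ∈ J := hJ ▸ Submodule.mem_top
  change (1 : Center F B) • (a * a) ∈ Submodule.span (Center F B) {a, (1 : B)} at h1
  rw [one_smul] at h1
  obtain ⟨c, l, hcl⟩ := Submodule.mem_span_pair.1 h1
  exact ⟨c, l, hcl.symm⟩

end Quadratic

/-! ### The decomposition of the algebra into its center and a complement with a nondegenerate form
-/

section Structure

variable {F : Type*} [Field F] {G : Type*} [CommGroup G]
  {B : Type*} [NonAssocCommRing B] [Module F B] [SMulCommClass F B B] [IsScalarTower F B B]
  {ℬ : G → Submodule F B}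

instance Center.instIsScalarTowerBase : IsScalarTower F (Center F B) B where
  smul_assoc r c x := smul_mul_assoc r (c : B) x

theorem smul_mem_center (c : Center F B) {x : B} (hx : x ∈ Center F B) : c • x ∈ Center F B :=
  mul_mem c.2 hx

theorem center_sub_smul (c d : Center F B) (x : B) : (c - d) • x = c • x - d • x :=
  sub_mul (c : B) d x

theorem one_mem_center : (1 : B) ∈ Center F B := (1 : Center F B).2

theorem IsGradedSimple.mem_center_of_smul (h : IsGrading ℬ) (hs : IsGradedSimple ℬ) {g : G}
    {c : Center F B} (hc : c ∈ centerGrading ℬ g) (h0 : c ≠ 0) {x : B}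
    (hx : c • x ∈ Center F B) : x ∈ Center F B := by
  obtain ⟨d, -, hd⟩ := hs.exists_inv h hc h0
  rw [← one_smul (Center F B) x, ← hd, mul_comm, mul_smul]
  exact smul_mem_center d hx

theorem mem_center_of_add_self [CharZero F] {x : B} (hx : x + x ∈ Center F B) :
    x ∈ Center F B := by
  have : x = (2⁻¹ : F) • (x + x) := by
    rw [← two_smul F x, smul_smul, inv_mul_cancel₀ two_ne_zero, one_smul]
  rw [this]
  exact SMulMemClass.smul_mem _ hx

theorem IsGrading.proj_smul (h : IsGrading ℬ) (c : Center F B) {k : G} {x : B} (hx : x ∈ ℬ k)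
    (g : G) : h.proj g (c • x) = h.center.proj (g * k⁻¹) c • x := by
  rw [center_smul_def, h.proj_mul_right hx, center_smul_def, h.coe_proj_center]

theorem IsGrading.proj_mem_center (h : IsGrading ℬ) (g : G) {x : B} (hx : x ∈ Center F B) :
    h.proj g x ∈ Center F B := h.proj_center_mem g ⟨x, hx⟩

/-- Every element is a root of a quadratic polynomial over the center. -/
def IsQuadratic (F B : Type*) [Field F] [NonAssocCommRing B] [Module F B] [SMulCommClass F B B]
    [IsScalarTower F B B] : Prop :=
  ∀ a : B, ∃ c l : Center F B, a * a = c • a + l • (1 : B)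

/-- The homogeneous elements of degree `g` with central square that are zero or not central. -/
def IsPure (ℬ : G → Submodule F B) (g : G) (x : B) : Prop :=
  x ∈ ℬ g ∧ x * x ∈ Center F B ∧ (x ∈ Center F B → x = 0)

theorem isPure_zero (g : G) : IsPure ℬ g 0 :=
  ⟨zero_mem _, by rw [mul_zero]; exact zero_mem _, fun _ => rfl⟩

theorem IsPure.smul (h : IsGrading ℬ) (hs : IsGradedSimple ℬ) {g k : G} {c : Center F B}
    (hc : c ∈ centerGrading ℬ g) {x : B} (hx : IsPure ℬ k x) : IsPure ℬ (g * k) (c • x) := by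
  refine ⟨h.smul_mem hc hx.1, ?_, fun hcx => ?_⟩
  · rw [smul_mul_smul_comm]; exact smul_mem_center _ hx.2.1
  · by_cases h0 : c = 0
    · rw [h0, zero_smul]
    · rw [hx.2.2 (hs.mem_center_of_smul h hc h0 hcx), smul_zero]

/-- Write `x = d - n y` with `d` central. If `d = 0`, then `x y = -n y²`. If `d ≠ 0`, expanding `x²`
shows that `d n y` is central, hence so is `n y`; then either `n = 0` and `x` is central, or `y` is
central, and a central pure element is zero. -/
theorem IsPure.mul_mem_of_add_mem [CharZero F] (h : IsGrading ℬ) (hs : IsGradedSimple ℬ) {g k : G} {x y : B}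
    (hx : IsPure ℬ g x) (hy : IsPure ℬ k y) {n : Center F B} (hn : n ∈ centerGrading ℬ (g * k⁻¹))
    (hxy : x + n • y ∈ Center F B) : x * y ∈ Center F B := by
  have hny : n • y ∈ ℬ g := by simpa using h.smul_mem hn hy.1
  obtain ⟨d, hd⟩ : ∃ d : Center F B, x = d • 1 - n • y :=
    ⟨⟨_, hxy⟩, by rw [center_smul_one]; simp⟩
  have hdg : d ∈ centerGrading ℬ g := by
    rw [mem_centerGrading, ← center_smul_one d]
    have : d • (1 : B) = x + n • y := by rw [hd]; abel
    rw [this]; exact add_mem hx.1 hny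
  by_cases hd0 : d = 0
  · rw [hd, hd0, zero_smul, zero_sub, neg_mul, smul_mul_assoc]
    exact neg_mem (smul_mem_center _ hy.2.1)
  have hdny : d • n • y ∈ Center F B := by
    have e : x * x + (d • n • y + d • n • y) = (d * d) • 1 + (n * n) • (y * y) := by
      rw [hd]
      simp only [sub_mul, mul_sub, smul_mul_assoc, mul_smul_comm, one_mul, mul_one]
      module
    refine mem_center_of_add_self ?_
    rw [← eq_sub_iff_add_eq'] at e
    rw [e]
    exact sub_mem (add_mem (smul_mem_center _ one_mem_center) (smul_mem_center _ hy.2.1)) hx.2.1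
  have hny' := hs.mem_center_of_smul h hdg hd0 hdny
  by_cases hn0 : n = 0
  · rw [hn0, zero_smul, add_zero] at hxy
    rw [hx.2.2 hxy, zero_mul]; exact zero_mem _
  · rw [hy.2.2 (hs.mem_center_of_smul h hn hn0 hny'), mul_zero]; exact zero_mem _

/-- Adding and subtracting the relations for `x + y` and `x - y` isolates `x² + y²` and `x y`.
Either `x y` turns out central at once, or a homogeneous component of a coefficient is invertible
and division by it leads to `IsPure.mul_mem_of_add_mem`. -/
theorem IsPure.mul_mem [CharZero F] (h : IsGrading ℬ) (hs : IsGradedSimple ℬ)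
    (hq : IsQuadratic F B) {g k : G} {x y : B} (hx : IsPure ℬ g x) (hy : IsPure ℬ k y) :
    x * y ∈ Center F B := by
  obtain ⟨c, l, hcl⟩ := hq (x + y)
  obtain ⟨c', l', hcl'⟩ := hq (x - y)
  have hyx := mul_comm y x
  simp only [add_mul, mul_add, sub_mul, mul_sub, smul_add, smul_sub, hyx] at hcl hcl'
  have h1 : (c + c') • x + (c - c') • y ∈ Center F B := by
    have : (c + c') • x + (c - c') • y =
        (x * x + x * x) + (y * y + y * y) - (l + l') • (1 : B) := by
      have e : (x * x + x * x) + (y * y + y * y) = (x * x + x * y + (x * y + y * y)) +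
          (x * x - x * y - (x * y - y * y)) := by abel
      rw [e, hcl, hcl', add_smul, add_smul, center_sub_smul]
      abel
    rw [this]
    exact sub_mem (add_mem (add_mem hx.2.1 hx.2.1) (add_mem hy.2.1 hy.2.1))
      (smul_mem_center _ one_mem_center)
  have h2 : (x * y + x * y) + (x * y + x * y) = (l - l') • (1 : B) + ((c - c') • x + (c + c') • y) := by
    have e : (x * y + x * y) + (x * y + x * y) = (x * x + x * y + (x * y + y * y)) -
        (x * x - x * y - (x * y - y * y)) := by abel
    rw [e, hcl, hcl', add_smul, center_sub_smul, center_sub_smul]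
    abel
  -- In degree `g k`, the right side of `h2` involves, besides a central term, only the component of
  -- `c + c'` of degree `g` and that of `c - c'` of degree `k`. If one of them is nonzero, it is
  -- invertible, and it is the coefficient of `x` or `y` in the component of `h1` of degree `g²` or
  -- `k²`.
  by_cases hp : h.center.proj g (c + c') = 0
  · by_cases hr : h.center.proj k (c - c') = 0
    · refine mem_center_of_add_self (mem_center_of_add_self ?_)
      have h3 := congrArg (h.proj (g * k)) h2
      have hxy := h.mul_mem hx.1 hy.1
      rw [h.proj_same (add_mem (add_mem hxy hxy) (add_mem hxy hxy)), map_add, map_add,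
        h.proj_smul _ hx.1, h.proj_smul _ hy.1, mul_inv_cancel_right, mul_inv_cancel_comm, hp, hr,
        zero_smul, zero_smul, add_zero, add_zero] at h3
      rw [h3]
      exact h.proj_mem_center _ (smul_mem_center _ one_mem_center)
    · have h3 := h.proj_mem_center (k * k) h1
      rw [map_add, h.proj_smul _ hx.1, h.proj_smul _ hy.1, mul_inv_cancel_right] at h3
      obtain ⟨d, hd, hdp⟩ := hs.exists_inv h (h.center.proj_mem _ _) hr
      have h4 := smul_mem_center d h3
      rw [smul_add, smul_smul, smul_smul, mul_comm d (h.center.proj k _), hdp, one_smul, add_comm] at h4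
      rw [mul_comm]
      refine hy.mul_mem_of_add_mem h hs hx ?_ h4
      have := h.center.mul_mem hd (h.center.proj_mem (k * k * g⁻¹) (c + c'))
      rwa [show k⁻¹ * (k * k * g⁻¹) = k * g⁻¹ by group] at this
  · have h3 := h.proj_mem_center (g * g) h1
    rw [map_add, h.proj_smul _ hx.1, h.proj_smul _ hy.1, mul_inv_cancel_right] at h3
    obtain ⟨d, hd, hdp⟩ := hs.exists_inv h (h.center.proj_mem _ _) hp
    have h4 := smul_mem_center d h3
    rw [smul_add, smul_smul, smul_smul, mul_comm d (h.center.proj g _), hdp, one_smul] at h4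
    refine hx.mul_mem_of_add_mem h hs hy ?_ h4
    have := h.center.mul_mem hd (h.center.proj_mem (g * g * k⁻¹) (c - c'))
    rwa [show g⁻¹ * (g * g * k⁻¹) = g * k⁻¹ by group] at this

/-- If `x + y` is central and nonzero, it is invertible, and `(x + y) y = x y + y²` is central. So
`y` is central, hence zero, and then `x` is as well. -/
theorem IsPure.add [CharZero F] (h : IsGrading ℬ) (hs : IsGradedSimple ℬ)
    (hq : IsQuadratic F B) {g : G} {x y : B} (hx : IsPure ℬ g x) (hy : IsPure ℬ g y) :
    IsPure ℬ g (x + y) := by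
  have hxy := hx.mul_mem h hs hq hy
  refine ⟨add_mem hx.1 hy.1, ?_, fun hd => ?_⟩
  · have : (x + y) * (x + y) = x * x + (x * y + x * y) + y * y := by
      rw [add_mul, mul_add, mul_add, mul_comm y x]; abel
    rw [this]
    exact add_mem (add_mem hx.2.1 (add_mem hxy hxy)) hy.2.1
  · by_cases hd0 : x + y = 0
    · exact hd0
    have hy0 : y ∈ Center F B := by
      refine hs.mem_center_of_smul h (g := g) (c := ⟨x + y, hd⟩) (add_mem hx.1 hy.1)
        (fun h0 => hd0 (congrArg Subtype.val h0)) ?_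
      rw [center_smul_def]
      change (x + y) * y ∈ _
      rw [add_mul]
      exact add_mem hxy hy.2.1
    have hy1 := hy.2.2 hy0
    rw [hy1, add_zero] at hd ⊢
    exact hx.2.2 hd

/-- Completing the square: in degree `g²` only the component of degree `g` of the linear coefficient
occurs, and half of it is subtracted. A central `y` is subtracted entirely. -/
theorem IsGradedSimple.exists_isPure [CharZero F] (h : IsGrading ℬ)
    (hq : IsQuadratic F B) {g : G} {y : B} (hy : y ∈ ℬ g) :
    ∃ l ∈ centerGrading ℬ g, IsPure ℬ g (y - l • 1) := by
  by_cases hyc : y ∈ Center F B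
  · refine ⟨⟨y, hyc⟩, hy, ?_⟩
    rw [center_smul_one, sub_self]
    exact isPure_zero g
  obtain ⟨c, l, hcl⟩ := hq y
  have h1 := congrArg (h.proj (g * g)) hcl
  rw [h.proj_same (h.mul_mem hy hy), map_add, h.proj_smul _ hy, mul_inv_cancel_right] at h1
  set d := (2⁻¹ : F) • h.center.proj g c with hd
  have hdg : d ∈ centerGrading ℬ g := Submodule.smul_mem _ _ (h.center.proj_mem g c)
  have hdd : h.center.proj g c = d + d := by
    rw [hd, ← two_smul F, smul_smul, mul_inv_cancel₀ two_ne_zero, one_smul]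
  rw [hdd] at h1
  refine ⟨d, hdg, sub_mem hy ?_, ?_, fun hc => absurd ?_ hyc⟩
  · rw [center_smul_one]; exact hdg
  · have : (y - d • 1) * (y - d • 1) = h.proj (g * g) (l • (1 : B)) + (d * d) • 1 := by
      simp only [sub_mul, mul_sub, smul_mul_assoc, mul_smul_comm, one_mul, mul_one]
      rw [h1]
      module
    rw [this]
    exact add_mem (h.proj_mem_center _ (smul_mem_center _ one_mem_center))
      (smul_mem_center _ one_mem_center)
  · have := add_mem hc (smul_mem_center d one_mem_center)
    rwa [sub_add_cancel] at this

/-- The elements whose homogeneous components are pure. -/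
def pureSubmodule [CharZero F] (h : IsGrading ℬ) (hs : IsGradedSimple ℬ)
    (hq : IsQuadratic F B) : Submodule (Center F B) B where
  carrier := {x | ∀ g, IsPure ℬ g (h.proj g x)}
  add_mem' hx hy g := by rw [map_add]; exact (hx g).add h hs hq (hy g)
  zero_mem' g := by rw [map_zero]; exact isPure_zero g
  smul_mem' c x hx := by
    refine h.center.induction c (fun m c hc g => ?_) (fun g => ?_) (fun c d hc hd g => ?_)
    · rw [center_smul_def, h.proj_mul_left (mem_centerGrading.1 hc)]
      have := (hx (m⁻¹ * g)).smul h hs hc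
      rwa [mul_inv_cancel_left] at this
    · rw [zero_smul, map_zero]; exact isPure_zero g
    · rw [add_smul, map_add]; exact (hc g).add h hs hq (hd g)

theorem IsPure.mem_pureSubmodule [CharZero F] (h : IsGrading ℬ) (hs : IsGradedSimple ℬ)
    (hq : IsQuadratic F B) {g : G} {x : B} (hx : IsPure ℬ g x) : x ∈ pureSubmodule h hs hq := by
  intro k
  by_cases hk : g = k
  · subst hk; rwa [h.proj_same hx.1]
  · rw [h.proj_ne hx.1 hk]; exact isPure_zero k

theorem isCompl_pureSubmodule [CharZero F] (h : IsGrading ℬ) (hs : IsGradedSimple ℬ)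
    (hq : IsQuadratic F B) :
    IsCompl (LinearMap.range (LinearMap.toSpanSingleton (Center F B) B 1)) (pureSubmodule h hs hq) := by
  constructor
  · rw [Submodule.disjoint_def]
    rintro _ ⟨c, rfl⟩ hc
    refine h.ext fun g => ?_
    rw [map_zero]
    refine (hc g).2.2 (h.proj_mem_center g ?_)
    exact smul_mem_center _ one_mem_center
  · rw [codisjoint_iff, Submodule.eq_top_iff']
    intro x
    refine h.induction x (fun g x hx => ?_) (zero_mem _) (fun x y hx hy => add_mem hx hy)
    obtain ⟨l, -, hl⟩ := IsGradedSimple.exists_isPure h hq hx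
    exact Submodule.mem_sup.2 ⟨l • 1, ⟨l, rfl⟩, _, hl.mem_pureSubmodule h hs hq, by abel⟩

/-- `t` is the projection of `B` onto its center `L` along a graded complement `V` with `V V ⊆ L`
on which the multiplication `V × V → L` is nondegenerate. -/
structure IsCenterProj (ℬ : G → Submodule F B) (t : B →ₗ[Center F B] Center F B) : Prop where
  map_one : t 1 = 1
  map_mem : ∀ {g : G} {x : B}, x ∈ ℬ g → t x ∈ centerGrading ℬ g
  mul_eq : ∀ {x y : B}, t x = 0 → t y = 0 → x * y = t (x * y) • (1 : B)
  eq_zero : ∀ {x : B}, t x = 0 → (∀ y, t y = 0 → t (x * y) = 0) → x = 0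

/-- Here `t` is the projection along the pure elements. On the radical of `V × V → L` every `a ∈ B`
acts as the central element `t a`, so the radical is an ideal; it is graded and does not contain
`1`, so it vanishes. -/
theorem IsGradedSimple.exists_isCenterProj [CharZero F] (h : IsGrading ℬ)
    (hs : IsGradedSimple ℬ) (hq : IsQuadratic F B) :
    ∃ t : B →ₗ[Center F B] Center F B, IsCenterProj ℬ t := by
  have hinj : Function.Injective (LinearMap.toSpanSingleton (Center F B) B 1) := by
    intro c d hcd
    rw [LinearMap.toSpanSingleton_apply, LinearMap.toSpanSingleton_apply, center_smul_one,
      center_smul_one] at hcd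
    exact Subtype.ext hcd
  have hc := isCompl_pureSubmodule h hs hq
  set V := pureSubmodule h hs hq with hV
  let t : B →ₗ[Center F B] Center F B :=
    (LinearEquiv.ofInjective _ hinj).symm.toLinearMap ∘ₗ Submodule.projectionOnto _ V hc
  have ht1 : ∀ c : Center F B, t (c • 1) = c := by
    intro c
    have := Submodule.projectionOnto_apply_left hc ⟨_, c, rfl⟩
    simp only [t, LinearMap.comp_apply, LinearEquiv.coe_coe, LinearEquiv.symm_apply_eq]
    exact this
  have htV : ∀ x, t x = 0 ↔ x ∈ V := by
    intro x
    simp only [t, LinearMap.comp_apply, LinearEquiv.coe_coe, LinearEquiv.map_eq_zero_iff]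
    exact Submodule.projectionOnto_apply_eq_zero_iff hc
  have hmulV : ∀ x ∈ V, ∀ y ∈ V, x * y ∈ Center F B := by
    intro x hx y hy
    obtain ⟨T, hT⟩ := h.exists_sum x
    obtain ⟨T', hT'⟩ := h.exists_sum y
    rw [hT T subset_rfl, hT' T' subset_rfl, Finset.sum_mul_sum]
    exact sum_mem fun g _ => sum_mem fun k _ => (hx g).mul_mem h hs hq (hy k)
  have hmul : ∀ {x y : B}, t x = 0 → t y = 0 → x * y = t (x * y) • (1 : B) := by
    intro x y hx hy
    obtain ⟨c, hc⟩ : ∃ c : Center F B, x * y = c • 1 :=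
      ⟨⟨_, hmulV x ((htV x).1 hx) y ((htV y).1 hy)⟩, by rw [center_smul_one]⟩
    rw [hc, ht1]
  have hone : t 1 = 1 := by simpa using ht1 1
  have hsub : ∀ x, t (x - t x • 1) = 0 := fun x => by rw [map_sub, ht1, sub_self]
  refine ⟨t, hone, ?_, hmul, ?_⟩
  · intro g x hx
    obtain ⟨l, hl, hp⟩ := IsGradedSimple.exists_isPure h hq hx
    have h0 := (htV _).2 (hp.mem_pureSubmodule h hs hq)
    rw [map_sub, ht1, sub_eq_zero] at h0
    rwa [h0]
  · -- the radical is a proper graded ideal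
    let I : Submodule F B :=
      { carrier := {x | t x = 0 ∧ ∀ y, t y = 0 → x * y = 0}
        add_mem' := fun {a b} ha hb => ⟨by rw [map_add, ha.1, hb.1, add_zero], fun y hy => by
          rw [add_mul, ha.2 y hy, hb.2 y hy, add_zero]⟩
        zero_mem' := ⟨map_zero t, fun y _ => zero_mul y⟩
        smul_mem' := fun r x hx => by
          have e : r • x = (r • (1 : Center F B)) • x := by rw [smul_assoc, one_smul]
          refine ⟨by rw [e, map_smul, hx.1, smul_zero], fun y hy => ?_⟩
          rw [smul_mul_assoc, hx.2 y hy, smul_zero] }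
    have hIproj : ∀ x ∈ I, ∀ g, h.proj g x ∈ I := by
      intro x hx g
      have hxV := (htV x).1 hx.1
      refine ⟨(htV _).2 ((hxV g).mem_pureSubmodule h hs hq), fun y hy => ?_⟩
      have hyV := (htV y).1 hy
      obtain ⟨T, hT⟩ := h.exists_sum y
      rw [hT T subset_rfl, Finset.mul_sum]
      refine Finset.sum_eq_zero fun k _ => ?_
      have h0 := hx.2 _ ((htV _).2 ((hyV k).mem_pureSubmodule h hs hq))
      have := congrArg (h.proj (g * k)) h0
      rwa [h.proj_mul_right (hyV k).1, mul_inv_cancel_right, map_zero] at this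
    have hleft : ∀ (a : B) {x : B}, x ∈ I → a * x ∈ I := by
      intro a x hx
      have : a * x = t a • x := by
        have h0 : x * (a - t a • 1) = 0 := hx.2 _ (hsub a)
        rw [mul_sub, mul_smul_comm, mul_one, sub_eq_zero] at h0
        rw [mul_comm, h0]
      rw [this]
      refine ⟨by rw [map_smul, hx.1, smul_zero], fun y hy => ?_⟩
      rw [smul_mul_assoc, hx.2 y hy, smul_zero]
    have hI : IsGradedIdeal ℬ I := by
      refine ⟨hleft, fun a x hx => by rw [mul_comm]; exact hleft a hx, le_antisymm ?_ ?_⟩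
      · intro x hx
        obtain ⟨T, hT⟩ := h.exists_sum x
        rw [hT T subset_rfl]
        exact Submodule.sum_mem _ fun g _ =>
          Submodule.mem_iSup_of_mem g ⟨hIproj x hx g, h.proj_mem g x⟩
      · exact iSup_le fun g => inf_le_left
    intro x hx hy
    have hxI : x ∈ I := ⟨hx, fun y hy' => by rw [hmul hx hy', hy y hy', zero_smul]⟩
    rcases hs.eq_bot_or_eq_top I hI with h0 | h0
    · rwa [h0, Submodule.mem_bot] at hxI
    · have h1 : (1 : B) ∈ I := h0 ▸ Submodule.mem_top
      have := hs.nontrivial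
      exact absurd (congrArg Subtype.val (hone.symm.trans h1.1) : (1 : B) = 0) one_ne_zero

end Structure

/-! ### Dual bases and isometries with the standard graded space -/

section LinearAlgebra

variable {K M : Type*} [Field K] [AddCommGroup M] [Module K M] [FiniteDimensional K M]

/-- Left nondegeneracy embeds `W` into the dual of `W'`. -/
theorem finrank_le_of_pairing (β : M →ₗ[K] M →ₗ[K] K) (W W' : Submodule K M)
    (h : ∀ v ∈ W, (∀ w ∈ W', β v w = 0) → v = 0) : Module.finrank K W ≤ Module.finrank K W' := by
  rw [← Subspace.dual_finrank_eq (K := K) (V := W')]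
  let φ : W →ₗ[K] Module.Dual K W' := (LinearMap.lcomp K K W'.subtype) ∘ₗ β ∘ₗ W.subtype
  refine LinearMap.finrank_le_finrank_of_injective (f := φ) ?_
  rw [injective_iff_map_eq_zero]
  intro v hv
  exact Subtype.ext (h v v.2 fun w hw => LinearMap.congr_fun hv ⟨w, hw⟩)

theorem exists_dual_bases (β : M →ₗ[K] M →ₗ[K] K) (W W' : Submodule K M)
    (h : ∀ v ∈ W, (∀ w ∈ W', β v w = 0) → v = 0)
    (h' : ∀ w ∈ W', (∀ v ∈ W, β v w = 0) → w = 0) :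
    ∃ p q : ℕ → M, (∀ i, p i ∈ W) ∧ (∀ i, q i ∈ W') ∧
      ∀ i < Module.finrank K W, ∀ j < Module.finrank K W, β (p i) (q j) = if i = j then 1 else 0 := by
  classical
  have hle := finrank_le_of_pairing β W W' h
  let φ : W' →ₗ[K] Module.Dual K W := (LinearMap.lcomp K K W.subtype) ∘ₗ β.flip ∘ₗ W'.subtype
  have hφ : Function.Injective φ := by
    rw [injective_iff_map_eq_zero]
    intro w hw
    exact Subtype.ext (h' w w.2 fun v hv => LinearMap.congr_fun hw ⟨v, hv⟩)
  have hle' := LinearMap.finrank_le_finrank_of_injective hφ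
  rw [Subspace.dual_finrank_eq] at hle'
  have hsurj : Function.Surjective φ :=
    (LinearMap.injective_iff_surjective_of_finrank_eq_finrank (by
      rw [Subspace.dual_finrank_eq]; exact le_antisymm hle' hle)).1 hφ
  let b := Module.finBasis K W
  choose q hq using fun j => hsurj (b.coord j)
  -- Families indexed by `ℕ`, zero beyond the dimension, avoid index types that depend on the
  -- subspace.
  refine ⟨fun i => if hi : i < Module.finrank K W then b ⟨i, hi⟩ else 0,
    fun i => if hi : i < Module.finrank K W then q ⟨i, hi⟩ else 0, fun i => ?_, fun i => ?_, ?_⟩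
  · dsimp only; split_ifs; exacts [(b _).2, zero_mem _]
  · dsimp only; split_ifs; exacts [(q _).2, zero_mem _]
  · intro i hi j hj
    simp only [dif_pos hi, dif_pos hj]
    have := LinearMap.congr_fun (hq ⟨j, hj⟩) (b ⟨i, hi⟩)
    rw [Module.Basis.coord_apply, Module.Basis.repr_self, Finsupp.single_apply] at this
    simp only [Fin.mk.injEq] at this
    exact this

variable {Γ : Type*} [CommGroup Γ]

open Classical in
theorem stdForm_single (κ : Γ → ℕ) (ε : Γ → ℕ → K) {x y : Γ} (i : Fin (κ x)) (j : Fin (κ y)) :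
    stdForm κ ε (Finsupp.single ⟨x, i⟩ 1) (Finsupp.single ⟨y, j⟩ 1) =
      if y = x⁻¹ ∧ (i : ℕ) = j then ε x i else 0 := by
  simp only [stdForm, Finsupp.linearCombination_single, one_smul]

/-- For `x ≠ x⁻¹` the spaces `W x` and `W x⁻¹` receive dual bases; for `x = x⁻¹` the basis of `W x`
is the diagonalizing one from `hdiag`. The isometries are the coordinate maps. -/
theorem exists_isometry_stdSpace (W : Γ → Submodule K M) (β : Γ → M →ₗ[K] M →ₗ[K] K)
    (hsymm : ∀ x v w, β x v w = β x⁻¹ w v)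
    (hnd : ∀ x, ∀ v ∈ W x, (∀ w ∈ W x⁻¹, β x v w = 0) → v = 0)
    (ε : Γ → ℕ → K) (hε0 : ∀ x i, ε x i ≠ 0) (hε1 : ∀ x, x * x ≠ 1 → ∀ i, ε x i = 1)
    (κ : Γ → ℕ) (hκ : ∀ x, κ x = Module.finrank K (W x))
    (hdiag : ∀ x, x * x = 1 → ∃ b : ℕ → M, (∀ i, b i ∈ W x) ∧
      ∀ i < κ x, ∀ j < κ x, β x (b i) (b j) = if i = j then ε x i else 0) :
    ∃ f : Γ → M →ₗ[K] StdSpace K κ,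
      (∀ x, ∀ v ∈ W x, f x v ∈ stdSpaceGrading K κ x) ∧
      (∀ x, ∀ v ∈ W x, f x v = 0 → v = 0) ∧
      (∀ x, ∀ w ∈ stdSpaceGrading K κ x, ∃ v ∈ W x, f x v = w) ∧
      ∀ x, ∀ v ∈ W x, ∀ w ∈ W x⁻¹, stdForm κ ε (f x v) (f x⁻¹ w) = β x v w := by
  classical
  have hκinv : ∀ x, κ x⁻¹ = κ x := by
    have : ∀ x, κ x ≤ κ x⁻¹ := fun x => by
      rw [hκ, hκ]; exact finrank_le_of_pairing (β x) _ _ (hnd x)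
    exact fun x => le_antisymm (by simpa using this x⁻¹) (this x)
  -- homogeneous bases that are dual to each other up to the scalars `ε`
  obtain ⟨e, heW, heβ⟩ : ∃ e : Γ → ℕ → M, (∀ x i, e x i ∈ W x) ∧
      ∀ x, ∀ i < κ x, ∀ j < κ x, β x (e x i) (e x⁻¹ j) = if i = j then ε x i else 0 := by
    have h1 : ∀ x, ∃ p q : ℕ → M, (∀ i, p i ∈ W x) ∧ (∀ i, q i ∈ W x⁻¹) ∧
        ∀ i < κ x, ∀ j < κ x, β x (p i) (q j) = if i = j then 1 else 0 := fun x => by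
      rw [hκ]
      refine exists_dual_bases (β x) (W x) (W x⁻¹) (hnd x) fun w hw hw' => ?_
      refine hnd x⁻¹ w hw fun v hv => ?_
      rw [inv_inv] at hv
      rw [← hsymm]
      exact hw' v hv
    choose p q hp hq hpq using h1
    have h2 : ∀ x, ∃ b : ℕ → M, (∀ i, b i ∈ W x) ∧ (x * x = 1 →
        ∀ i < κ x, ∀ j < κ x, β x (b i) (b j) = if i = j then ε x i else 0) := fun x => by
      by_cases hx : x * x = 1
      · obtain ⟨b, hb, hb'⟩ := hdiag x hx
        exact ⟨b, hb, fun _ => hb'⟩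
      · exact ⟨0, fun i => zero_mem _, fun h => absurd h hx⟩
    choose b hb hbβ using h2
    -- An arbitrary linear order selects, in each pair `x ≠ x⁻¹`, the member that receives the basis
    -- `p`; the other receives the dual basis `q`.
    let _ : LinearOrder Γ := linearOrderOfSTO WellOrderingRel
    refine ⟨fun x => if x * x = 1 then b x else if x < x⁻¹ then p x else q x⁻¹, fun x i => ?_,
      fun x i hi j hj => ?_⟩
    · dsimp only
      split_ifs
      · exact hb x i
      · exact hp x i
      · simpa using hq x⁻¹ i
    · by_cases hx : x * x = 1
      · have hx' : x⁻¹ = x := inv_eq_of_mul_eq_one_left hx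
        simp only [hx', hx, if_true]
        exact hbβ x hx i hi j hj
      · have hx' : ¬ x⁻¹ * x⁻¹ = 1 := by
          rwa [← mul_inv, inv_eq_one]
        have hne : x ≠ x⁻¹ := fun h' => hx (by nth_rewrite 2 [h']; rw [mul_inv_cancel])
        simp only [if_neg hx, if_neg hx', inv_inv, hε1 x hx]
        rcases lt_or_gt_of_ne hne with hlt | hlt
        · rw [if_pos hlt, if_neg hlt.not_gt]
          exact hpq x i hi j hj
        · rw [if_pos hlt, if_neg hlt.not_gt, hsymm]
          rw [← hκinv] at hi hj
          rw [hpq x⁻¹ j hj i hi]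
          simp only [eq_comm]
  have hself : ∀ x (i : Fin (κ x)) (j : Fin (κ x)),
      β x (e x i) (e x⁻¹ j) = if i = j then ε x i else 0 := fun x i j => by
    rw [heβ x i i.2 j j.2]; simp only [Fin.ext_iff]
  have hspan : ∀ x, Submodule.span K (Set.range fun i : Fin (κ x) => e x i) = W x := by
    intro x
    have hli : LinearIndependent K fun i : Fin (κ x) => e x i := by
      rw [Fintype.linearIndependent_iff]
      intro g hg i
      have := congrArg (fun v => β x v (e x⁻¹ i)) hg
      simp only [map_sum, LinearMap.sum_apply, map_smul, LinearMap.smul_apply, hself, smul_eq_mul,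
        mul_ite, mul_zero, Finset.sum_ite_eq', Finset.mem_univ, if_true, map_zero,
        LinearMap.zero_apply] at this
      exact (mul_eq_zero.1 this).resolve_right (hε0 x i)
    refine Submodule.eq_of_le_of_finrank_eq (Submodule.span_le.2 ?_) ?_
    · rintro _ ⟨i, rfl⟩; exact heW x i
    · rw [finrank_span_eq_card hli, Fintype.card_fin, hκ]
  -- The coordinate of `v` along `e x i` is found by pairing with `e x⁻¹ i` and dividing by `ε x i`.
  let f : Γ → M →ₗ[K] StdSpace K κ := fun x =>
    ∑ i : Fin (κ x), (Finsupp.lsingle (⟨x, i⟩ : BasisIndex κ)) ∘ₗ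
      ((ε x i)⁻¹ • (β x).flip (e x⁻¹ i))
  have hfe : ∀ x (i : Fin (κ x)), f x (e x i) = Finsupp.single ⟨x, i⟩ 1 := by
    intro x i
    simp only [f, LinearMap.sum_apply, LinearMap.comp_apply, LinearMap.smul_apply,
      LinearMap.flip_apply, hself, smul_eq_mul, Finsupp.lsingle_apply]
    rw [Finset.sum_eq_single i]
    · rw [if_pos rfl, inv_mul_cancel₀ (hε0 x i)]
    · intro j _ hj
      rw [if_neg hj.symm, mul_zero, Finsupp.single_zero]
    · simp
  refine ⟨f, fun x v _ => ?_, fun x v hv hfv => ?_, fun x w hw => ?_, fun x v hv w hw => ?_⟩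
  · simp only [f, LinearMap.sum_apply]
    exact Submodule.sum_mem _ fun i _ => Finsupp.single_mem_supported K _ rfl
  · refine hnd x v hv fun w hw => ?_
    rw [← hspan] at hw
    induction hw using Submodule.span_induction with
    | mem w hw =>
      obtain ⟨j, rfl⟩ := hw
      have := congrArg (fun w => w ⟨x, Fin.cast (hκinv x) j⟩) hfv
      simp only [f, LinearMap.sum_apply, LinearMap.comp_apply, LinearMap.smul_apply,
        LinearMap.flip_apply, smul_eq_mul, Finsupp.lsingle_apply, Finsupp.finsetSum_apply,
        Finsupp.single_apply, Sigma.mk.injEq, heq_eq_eq, true_and, Finset.sum_ite_eq',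
        Finset.mem_univ, if_true, Finsupp.zero_apply, mul_eq_zero, inv_eq_zero, hε0, false_or] at this
      exact this
    | zero => exact map_zero _
    | add w w' _ _ h h' => rw [map_add, h, h', add_zero]
    | smul r w _ h => rw [map_smul, h, smul_zero]
  · rw [stdSpaceGrading, Finsupp.supported_eq_span_single] at hw
    induction hw using Submodule.span_induction with
    | mem w hw =>
      obtain ⟨⟨y, i⟩, rfl, rfl⟩ := hw
      exact ⟨e y i, heW y i, hfe y i⟩
    | zero => exact ⟨0, zero_mem _, map_zero _⟩
    | add w w' _ _ h h' =>
      obtain ⟨v, hv, rfl⟩ := h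
      obtain ⟨v', hv', rfl⟩ := h'
      exact ⟨v + v', add_mem hv hv', map_add _ _ _⟩
    | smul r w _ h =>
      obtain ⟨v, hv, rfl⟩ := h
      exact ⟨r • v, Submodule.smul_mem _ r hv, map_smul _ _ _⟩
  · rw [← hspan] at hv hw
    induction hv, hw using Submodule.span_induction₂ with
    | mem_mem v w hv hw =>
      obtain ⟨i, rfl⟩ := hv
      obtain ⟨j, rfl⟩ := hw
      rw [hfe, hfe, stdForm_single, heβ x i i.2 j (j.2.trans_eq (hκinv x))]
      simp only [true_and]
    | zero_left y _ => simp
    | zero_right x _ => simp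
    | add_left x y z _ _ _ h₁ h₂ => simp only [map_add, LinearMap.add_apply, h₁, h₂]
    | add_right x y z _ _ _ h₁ h₂ => simp only [map_add, h₁, h₂]
    | smul_left r x y _ _ h => simp only [map_smul, LinearMap.smul_apply, h]
    | smul_right r x y _ _ h => simp only [map_smul, h]

end LinearAlgebra

/-! ### Reading off coefficients in `A ⊗ ℂ G` -/

section TensorMonoidAlgebra

variable {G : Type*} (K : Type*) [Field K] [Algebra K ℂ] (A : Type*) [AddCommGroup A] [Module K A]

theorem exists_coord : ∃ r : ℂ →ₗ[K] K, r ∘ₗ Algebra.linearMap K ℂ = LinearMap.id :=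
  LinearMap.exists_leftInverse_of_injective _
    (LinearMap.ker_eq_bot.2 (algebraMap K ℂ).injective)

/-- A linear left inverse of the embedding of `K` into `ℂ`. -/
def coord : ℂ →ₗ[K] K := (exists_coord K).choose

theorem coord_algebraMap (k : K) : coord K (algebraMap K ℂ k) = k :=
  LinearMap.congr_fun (exists_coord K).choose_spec k

/-- The map `A ⊗ ℂ G → A` that sends `a ⊗ w g` to `a` and vanishes on `a ⊗ w' k`, `k ≠ g`. -/
def extract (g : G) (w : ℂ) : A ⊗[K] MonoidAlgebra ℂ G →ₗ[K] A :=
  (TensorProduct.rid K A).toLinearMap ∘ₗ LinearMap.lTensor A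
    (coord K ∘ₗ LinearMap.mulLeft K w⁻¹ ∘ₗ Finsupp.lapply g ∘ₗ
      (MonoidAlgebra.coeffLinearEquiv K).toLinearMap)

variable {K A}

open Classical in
theorem extract_tmul_single (g k : G) (w w' : ℂ) (a : A) :
    extract K A g w (a ⊗ₜ MonoidAlgebra.single k w') =
      if k = g then coord K (w⁻¹ * w') • a else 0 := by
  simp only [extract, LinearMap.comp_apply, LinearMap.lTensor_tmul, LinearEquiv.coe_coe,
    TensorProduct.rid_tmul, LinearMap.mulLeft_apply]
  split_ifs with h
  · subst h
    simp [MonoidAlgebra.coeffLinearEquiv]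
  · simp [MonoidAlgebra.coeffLinearEquiv, h]

theorem extract_same (g : G) {w : ℂ} (hw : w ≠ 0) (a : A) :
    extract K A g w (a ⊗ₜ MonoidAlgebra.single g w) = a := by
  rw [extract_tmul_single, if_pos rfl, inv_mul_cancel₀ hw, ← map_one (algebraMap K ℂ),
    coord_algebraMap, one_smul]

theorem extract_ne {g k : G} (h : k ≠ g) (w w' : ℂ) (a : A) :
    extract K A g w (a ⊗ₜ MonoidAlgebra.single k w') = 0 := by
  rw [extract_tmul_single, if_neg h]

theorem tmul_single_injective (g : G) {w : ℂ} (hw : w ≠ 0) {a b : A}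
    (h : a ⊗ₜ[K] MonoidAlgebra.single g w = b ⊗ₜ[K] MonoidAlgebra.single g w) : a = b := by
  rw [← extract_same (K := K) g hw a, h, extract_same g hw]

theorem tmul_single_smul (g : G) (w : ℂ) (a : A) (k : K) :
    a ⊗ₜ[K] MonoidAlgebra.single g (k • w) = (k • a) ⊗ₜ[K] MonoidAlgebra.single g w := by
  rw [TensorProduct.smul_tmul, MonoidAlgebra.smul_single]

end TensorMonoidAlgebra

/-! ### The `K`-valued forms obtained from a homomorphism of the center to `ℂ` -/

section LoopData

variable {G : Type*} [CommGroup G]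
  {B : Type*} [NonAssocCommRing B] [Module ℝ B] [SMulCommClass ℝ B B] [IsScalarTower ℝ B B]

/-- The identification `ι` of the field `K` with `L_e`, a homomorphism `ρ : L → ℂ` and numbers `z g`
such that `K z g` contains `ρ(L_g)` and `K z g * K z k ⊆ K z (g k)`. -/
structure IsLoopDatum (ℬ : G → Submodule ℝ B) (K : Type*) [Field K] [Algebra K ℂ] [Module K B]
    (ι : K →+* Center ℝ B) (ρ : Center ℝ B →+* ℂ) (z : G → ℂ) : Prop where
  smul_eq : ∀ (k : K) (x : B), k • x = ι k • x
  mem_iff : ∀ c : Center ℝ B, c ∈ centerGrading ℬ 1 ↔ ∃ k, ι k = c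
  rho_iota : ∀ k, ρ (ι k) = algebraMap K ℂ k
  z_ne_zero : ∀ g, z g ≠ 0
  z_mul : ∀ g k, ∃ a : K, z g * z k = a • z (g * k)
  rho_mem : ∀ {g : G} {l : Center ℝ B}, l ∈ centerGrading ℬ g → ∃ a : K, ρ l = a • z g

variable {ℬ : G → Submodule ℝ B} {K : Type*} [Field K] [Algebra K ℂ] [Module K B]
  {ι : K →+* Center ℝ B} {ρ : Center ℝ B →+* ℂ} {z : G → ℂ}
  {t : B →ₗ[Center ℝ B] Center ℝ B}

theorem IsLoopDatum.smul_mem (hd : IsLoopDatum ℬ K ι ρ z) (h : IsGrading ℬ) (k : K) {g : G} {x : B}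
    (hx : x ∈ ℬ g) : k • x ∈ ℬ g := by
  rw [hd.smul_eq, ← one_mul g]
  exact h.smul_mem ((hd.mem_iff _).2 ⟨k, rfl⟩) hx

theorem IsLoopDatum.map_base_smul (hd : IsLoopDatum ℬ K ι ρ z) (k : K) (x : B) :
    t (k • x) = ι k * t x := by
  rw [hd.smul_eq, map_smul, smul_eq_mul]

/-- The component `V_g` of the complement `V = ker t` of the center. -/
def IsLoopDatum.vec (hd : IsLoopDatum ℬ K ι ρ z) (h : IsGrading ℬ)
    (t : B →ₗ[Center ℝ B] Center ℝ B) (g : G) : Submodule K B where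
  carrier := {x | x ∈ ℬ g ∧ t x = 0}
  add_mem' hx hy := ⟨add_mem hx.1 hy.1, by rw [map_add, hx.2, hy.2, add_zero]⟩
  zero_mem' := ⟨zero_mem _, map_zero t⟩
  smul_mem' k _ hx := ⟨hd.smul_mem h k hx.1, by rw [hd.map_base_smul, hx.2, mul_zero]⟩

/-- The form `(v, w) ↦ ρ(t(v w)) / (z g z k)`. -/
def IsLoopDatum.form (hd : IsLoopDatum ℬ K ι ρ z) (t : B →ₗ[Center ℝ B] Center ℝ B) (g k : G) :
    B →ₗ[K] B →ₗ[K] K :=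
  LinearMap.mk₂ K (fun v w => coord K ((z g * z k)⁻¹ * ρ (t (v * w))))
    (fun v v' w => by rw [add_mul, map_add, map_add, mul_add, map_add])
    (fun a v w => by
      rw [hd.smul_eq, smul_mul_assoc, map_smul, smul_eq_mul, map_mul ρ, hd.rho_iota,
        mul_left_comm, ← Algebra.smul_def, map_smul])
    (fun v w w' => by rw [mul_add, map_add, map_add, mul_add, map_add])
    (fun a v w => by
      rw [hd.smul_eq, mul_smul_comm, map_smul, smul_eq_mul, map_mul ρ, hd.rho_iota,
        mul_left_comm, ← Algebra.smul_def, map_smul])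

theorem IsLoopDatum.form_apply (hd : IsLoopDatum ℬ K ι ρ z) (g k : G) (v w : B) :
    hd.form t g k v w = coord K ((z g * z k)⁻¹ * ρ (t (v * w))) := rfl

/-- Both `ρ l` and `z g * z k` lie on the line `K z (g k)`, so their quotient is in `K` and `coord`
loses nothing. -/
theorem IsLoopDatum.rho_eq (hd : IsLoopDatum ℬ K ι ρ z) {g k : G} {l : Center ℝ B}
    (hl : l ∈ centerGrading ℬ (g * k)) :
    ρ l = coord K ((z g * z k)⁻¹ * ρ l) • (z g * z k) := by
  obtain ⟨a, ha⟩ := hd.rho_mem hl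
  obtain ⟨b, hb⟩ := hd.z_mul g k
  have hzz : z g * z k ≠ 0 := mul_ne_zero (hd.z_ne_zero g) (hd.z_ne_zero k)
  have hb0 : b ≠ 0 := by rintro rfl; exact hzz (by rw [hb, zero_smul])
  have hab : ρ l = (a * b⁻¹) • (z g * z k) := by
    rw [hb, smul_smul, mul_assoc, inv_mul_cancel₀ hb0, mul_one, ha]
  rw [hab, Algebra.smul_def, mul_comm (algebraMap K ℂ _), inv_mul_cancel_left₀ hzz,
    coord_algebraMap, Algebra.smul_def, mul_comm]

theorem IsLoopDatum.form_smul (hd : IsLoopDatum ℬ K ι ρ z) (ht : IsCenterProj ℬ t)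
    (h : IsGrading ℬ) {g k : G} {v w : B} (hv : v ∈ ℬ g) (hw : w ∈ ℬ k) :
    hd.form t g k v w • (z g * z k) = ρ (t (v * w)) :=
  (hd.rho_eq (ht.map_mem (h.mul_mem hv hw))).symm

/-- Although `ρ` may have a kernel, nonzero homogeneous elements of `L` are units. -/
theorem IsLoopDatum.rho_ne_zero (h : IsGrading ℬ) (hs : IsGradedSimple ℬ) {g : G}
    {l : Center ℝ B} (hl : l ∈ centerGrading ℬ g) (h0 : l ≠ 0) : ρ l ≠ 0 := by
  obtain ⟨d, -, hd⟩ := hs.exists_inv h hl h0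
  intro h1
  have := congrArg ρ hd
  rw [map_mul, h1, zero_mul, map_one] at this
  exact zero_ne_one this

theorem IsCenterProj.map_proj (ht : IsCenterProj ℬ t) (h : IsGrading ℬ) (g : G) (x : B) :
    t (h.proj g x) = h.center.proj g (t x) := by
  refine h.induction x (fun k x hx => ?_) (by simp) (fun x y hx hy => ?_)
  · rw [h.proj_apply hx, h.center.proj_apply (ht.map_mem hx)]
    split_ifs <;> simp
  · simp only [map_add, hx, hy]

theorem IsCenterProj.map_smul_one (ht : IsCenterProj ℬ t) (l : Center ℝ B) :
    t (l • (1 : B)) = l := by rw [map_smul, ht.map_one, smul_eq_mul, mul_one]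

/-- If `t (v w) ≠ 0` for some homogeneous `w`, its degree `m` is in `H`. A unit of `L` of degree `k
g m⁻¹` moves `w` to degree `k` and keeps the product nonzero under `ρ`. -/
theorem IsLoopDatum.form_nondegenerate (hd : IsLoopDatum ℬ K ι ρ z) (ht : IsCenterProj ℬ t)
    (h : IsGrading ℬ) (hs : IsGradedSimple ℬ) {H : Subgroup G}
    (hH : (H : Set G) = centerSupport ℬ) {g k : G} (hgk : g * k ∈ H) {v : B}
    (hv : v ∈ hd.vec h t g) (hvw : ∀ w ∈ hd.vec h t k, hd.form t g k v w = 0) : v = 0 := by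
  refine ht.eq_zero hv.2 fun y hy => ?_
  refine h.center.ext fun m => ?_
  rw [map_zero, ← ht.map_proj h, h.proj_mul_left hv.1]
  set w := h.proj (g⁻¹ * m) y with hw
  have hwm : w ∈ ℬ (g⁻¹ * m) := h.proj_mem _ _
  have hw0 : t w = 0 := by rw [hw, ht.map_proj, hy, map_zero]
  by_contra hne
  have htm : t (v * w) ∈ centerGrading ℬ m := by
    have := ht.map_mem (h.mul_mem hv.1 hwm)
    rwa [mul_inv_cancel_left] at this
  have hm : m ∈ H := by
    rw [← SetLike.mem_coe, hH]
    exact mem_centerSupport.2 ⟨_, htm, hne⟩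
  have hkm : k * g * m⁻¹ ∈ centerSupport ℬ := by
    rw [← hH, SetLike.mem_coe, mul_comm k g]
    exact H.mul_mem hgk (H.inv_mem hm)
  obtain ⟨c, hc, hc0⟩ := mem_centerSupport.1 hkm
  have hcw : c • w ∈ ℬ k := by
    have := h.smul_mem hc hwm
    rwa [show k * g * m⁻¹ * (g⁻¹ * m) = k by rw [mul_comm g⁻¹]; group] at this
  have h0 := hvw (c • w) ⟨hcw, by rw [map_smul, hw0, smul_zero]⟩
  have h1 := hd.form_smul ht h hv.1 hcw
  rw [h0, zero_smul, mul_smul_comm, map_smul, smul_eq_mul, map_mul] at h1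
  rcases mul_eq_zero.1 h1.symm with h2 | h2
  · exact IsLoopDatum.rho_ne_zero h hs hc hc0 h2
  · exact IsLoopDatum.rho_ne_zero h hs htm hne h2

end LoopData

/-! ### Vectors and scalars in the algebra of a bilinear form -/

section FormAlgebra

variable {F V : Type*} [Field F] [AddCommGroup V] [Module F V] (b : LinearMap.BilinForm F V)

/-- The inclusion of `V` into `J(V, b)`. -/
def FormAlgebra.inr : V →ₗ[F] FormAlgebra b where
  toFun v := ⟨0, v⟩
  map_add' u v := by ext <;> simp
  map_smul' r v := by ext <;> simp

@[simp] theorem FormAlgebra.scalar_inr (v : V) : (FormAlgebra.inr b v).scalar = 0 := rfl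
@[simp] theorem FormAlgebra.vector_inr (v : V) : (FormAlgebra.inr b v).vector = v := rfl

variable {b}

theorem FormAlgebra.inr_mul_inr (u v : V) :
    FormAlgebra.inr b u * FormAlgebra.inr b v = b u v • (1 : FormAlgebra b) := by
  ext <;> simp

theorem FormAlgebra.eq_add (x : FormAlgebra b) :
    x = x.scalar • (1 : FormAlgebra b) + FormAlgebra.inr b x.vector := by
  ext <;> simp

theorem FormAlgebra.eq_zero_of_smul_add_smul {r s : F} {v : V}
    (h : r • (1 : FormAlgebra b) + s • FormAlgebra.inr b v = 0) : r = 0 ∧ (s = 0 ∨ v = 0) := by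
  constructor
  · simpa using congrArg FormAlgebra.scalar h
  · simpa using congrArg FormAlgebra.vector h

theorem FormAlgebra.inr_mem_grading {Γ : Type*} [CommGroup Γ] {𝒱 : Γ → Submodule F V} {g : Γ}
    {v : V} (hv : v ∈ 𝒱 g) : FormAlgebra.inr b v ∈ FormAlgebra.grading b 𝒱 g :=
  ⟨zero_mem _, hv⟩

theorem FormAlgebra.one_mem_grading {Γ : Type*} [CommGroup Γ] {𝒱 : Γ → Submodule F V} :
    (1 : FormAlgebra b) ∈ FormAlgebra.grading b 𝒱 1 :=
  ⟨by simp [trivialGrading], zero_mem _⟩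

end FormAlgebra

/-! ### The isomorphism onto the loop algebra -/

section Hom

variable {G : Type*} [CommGroup G]
  {B : Type*} [NonAssocCommRing B] [Module ℝ B] [SMulCommClass ℝ B B] [IsScalarTower ℝ B B]
  {ℬ : G → Submodule ℝ B} {K : Type*} [Field K] [Algebra K ℂ] [Module K B]
  {ι : K →+* Center ℝ B} {ρ : Center ℝ B →+* ℂ} {z : G → ℂ}
  {t : B →ₗ[Center ℝ B] Center ℝ B}

theorem IsGrading.exists_finset [Module.Finite ℝ B] (h : IsGrading ℬ) :
    ∃ T : Finset G, ∀ g ∉ T, ∀ x ∈ ℬ g, x = 0 := by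
  have hfin := WellFoundedGT.finite_ne_bot_of_iSupIndep h.indep
  refine ⟨hfin.toFinset, fun g hg x hx => ?_⟩
  rw [Set.Finite.mem_toFinset, Set.mem_ofPred_eq, not_not] at hg
  rwa [hg, Submodule.mem_bot] at hx

/-- A choice of `u ∈ L_m` and `u' ∈ L_{m⁻¹}` with `u u' = 1`, for `m` in the support of `L`. -/
theorem exists_units (h : IsGrading ℬ) (hs : IsGradedSimple ℬ) {H : Subgroup G}
    (hH : (H : Set G) = centerSupport ℬ) :
    ∃ u u' : G → Center ℝ B, ∀ g : G,
      u g ∈ centerGrading ℬ (g * ((g : G ⧸ H).out)⁻¹) ∧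
      u' g ∈ centerGrading ℬ ((g : G ⧸ H).out * g⁻¹) ∧ u g * u' g = 1 := by
  have : ∀ g : G, ∃ u u' : Center ℝ B, u ∈ centerGrading ℬ (g * ((g : G ⧸ H).out)⁻¹) ∧
      u' ∈ centerGrading ℬ ((g : G ⧸ H).out * g⁻¹) ∧ u * u' = 1 := by
    intro g
    have hg : g * ((g : G ⧸ H).out)⁻¹ ∈ centerSupport ℬ := by
      rw [← hH, SetLike.mem_coe, ← QuotientGroup.eq_one_iff, QuotientGroup.mk_mul,
        QuotientGroup.mk_inv, QuotientGroup.out_eq', mul_inv_cancel]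
    obtain ⟨c, hc, hc0⟩ := mem_centerSupport.1 hg
    obtain ⟨d, hd, hcd⟩ := hs.exists_inv h hc hc0
    exact ⟨c, d, hc, by rwa [mul_inv_rev, inv_inv] at hd, hcd⟩
  choose u u' huu using this
  exact ⟨u, u', huu⟩

set_option maxHeartbeats 1000000 in
-- A unit `u g ∈ L` carries `V` at the representative of the coset of `g` onto `V_g`. The map sends
-- `l ∈ L_g` to `1 ⊗ ρ(l) g`, and `u g • v` to `f(v) ⊗ ρ(u g) z(out) g`. Multiplicativity rests on
-- the fact that units of the same degree differ by a scalar from `L_e = K`. Even if `ρ` is not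
-- injective, `ψ` is, because the group element records the degree.
theorem IsLoopDatum.exists_hom [Module.Finite ℝ B] (hd : IsLoopDatum ℬ K ι ρ z)
    (ht : IsCenterProj ℬ t) (h : IsGrading ℬ) (hs : IsGradedSimple ℬ) {H : Subgroup G}
    (hH : (H : Set G) = centerSupport ℬ) (κ : G ⧸ H → ℕ) (ε : G ⧸ H → ℕ → K)
    (f : G ⧸ H → B →ₗ[K] StdSpace K κ)
    (hf_mem : ∀ x, ∀ v ∈ hd.vec h t x.out, f x v ∈ stdSpaceGrading K κ x)
    (hf_inj : ∀ x, ∀ v ∈ hd.vec h t x.out, f x v = 0 → v = 0)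
    (hf_surj : ∀ x, ∀ w ∈ stdSpaceGrading K κ x, ∃ v ∈ hd.vec h t x.out, f x v = w)
    (hf_form : ∀ x, ∀ v ∈ hd.vec h t x.out, ∀ w ∈ hd.vec h t (x⁻¹).out,
      stdForm κ ε (f x v) (f x⁻¹ w) = hd.form t x.out (x⁻¹).out v w) :
    ∃ ψ : B →ₗ[K] StdJordan κ ε ⊗[K] MonoidAlgebra ℂ G,
      (∀ x y, ψ (x * y) = ψ x * ψ y) ∧ Function.Injective ψ ∧
      (∀ g : G, ∀ x ∈ ℬ g, ∃ a ∈ stdJordanGrading κ ε (g : G ⧸ H),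
        ψ x = a ⊗ₜ MonoidAlgebra.single g (z g)) ∧
      ∀ g : G, ∀ a ∈ stdJordanGrading κ ε (g : G ⧸ H), ∃ x ∈ ℬ g,
        ψ x = a ⊗ₜ MonoidAlgebra.single g (z g) := by
  classical
  obtain ⟨u, u', huu⟩ := exists_units h hs hH
  choose hu hu' huu' using huu
  obtain ⟨T, hT⟩ := h.exists_finset
  have hsupp : ∀ {g : G} {l : Center ℝ B}, l ∈ centerGrading ℬ g → l ≠ 0 → (g : G ⧸ H) = 1 := by
    intro g l hl hl0
    rw [QuotientGroup.eq_one_iff, ← SetLike.mem_coe, hH]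
    exact mem_centerSupport.2 ⟨l, hl, hl0⟩
  have hproj : ∀ (g : G) (k : K) (x : B), h.proj g (k • x) = k • h.proj g x := by
    intro g k x
    rw [hd.smul_eq, hd.smul_eq, center_smul_def,
      h.proj_mul_left (k := 1) (mem_centerGrading.1 ((hd.mem_iff _).2 ⟨k, rfl⟩)), inv_one, one_mul]
    rfl
  let inr := FormAlgebra.inr (stdForm κ ε)
  let ψ₀ : G → B → StdJordan κ ε ⊗[K] MonoidAlgebra ℂ G := fun g x =>
    (1 : StdJordan κ ε) ⊗ₜ MonoidAlgebra.single g (ρ (t x)) +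
      inr (f g (u' g • (x - t x • (1 : B)))) ⊗ₜ
        MonoidAlgebra.single g (ρ (u g) * z (g : G ⧸ H).out)
  have hψ₀_add : ∀ g x y, ψ₀ g (x + y) = ψ₀ g x + ψ₀ g y := by
    intro g x y
    have e : x + y - (t x + t y) • (1 : B) = (x - t x • 1) + (y - t y • 1) := by
      rw [add_smul]; abel
    simp only [ψ₀, map_add, e, smul_add, MonoidAlgebra.single_add, TensorProduct.tmul_add,
      TensorProduct.add_tmul]
    abel
  have hψ₀_smul : ∀ g (k : K) x, ψ₀ g (k • x) = k • ψ₀ g x := by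
    intro g k x
    have e : u' g • (k • x - t (k • x) • (1 : B)) = k • (u' g • (x - t x • 1)) := by
      rw [hd.map_base_smul, hd.smul_eq, hd.smul_eq, mul_smul, ← smul_sub, smul_comm]
    simp only [ψ₀, e, map_smul, smul_add, ← TensorProduct.smul_tmul']
    congr 1
    rw [hd.map_base_smul, map_mul ρ, hd.rho_iota, ← Algebra.smul_def, ← MonoidAlgebra.smul_single,
      TensorProduct.tmul_smul]
  let ψ : B →ₗ[K] StdJordan κ ε ⊗[K] MonoidAlgebra ℂ G :=
    { toFun := fun x => ∑ g ∈ T, ψ₀ g (h.proj g x)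
      map_add' := fun x y => by simp only [map_add, hψ₀_add, Finset.sum_add_distrib]
      map_smul' := fun k x => by
        simp only [hproj, hψ₀_smul, Finset.smul_sum, RingHom.id_apply] }
  have hψ₀_zero : ∀ g, ψ₀ g 0 = 0 := fun g => by simp [ψ₀]
  have hψ : ∀ g : G, ∀ x ∈ ℬ g, ψ x = ψ₀ g x := by
    intro g x hx
    change ∑ g ∈ T, ψ₀ g (h.proj g x) = ψ₀ g x
    by_cases hg : g ∈ T
    · rw [Finset.sum_eq_single g, h.proj_same hx]
      · intro k _ hk; rw [h.proj_ne hx hk.symm, hψ₀_zero]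
      · intro hg'; exact absurd hg hg'
    · rw [hT g hg x hx]; simp [hψ₀_zero]
  have hψL : ∀ g : G, ∀ l ∈ centerGrading ℬ g, ψ (l • (1 : B)) =
      (1 : StdJordan κ ε) ⊗ₜ MonoidAlgebra.single g (ρ l) := by
    intro g l hl
    rw [hψ g _ (by rw [center_smul_one]; exact hl)]
    simp [ψ₀, ht.map_one]
  have hψV : ∀ g : G, ∀ v ∈ hd.vec h t g, ψ v = inr (f g (u' g • v)) ⊗ₜ
        MonoidAlgebra.single g (ρ (u g) * z (g : G ⧸ H).out) := by
    intro g v hv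
    rw [hψ g v hv.1]
    simp [ψ₀, hv.2]
  have hu'v : ∀ g : G, ∀ v ∈ hd.vec h t g, u' g • v ∈ hd.vec h t (g : G ⧸ H).out := by
    intro g v hv
    refine ⟨?_, by rw [map_smul, hv.2, smul_zero]⟩
    have := h.smul_mem (hu' g) hv.1
    rwa [inv_mul_cancel_right] at this
  have hdec : ∀ g : G, ∀ x ∈ ℬ g, ∃ l ∈ centerGrading ℬ g, ∃ v ∈ hd.vec h t g, x = l • 1 + v := by
    intro g x hx
    refine ⟨t x, ht.map_mem hx, x - t x • 1, ⟨sub_mem hx ?_, ?_⟩, by abel⟩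
    · rw [center_smul_one]; exact ht.map_mem hx
    · rw [map_sub, ht.map_smul_one, sub_self]
  have hLV : ∀ g : G, ∀ l ∈ centerGrading ℬ g, ∀ k : G, ∀ v ∈ hd.vec h t k, ψ (l • v) =
      inr (f k (u' k • v)) ⊗ₜ MonoidAlgebra.single (g * k) (ρ l * (ρ (u k) * z (k : G ⧸ H).out)) := by
    intro g l hl k v hv
    by_cases hl0 : l = 0
    · simp [hl0]
    have hgk : ((g * k : G) : G ⧸ H) = k := by
      rw [QuotientGroup.mk_mul, hsupp hl hl0, one_mul]
    have hlv : l • v ∈ hd.vec h t (g * k) :=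
      ⟨h.smul_mem hl hv.1, by rw [map_smul, hv.2, smul_zero]⟩
    -- As `g k` and `k` lie in one coset, the degrees cancel and the product is in `L_e = K`.
    obtain ⟨a, ha⟩ : ∃ a : K, ι a = u' (g * k) * l * u k := by
      refine (hd.mem_iff _).1 ?_
      have := h.center.mul_mem (h.center.mul_mem (hu' (g * k)) hl) (hu k)
      rw [hgk] at this
      convert this using 1
      rw [mul_inv_rev]
      group
    have e1 : u' (g * k) • l • v = a • u' k • v := by
      rw [hd.smul_eq, ha, smul_smul, smul_smul, mul_assoc _ (u k), huu', mul_one]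
    have e2 : ρ l * ρ (u k) = algebraMap K ℂ a * ρ (u (g * k)) := by
      rw [← hd.rho_iota, ha, ← map_mul, ← map_mul]
      congr 1
      rw [show u' (g * k) * l * u k * u (g * k) = (u (g * k) * u' (g * k)) * (l * u k) by ring, huu',
        one_mul]
    rw [hψV _ _ hlv, e1, hgk, map_smul, map_smul, ← mul_assoc (ρ l), e2, mul_assoc,
      ← Algebra.smul_def, tmul_single_smul]
  have hmul : ∀ g : G, ∀ x ∈ ℬ g, ∀ k : G, ∀ y ∈ ℬ k, ψ (x * y) = ψ x * ψ y := by
    intro g x hx k y hy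
    obtain ⟨l, hl, v, hv, rfl⟩ := hdec g x hx
    obtain ⟨m, hm, w, hw, rfl⟩ := hdec k y hy
    have c1 : ψ (l • (1 : B) * m • (1 : B)) = ψ (l • (1 : B)) * ψ (m • (1 : B)) := by
      rw [hψL g l hl, hψL k m hm, smul_mul_smul_comm, mul_one, hψL (g * k) _ (h.center.mul_mem hl hm),
        Algebra.TensorProduct.tmul_mul_tmul, MonoidAlgebra.single_mul_single, mul_one, map_mul]
    have c2 : ψ (l • (1 : B) * w) = ψ (l • (1 : B)) * ψ w := by
      rw [smul_mul_assoc, one_mul, hLV g l hl k w hw, hψL g l hl, hψV k w hw,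
        Algebra.TensorProduct.tmul_mul_tmul, MonoidAlgebra.single_mul_single, one_mul]
    have c3 : ψ (v * m • (1 : B)) = ψ v * ψ (m • (1 : B)) := by
      rw [mul_smul_comm, mul_one, hLV k m hm g v hv, hψL k m hm, hψV g v hv,
        Algebra.TensorProduct.tmul_mul_tmul, MonoidAlgebra.single_mul_single, mul_one, mul_comm k g,
        mul_comm (ρ m)]
    have c4 : ψ (v * w) = ψ v * ψ w := by
      have hvw := ht.map_mem (h.mul_mem hv.1 hw.1)
      rw [ht.mul_eq hv.2 hw.2, hψL (g * k) _ hvw, hψV g v hv, hψV k w hw,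
        Algebra.TensorProduct.tmul_mul_tmul, MonoidAlgebra.single_mul_single,
        FormAlgebra.inr_mul_inr, ← tmul_single_smul]
      congr 2
      -- On inverse cosets the isometry property applies to the vectors moved to the
      -- representatives. Otherwise the degree of `t (v * w)` is outside `H`, and both sides vanish.
      by_cases hgk : (k : G ⧸ H) = (g : G ⧸ H)⁻¹
      · have hv' := hu'v g v hv
        have hw' := hu'v k w hw
        rw [hgk] at hw'
        have e := hd.form_smul ht h hv'.1 hw'.1
        rw [hgk, hf_form _ _ hv' _ hw']
        rw [smul_mul_smul_comm, t.map_smul, smul_eq_mul, map_mul, map_mul] at e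
        have e1 : ρ (u g) * ρ (u' g) = 1 := by rw [← map_mul, huu', map_one]
        have e2 : ρ (u k) * ρ (u' k) = 1 := by rw [← map_mul, huu', map_one]
        rw [mul_mul_mul_comm, ← mul_smul_comm, e]
        linear_combination (-ρ (t (v * w))) * e1 - (ρ (u g) * ρ (u' g) * ρ (t (v * w))) * e2
      · rw [stdForm_eq_zero κ ε (hf_mem _ _ (hu'v g v hv)) (hf_mem _ _ (hu'v k w hw))
          (fun h' => hgk (eq_inv_of_mul_eq_one_right h')), zero_smul]
        by_contra hne
        have hne' : t (v * w) ≠ 0 := fun h0 => hne (by rw [h0, map_zero])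
        refine hgk (eq_inv_of_mul_eq_one_right ?_)
        rw [← QuotientGroup.mk_mul]
        exact hsupp hvw hne'
    rw [add_mul, mul_add, mul_add, map_add ψ (l • (1 : B)) v, map_add ψ (m • (1 : B)) w, map_add,
      map_add, map_add, c1, c2, c3, c4, add_mul, mul_add, mul_add]
  have hcomp : ∀ g : G, ∀ l ∈ centerGrading ℬ g, ∀ v ∈ hd.vec h t g, ∃ b a : K,
      ρ l = b • z g ∧ ρ (u g) * z (g : G ⧸ H).out = a • z g ∧
      ψ (l • 1 + v) = (b • (1 : StdJordan κ ε) + a • inr (f g (u' g • v))) ⊗ₜ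
        MonoidAlgebra.single g (z g) := by
    intro g l hl v hv
    obtain ⟨b, hb⟩ := hd.rho_mem hl
    obtain ⟨c, hc⟩ := hd.rho_mem (hu g)
    obtain ⟨d, hd'⟩ := hd.z_mul (g * ((g : G ⧸ H).out)⁻¹) (g : G ⧸ H).out
    rw [inv_mul_cancel_right] at hd'
    have ha : ρ (u g) * z (g : G ⧸ H).out = (c * d) • z g := by
      rw [hc, smul_mul_assoc, hd', smul_smul]
    refine ⟨b, c * d, hb, ha, ?_⟩
    rw [map_add, hψL g l hl, hψV g v hv, hb, ha, tmul_single_smul, tmul_single_smul,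
      TensorProduct.add_tmul]
  have hρu : ∀ g : G, ρ (u g) ≠ 0 := by
    intro g h0
    have := congrArg ρ (huu' g)
    rw [map_mul, h0, zero_mul, map_one] at this
    exact zero_ne_one this
  have hscalar : ∀ g : G, ∀ l ∈ centerGrading ℬ g, ∀ v ∈ hd.vec h t g, ψ (l • 1 + v) = 0 →
      l • 1 + v = 0 := by
    intro g l hl v hv h0
    obtain ⟨b, a, hb, ha, hab⟩ := hcomp g l hl v hv
    rw [h0, ← TensorProduct.zero_tmul (StdJordan κ ε) (MonoidAlgebra.single g (z g))] at hab
    have h1 := tmul_single_injective g (hd.z_ne_zero g) hab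
    obtain ⟨h2, h3⟩ := FormAlgebra.eq_zero_of_smul_add_smul h1.symm
    have hl0 : l = 0 := by
      by_contra hl0
      exact IsLoopDatum.rho_ne_zero h hs hl hl0 (by rw [hb, h2, zero_smul])
    have ha0 : a ≠ 0 := by
      rintro rfl
      rw [zero_smul] at ha
      exact mul_ne_zero (hρu g) (hd.z_ne_zero _) ha
    have hv0 := hf_inj _ _ (hu'v g v hv) (h3.resolve_left ha0)
    have hv1 : v = 0 := by
      rw [← one_smul (Center ℝ B) v, ← huu' g, mul_smul, hv0, smul_zero]
    rw [hl0, hv1, zero_smul, add_zero]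
  have hone : ∀ {g : G} {b : K} {l : Center ℝ B}, l ∈ centerGrading ℬ g → ρ l = b • z g →
      b • (1 : StdJordan κ ε) ∈ stdJordanGrading κ ε (g : G ⧸ H) := by
    intro g b l hl hb
    by_cases hb0 : b = 0
    · rw [hb0, zero_smul]; exact zero_mem _
    · rw [hsupp hl]
      · exact Submodule.smul_mem _ _ FormAlgebra.one_mem_grading
      · rintro rfl
        rw [map_zero, eq_comm, smul_eq_zero] at hb
        exact hb.elim hb0 (hd.z_ne_zero g)
  have hmem : ∀ g : G, ∀ x ∈ ℬ g, ∃ a ∈ stdJordanGrading κ ε (g : G ⧸ H),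
        ψ x = a ⊗ₜ MonoidAlgebra.single g (z g) := by
    intro g x hx
    obtain ⟨l, hl, v, hv, rfl⟩ := hdec g x hx
    obtain ⟨b, a, hb, ha, hab⟩ := hcomp g l hl v hv
    exact ⟨_, add_mem (hone hl hb) (Submodule.smul_mem _ _
      (FormAlgebra.inr_mem_grading (hf_mem _ _ (hu'v g v hv)))), hab⟩
  refine ⟨ψ, fun x y => ?_, ?_, hmem, ?_⟩
  · refine h.induction x (fun g x hx => ?_) (by simp) (fun x x' hx hx' => ?_)
    · refine h.induction y (fun k y hy => hmul g x hx k y hy) (by simp) (fun y y' hy hy' => ?_)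
      rw [mul_add, map_add, hy, hy', map_add, mul_add]
    · rw [add_mul, map_add, hx, hx', map_add, add_mul]
  · rw [injective_iff_map_eq_zero]
    intro x hx
    refine h.ext fun g => ?_
    rw [map_zero]
    have key : ∀ y : B, extract K (StdJordan κ ε) g (z g) (ψ y) =
        extract K (StdJordan κ ε) g (z g) (ψ (h.proj g y)) := by
      intro y
      refine h.induction y (fun k y hy => ?_) (by simp) (fun x y hx hy => ?_)
      · by_cases hk : k = g
        · subst hk; rw [h.proj_same hy]
        · obtain ⟨a, -, ha⟩ := hmem k y hy
          rw [ha, extract_ne hk, h.proj_ne hy hk, map_zero, map_zero]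
      · simp only [map_add, hx, hy]
    have h1 := key x
    rw [hx, map_zero] at h1
    obtain ⟨a, -, ha⟩ := hmem g _ (h.proj_mem g x)
    rw [ha, extract_same g (hd.z_ne_zero g)] at h1
    rw [← h1, TensorProduct.zero_tmul] at ha
    obtain ⟨l, hl, v, hv, hlv⟩ := hdec g _ (h.proj_mem g x)
    rw [hlv] at ha ⊢
    exact hscalar g l hl v hv ha
  · rintro g a ⟨ha1, ha2⟩
    -- The zero vectors serve only to obtain the scalar `c` with `ρ (u g) z(out) = c z g`, for which
    -- the preimage has to compensate by `c⁻¹`.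
    obtain ⟨b₀, c, -, hc, -⟩ := hcomp g 0 (zero_mem _) 0 (zero_mem _)
    have hc0 : c ≠ 0 := by
      rintro rfl
      rw [zero_smul] at hc
      exact mul_ne_zero (hρu g) (hd.z_ne_zero _) hc
    obtain ⟨v₀, hv₀, hfv₀⟩ := hf_surj _ (c⁻¹ • a.vector) (Submodule.smul_mem _ _ ha2)
    have hv : u g • v₀ ∈ hd.vec h t g := by
      refine ⟨?_, by rw [map_smul, hv₀.2, smul_zero]⟩
      have := h.smul_mem (hu g) hv₀.1
      rwa [inv_mul_cancel_right] at this
    obtain ⟨l, hl, hla⟩ : ∃ l ∈ centerGrading ℬ g, ρ l = a.scalar • z g := by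
      by_cases hg : (g : G ⧸ H) = 1
      · have hgH : g ∈ centerSupport ℬ := by
          rw [← hH, SetLike.mem_coe, ← QuotientGroup.eq_one_iff, hg]
        obtain ⟨l, hl, hl0⟩ := mem_centerSupport.1 hgH
        obtain ⟨b, hb⟩ := hd.rho_mem hl
        have hb0 : b ≠ 0 := by
          rintro rfl
          exact IsLoopDatum.rho_ne_zero h hs hl hl0 (by rw [hb, zero_smul])
        refine ⟨ι (a.scalar * b⁻¹) * l, ?_, ?_⟩
        · rw [← one_mul g]
          exact h.center.mul_mem ((hd.mem_iff _).2 ⟨_, rfl⟩) hl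
        · rw [map_mul, hd.rho_iota, ← Algebra.smul_def, hb, smul_smul, mul_assoc,
            inv_mul_cancel₀ hb0, mul_one]
      · rw [trivialGrading, if_neg hg, Submodule.mem_bot] at ha1
        exact ⟨0, zero_mem _, by rw [ha1, map_zero, zero_smul]⟩
    obtain ⟨b, c', hb, hc', hbc⟩ := hcomp g l hl _ hv
    have hbb : b = a.scalar := smul_left_injective K (hd.z_ne_zero g) (hb.symm.trans hla)
    have hcc : c' = c := smul_left_injective K (hd.z_ne_zero g) (hc'.symm.trans hc)
    refine ⟨l • 1 + u g • v₀, add_mem (by rw [center_smul_one]; exact hl) hv.1, ?_⟩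
    rw [hbc]
    congr 1
    rw [smul_smul, mul_comm (u' g), huu', one_smul, hfv₀, hcc, ← map_smul, smul_smul,
      mul_inv_cancel₀ hc0, one_smul, hbb]
    exact a.eq_add.symm

end Hom

/-! ### Diagonalization of symmetric forms -/

section Diagonal

variable {K M : Type*} [Field K] [NeZero (2 : K)] [AddCommGroup M] [Module K M]

theorem bilin_eq_of_weightedSumSquares {n : ℕ} (β : M →ₗ[K] M →ₗ[K] K)
    (hsymm : ∀ v w, β v w = β w v) (w : Fin n → K) (e : M ≃ₗ[K] (Fin n → K))
    (he : ∀ v, ∑ i, w i * (e v i * e v i) = β v v) (u v : Fin n → K) :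
    β (e.symm u) (e.symm v) = ∑ i, w i * (u i * v i) := by
  have h1 := he (e.symm (u + v))
  have h2 := he (e.symm u)
  have h3 := he (e.symm v)
  simp only [LinearEquiv.apply_symm_apply] at h1 h2 h3
  have h4 : (2 : K) * β (e.symm u) (e.symm v) = 2 * ∑ i, w i * (u i * v i) := by
    rw [map_add, map_add, map_add, LinearMap.add_apply, LinearMap.add_apply,
      hsymm (e.symm v) (e.symm u), ← h2, ← h3] at h1
    have h5 : ∑ i, w i * ((u + v) i * (u + v) i) = ∑ i, w i * (u i * u i) + ∑ i, w i * (v i * v i) +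
        2 * ∑ i, w i * (u i * v i) := by
      rw [Finset.mul_sum, ← Finset.sum_add_distrib, ← Finset.sum_add_distrib]
      exact Finset.sum_congr rfl fun i _ => by simp only [Pi.add_apply]; ring
    rw [h5] at h1
    linear_combination -h1
  exact mul_left_cancel₀ (NeZero.ne 2) h4

/-- The restriction to a subspace of the quadratic form of a bilinear form. -/
def restrictQuad (β : M →ₗ[K] M →ₗ[K] K) (W : Submodule K M) : QuadraticForm K W :=
  (LinearMap.BilinMap.toQuadraticMap β).comp W.subtype

theorem restrictQuad_apply (β : M →ₗ[K] M →ₗ[K] K) (W : Submodule K M) (v : W) :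
    restrictQuad β W v = β v v := rfl

theorem separatingLeft_restrictQuad [Invertible (2 : K)] (β : M →ₗ[K] M →ₗ[K] K) (W : Submodule K M)
    (hsymm : ∀ v w, β v w = β w v) (hnd : ∀ v ∈ W, (∀ w ∈ W, β v w = 0) → v = 0) :
    LinearMap.SeparatingLeft (QuadraticMap.associated (R := K) (restrictQuad β W)) := by
  intro v hv
  refine Subtype.ext (hnd v v.2 fun w hw => ?_)
  have h1 := LinearMap.congr_fun₂ (QuadraticMap.two_nsmul_associated K (restrictQuad β W)) v ⟨w, hw⟩
  rw [LinearMap.smul_apply, LinearMap.smul_apply, hv, smul_zero, QuadraticMap.polarBilin_apply_apply,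
    QuadraticMap.polar] at h1
  simp only [restrictQuad_apply, Submodule.coe_add, map_add, LinearMap.add_apply,
    hsymm w v] at h1
  have h2 : (2 : K) * β v w = 0 := by linear_combination -h1
  exact (mul_eq_zero.1 h2).resolve_left (NeZero.ne 2)

theorem diag_of_weightedSumSquares {n : ℕ} (β : M →ₗ[K] M →ₗ[K] K) (W : Submodule K M)
    (hsymm : ∀ v w, β v w = β w v) (w : Fin n → K)
    (he : (restrictQuad β W).Equivalent (QuadraticMap.weightedSumSquares K w)) :
    ∃ b : ℕ → M, (∀ i, b i ∈ W) ∧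
      ∀ i j : Fin n, β (b i) (b j) = if i = j then w i else 0 := by
  classical
  obtain ⟨e⟩ := he
  let β' : W →ₗ[K] W →ₗ[K] K := β.domRestrict₁₂ W W
  have key := bilin_eq_of_weightedSumSquares β' (fun v w => hsymm v w) w e.toLinearEquiv
    (fun v => by
      have := e.map_app v
      rw [QuadraticMap.weightedSumSquares_apply] at this
      exact this)
  refine ⟨fun i => if hi : i < n then (e.toLinearEquiv.symm (Pi.single ⟨i, hi⟩ 1) : W) else 0,
    fun i => ?_, fun i j => ?_⟩
  · dsimp only; split_ifs
    · exact Subtype.property _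
    · exact zero_mem _
  · have := key (Pi.single i 1) (Pi.single j 1)
    simp only [Fin.is_lt, dif_pos, Fin.eta]
    refine Eq.trans this ?_
    rw [Finset.sum_eq_single i]
    · by_cases hij : i = j
      · subst hij; simp
      · rw [if_neg hij, Pi.single_eq_of_ne hij]; simp
    · intro k _ hk; simp [Pi.single_eq_of_ne hk]
    · simp

end Diagonal

theorem exists_complex_diag {M : Type*} [AddCommGroup M] [Module ℂ M] [FiniteDimensional ℂ M]
    (β : M →ₗ[ℂ] M →ₗ[ℂ] ℂ) (W : Submodule ℂ M)
    (hsymm : ∀ v w, β v w = β w v) (hnd : ∀ v ∈ W, (∀ w ∈ W, β v w = 0) → v = 0) :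
    ∃ b : ℕ → M, (∀ i, b i ∈ W) ∧ ∀ i < Module.finrank ℂ W, ∀ j < Module.finrank ℂ W,
      β (b i) (b j) = if i = j then 1 else 0 := by
  have he := QuadraticForm.equivalent_weightedSumSquares_of_isAlgClosed (restrictQuad β W)
    (separatingLeft_restrictQuad β W hsymm hnd)
  obtain ⟨b, hb, hbb⟩ := diag_of_weightedSumSquares β W hsymm _ he
  refine ⟨b, hb, fun i hi j hj => ?_⟩
  have := hbb ⟨i, hi⟩ ⟨j, hj⟩
  simpa only [Fin.mk.injEq, Pi.one_apply] using this

/-- Sylvester's theorem gives signs in some order; a permutation puts the positive ones first, as in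
the convention of `realSign`. -/
theorem exists_real_diag {M : Type*} [AddCommGroup M] [Module ℝ M] [FiniteDimensional ℝ M]
    (β : M →ₗ[ℝ] M →ₗ[ℝ] ℝ) (W : Submodule ℝ M)
    (hsymm : ∀ v w, β v w = β w v) (hnd : ∀ v ∈ W, (∀ w ∈ W, β v w = 0) → v = 0) :
    ∃ b : ℕ → M, (∀ i, b i ∈ W) ∧ ∀ i < Module.finrank ℝ W, ∀ j < Module.finrank ℝ W,
      β (b i) (b j) = if i = j then
        (if i < sigPos (restrictQuad β W) then 1 else -1) else 0 := by
  classical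
  obtain ⟨w, hw, he⟩ := QuadraticForm.equivalent_one_neg_one_weighted_sum_squared (restrictQuad β W)
    (separatingLeft_restrictQuad β W hsymm hnd)
  have hp := QuadraticForm.sigPos_of_equiv_weightedSumSquares he
  obtain ⟨b, hb, hbb⟩ := diag_of_weightedSumSquares β W hsymm _ he
  generalize sigPos (restrictQuad β W) = p at *
  generalize Module.finrank ℝ W = n at *
  have hpn : p ≤ n := by
    rw [hp]
    exact (Set.ncard_le_card _).trans_eq (by simp)
  have hcard : Fintype.card {i : Fin n // (i : ℕ) < p} = Fintype.card {i : Fin n // 0 < w i} := by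
    rw [Fintype.card_subtype, Fin.card_filter_val_lt, min_eq_right hpn, hp,
      Set.ncard_eq_toFinset_card', Fintype.card_subtype]
    congr 1
    ext i; simp
  let s : Equiv.Perm (Fin n) := (Fintype.equivOfCardEq hcard).extendSubtype
  have hs : ∀ i, w (s i) = if (i : ℕ) < p then 1 else -1 := by
    intro i
    split_ifs with hi
    · have := (Fintype.equivOfCardEq hcard).extendSubtype_mem i hi
      refine (hw _).resolve_left fun h => ?_
      have h2 : 0 < w (s i) := this
      rw [h] at h2
      norm_num at h2
    · have := (Fintype.equivOfCardEq hcard).extendSubtype_not_mem i hi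
      exact (hw _).resolve_right fun h => this (by change 0 < w (s i); rw [h]; norm_num)
  refine ⟨fun i => if hi : i < n then b (s ⟨i, hi⟩) else 0, fun i => ?_, fun i hi j hj => ?_⟩
  · dsimp only; split_ifs
    · exact hb _
    · exact zero_mem _
  · simp only [hi, hj, dif_pos, hbb, s.injective.eq_iff, Fin.mk.injEq, hs]

/-! ### Signatures under rescaling of the form -/

section Signature

variable {M : Type*} [AddCommGroup M] [Module ℝ M] [FiniteDimensional ℝ M]

/-- Multiplication by `√c` is an isometry from the rescaled form to the original one. -/
theorem sigPos_restrictQuad_of_pos {β β' : M →ₗ[ℝ] M →ₗ[ℝ] ℝ} {W : Submodule ℝ M} {c : ℝ}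
    (hc : 0 < c) (h : ∀ v ∈ W, β' v v = c * β v v) :
    sigPos (restrictQuad β' W) = sigPos (restrictQuad β W) := by
  refine QuadraticMap.Equivalent.sigPos_eq ⟨{ LinearEquiv.smulOfNeZero ℝ W (Real.sqrt c)
    (Real.sqrt_pos.2 hc).ne' with map_app' := fun v => ?_ }⟩
  change restrictQuad β W (Real.sqrt c • v) = _
  rw [QuadraticMap.map_smul, Real.mul_self_sqrt hc.le, restrictQuad_apply, restrictQuad_apply,
    h v v.2, smul_eq_mul]

/-- Up to a positive factor the new form is `-β`, whose positive index is the negative index of `β`;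
the radical is zero, so the two indices add up to the dimension. -/
theorem sigPos_add_sigPos_restrictQuad_of_neg {β β' : M →ₗ[ℝ] M →ₗ[ℝ] ℝ} {W : Submodule ℝ M} {c : ℝ}
    (hc : c < 0) (h : ∀ v ∈ W, β' v v = c * β v v)
    (hsymm : ∀ v w, β v w = β w v) (hnd : ∀ v ∈ W, (∀ w ∈ W, β v w = 0) → v = 0) :
    sigPos (restrictQuad β W) + sigPos (restrictQuad β' W) = Module.finrank ℝ W := by
  have h1 : sigPos (restrictQuad β' W) = sigPos (restrictQuad (-β) W) :=
    sigPos_restrictQuad_of_pos (neg_pos.2 hc) fun v hv => by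
      rw [h v hv, LinearMap.neg_apply, LinearMap.neg_apply, neg_mul_neg]
  have h2 : restrictQuad (-β) W = -restrictQuad β W := by
    ext v; simp [restrictQuad_apply]
  rw [h1, h2, sigPos_neg]
  rw [← QuadraticForm.sigPos_add_sigNeg_add_radical (Q := restrictQuad β W)]
  suffices h3 : (restrictQuad β W).radical = ⊥ by rw [h3, finrank_bot, add_zero]
  refine (Submodule.eq_bot_iff _).2 fun v hv => Subtype.ext (hnd v v.2 fun w hw => ?_)
  have h4 := LinearMap.congr_fun hv.2 ⟨w, hw⟩
  rw [QuadraticMap.polarBilin_apply_apply, QuadraticMap.polar] at h4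
  simp only [restrictQuad_apply, Submodule.coe_add, map_add, LinearMap.add_apply, hsymm w v,
    LinearMap.zero_apply] at h4
  linarith

end Signature

/-! ### Coordinates on a component, and the signature of the standard form -/

section Coordinates

variable {R K M : Type*} [Field R] [Field K] [Algebra R K] [AddCommGroup M] [Module R M]
  {Γ : Type*} [CommGroup Γ] {κ : Γ → ℕ}

theorem eq_sum_single_of_mem_stdSpaceGrading {x : Γ} {u : StdSpace K κ}
    (hu : u ∈ stdSpaceGrading K κ x) :
    u = ∑ i : Fin (κ x), u ⟨x, i⟩ • Finsupp.single (⟨x, i⟩ : BasisIndex κ) (1 : K) := by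
  classical
  ext ⟨y, j⟩
  rw [Finsupp.finsetSum_apply]
  by_cases hy : y = x
  · subst hy
    rw [Finset.sum_eq_single j]
    · simp
    · intro i _ hi
      rw [Finsupp.smul_apply, Finsupp.single_apply, if_neg, smul_zero]
      simpa using hi
    · simp
  · rw [Finset.sum_eq_zero]
    · exact (Finsupp.mem_supported' K u).1 hu _ hy
    · intro i _
      rw [Finsupp.smul_apply, Finsupp.single_apply, if_neg, smul_zero]
      intro h'
      exact hy (congrArg Sigma.fst h').symm

theorem exists_coordinates (x : Γ) (W : Submodule R M) (f : M →ₗ[R] StdSpace K κ)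
    (hf : ∀ v ∈ W, f v ∈ stdSpaceGrading K κ x) (hinj : ∀ v ∈ W, f v = 0 → v = 0)
    (hsurj : ∀ w ∈ stdSpaceGrading K κ x, ∃ v ∈ W, f v = w) :
    ∃ e : W ≃ₗ[R] (Fin (κ x) → K), ∀ v i, e v i = f v ⟨x, i⟩ := by
  classical
  let φ : W →ₗ[R] (Fin (κ x) → K) :=
    { toFun := fun v i => f v ⟨x, i⟩
      map_add' := fun v w => by ext i; simp
      map_smul' := fun r v => by ext i; simp }
  have hφ : Function.Bijective φ := by
    constructor
    · rw [injective_iff_map_eq_zero]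
      intro v hv
      refine Subtype.ext (hinj v v.2 ?_)
      rw [eq_sum_single_of_mem_stdSpaceGrading (hf v v.2)]
      refine Finset.sum_eq_zero fun i _ => ?_
      have : f v ⟨x, i⟩ = 0 := congrFun hv i
      rw [this, zero_smul]
    · intro a
      have hmem : ∑ i : Fin (κ x), a i • Finsupp.single (⟨x, i⟩ : BasisIndex κ) (1 : K) ∈
          stdSpaceGrading K κ x :=
        Submodule.sum_mem _ fun i _ =>
          Submodule.smul_mem _ _ (Finsupp.single_mem_supported K _ rfl)
      obtain ⟨v, hv, hfv⟩ := hsurj _ hmem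
      refine ⟨⟨v, hv⟩, funext fun j => ?_⟩
      change f v ⟨x, j⟩ = a j
      rw [hfv, Finsupp.finsetSum_apply, Finset.sum_eq_single j]
      · simp
      · intro i _ hi
        rw [Finsupp.smul_apply, Finsupp.single_apply, if_neg, smul_zero]
        simpa using hi
      · simp
  exact ⟨LinearEquiv.ofBijective φ hφ, fun _ _ => rfl⟩

end Coordinates

section SignatureCoordinates

variable {M : Type*} [AddCommGroup M] [Module ℝ M]

variable {Γ : Type*} [CommGroup Γ]

/-- In the coordinates given by `f` the form is diagonal with signs `realSign`, and the bounds and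
parity in `IsSignature` make exactly `(κ x + σ x) / 2` of them positive. -/
theorem two_mul_sigPos_of_stdForm {κ : Γ → ℕ} {σ : TwoTorsion Γ → ℤ} (hσ : IsSignature κ σ)
    (x : TwoTorsion Γ) (β : M →ₗ[ℝ] M →ₗ[ℝ] ℝ) (W : Submodule ℝ M)
    (f : M →ₗ[ℝ] StdSpace ℝ κ) (hf : ∀ v ∈ W, f v ∈ stdSpaceGrading ℝ κ x)
    (hinj : ∀ v ∈ W, f v = 0 → v = 0) (hsurj : ∀ w ∈ stdSpaceGrading ℝ κ x, ∃ v ∈ W, f v = w)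
    (hform : ∀ v ∈ W, stdForm κ (realSign κ σ) (f v) (f v) = β v v) :
    2 * (sigPos (restrictQuad β W) : ℤ) = κ x + σ x := by
  classical
  have hx : (x : Γ) = (x : Γ)⁻¹ := by
    have := x.2
    rw [MonoidHom.mem_ker, powMonoidHom_apply, pow_two] at this
    exact eq_inv_of_mul_eq_one_left this
  obtain ⟨e, he'⟩ := exists_coordinates (x : Γ) W f hf hinj hsurj
  have he : (restrictQuad β W).Equivalent
      (QuadraticMap.weightedSumSquares ℝ fun i : Fin (κ x) => realSign κ σ x i) := by
    refine ⟨{ e with map_app' := fun v => ?_ }⟩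
    change QuadraticMap.weightedSumSquares ℝ _ (e v) = _
    rw [QuadraticMap.weightedSumSquares_apply, restrictQuad_apply, ← hform v v.2,
      eq_sum_single_of_mem_stdSpaceGrading (hf v v.2)]
    simp only [map_sum, LinearMap.sum_apply, map_smul, LinearMap.smul_apply, stdForm_single]
    refine Finset.sum_congr rfl fun i _ => ?_
    rw [Finset.sum_eq_single i]
    · rw [if_pos ⟨hx, rfl⟩]
      rw [he']
      simp only [smul_eq_mul]; ring
    · intro j _ hj
      rw [if_neg, smul_zero]
      rintro ⟨-, h'⟩
      exact hj (Fin.ext h')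
    · simp
  rw [QuadraticForm.sigPos_of_equiv_weightedSumSquares he, Set.ncard_eq_toFinset_card']
  obtain ⟨h1, h2⟩ := hσ x
  obtain ⟨h1a, h1b⟩ := abs_le.1 h1
  clear h1
  have h3 : (σ x + κ x) % 2 = 0 := by
    have := h2; unfold Int.ModEq at this; omega
  obtain ⟨q, hq⟩ : ∃ q : ℕ, σ x + κ x = 2 * q := by
    exact ⟨((σ x + κ x) / 2).toNat, by omega⟩
  have h4 : (Set.toFinset {i : Fin (κ x) | 0 < realSign κ σ x i}) =
      Finset.univ.filter fun i : Fin (κ x) => (i : ℕ) < q := by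
    ext i
    simp only [Set.mem_toFinset, Set.mem_ofPred_eq, Finset.mem_filter, Finset.mem_univ, true_and,
      realSign, SetLike.coe_mem, dif_pos, Subtype.coe_eta]
    have h5 : 2 * ((i : ℕ) : ℤ) < κ x + σ x ↔ (i : ℕ) < q := by omega
    simp only [h5]
    split_ifs with hi <;> simp [hi]
  rw [h4, Fin.card_filter_val_lt, min_eq_right]
  · omega
  · omega

end SignatureCoordinates

/-! ### The real lines fixed by `w ↦ c conj w` -/

section Fixed

/-- A square root `w` of `c` has modulus one, so `c conj w = w² conj w = w`. -/
theorem exists_circle_sqrt (c : Circle) : ∃ w : ℂ, w ≠ 0 ∧ w = (c : ℂ) * (starRingEnd ℂ) w := by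
  obtain ⟨w, hw⟩ := IsAlgClosed.exists_pow_nat_eq (c : ℂ) (n := 2) two_pos
  have hw1 : ‖w‖ = 1 := by
    have := congrArg norm hw
    rw [norm_pow, Circle.norm_coe] at this
    exact (pow_eq_one_iff_of_nonneg (norm_nonneg w) two_ne_zero).1 this
  have h0 : w ≠ 0 := by rintro rfl; simp at hw1
  refine ⟨w, h0, ?_⟩
  rw [← hw, pow_two, mul_assoc, Complex.mul_conj, Complex.normSq_eq_norm_sq, hw1]
  simp

/-- The quotient `w' / w` is invariant under conjugation. -/
theorem exists_real_smul_of_fixed {c : Circle} {w w' : ℂ} (h0 : w ≠ 0)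
    (hw : w = (c : ℂ) * (starRingEnd ℂ) w) (hw' : w' = (c : ℂ) * (starRingEnd ℂ) w') :
    ∃ r : ℝ, w' = r • w := by
  have h0' : (starRingEnd ℂ) w ≠ 0 := (map_ne_zero _).2 h0
  have h : (starRingEnd ℂ) (w' / w) = w' / w := by
    rw [map_div₀]
    conv_rhs => rw [hw, hw']
    rw [mul_div_mul_left _ _ (Circle.coe_ne_zero c)]
  obtain ⟨r, hr⟩ := Complex.conj_eq_iff_real.1 h
  refine ⟨r, ?_⟩
  rw [Complex.real_smul, ← hr, div_mul_cancel₀ _ h0]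

end Fixed

/-! ### Graded isomorphisms with loop algebras as maps into `A ⊗ ℂ G` -/

section LoopEmbedding

variable {G Γ : Type*} [CommGroup G] [CommGroup Γ]

/-- `ψ` maps the component `ℬ g` bijectively onto `𝒜 (π g) ⊗ z g g ⊆ A ⊗ ℂ G`, and it is a
homomorphism of real algebras. -/
structure IsLoopEmbedding {B : Type*} [NonUnitalNonAssocRing B] [Module ℝ B]
    (ℬ : G → Submodule ℝ B) (π : G →* Γ) {K : Type*} [Field K] [Algebra K ℂ] [Algebra ℝ K]
    {A : Type*} [NonUnitalNonAssocRing A] [Module K A] [SMulCommClass K A A] [IsScalarTower K A A]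
    (𝒜 : Γ → Submodule K A) (z : G → ℂ) (ψ : B →+ A ⊗[K] MonoidAlgebra ℂ G) : Prop where
  map_smul : ∀ (r : ℝ) (x : B), ψ (r • x) = algebraMap ℝ K r • ψ x
  map_mul : ∀ x y, ψ (x * y) = ψ x * ψ y
  injective : Function.Injective ψ
  map_mem : ∀ {g : G} {x : B}, x ∈ ℬ g → ∃ a ∈ 𝒜 (π g), ψ x = a ⊗ₜ MonoidAlgebra.single g (z g)
  surj : ∀ {g : G} {a : A}, a ∈ 𝒜 (π g) → ∃ x ∈ ℬ g, ψ x = a ⊗ₜ MonoidAlgebra.single g (z g)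

variable {B : Type*} [NonUnitalNonAssocRing B] [Module ℝ B] {ℬ : G → Submodule ℝ B} {π : G →* Γ}

section Real

variable {A : Type*} [NonUnitalNonAssocRing A] [Module ℝ A] [SMulCommClass ℝ A A]
  [IsScalarTower ℝ A A] {𝒜 : Γ → Submodule ℝ A} {χ : G →* Circle} {z : G → ℂ}

theorem mem_realLoopComponent (hz : ∀ g, z g ≠ 0 ∧ z g = (χ g : ℂ) * (starRingEnd ℂ) (z g))
    {g : G} {y : A ⊗[ℝ] MonoidAlgebra ℂ G} :
    y ∈ realLoopComponent π χ 𝒜 g ↔ ∃ a ∈ 𝒜 (π g), y = a ⊗ₜ MonoidAlgebra.single g (z g) := by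
  constructor
  · intro hy
    induction hy using Submodule.span_induction with
    | mem y hy =>
      obtain ⟨a, ha, w, hw, rfl⟩ := hy
      obtain ⟨r, rfl⟩ := exists_real_smul_of_fixed (hz g).1 (hz g).2 hw
      exact ⟨r • a, Submodule.smul_mem _ _ ha, tmul_single_smul g (z g) a r⟩
    | zero => exact ⟨0, zero_mem _, by simp⟩
    | add x y _ _ hx hy =>
      obtain ⟨a, ha, rfl⟩ := hx
      obtain ⟨b, hb, rfl⟩ := hy
      exact ⟨a + b, add_mem ha hb, (TensorProduct.add_tmul _ _ _).symm⟩
    | smul r x _ hx =>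
      obtain ⟨a, ha, rfl⟩ := hx
      exact ⟨r • a, Submodule.smul_mem _ _ ha, rfl⟩
  · rintro ⟨a, ha, rfl⟩
    exact Submodule.subset_span ⟨a, ha, z g, (hz g).2, rfl⟩

end Real

section Complex

variable {A : Type*} [NonUnitalNonAssocRing A] [Module ℂ A] [SMulCommClass ℂ A A]
  [IsScalarTower ℂ A A] {𝒜 : Γ → Submodule ℂ A}

theorem mem_loopComponent {g : G} {y : A ⊗[ℂ] MonoidAlgebra ℂ G} :
    y ∈ loopComponent π 𝒜 g ↔ ∃ a ∈ 𝒜 (π g), y = a ⊗ₜ MonoidAlgebra.single g (1 : ℂ) := by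
  constructor
  · intro hy
    induction hy using Submodule.span_induction with
    | mem y hy => exact hy
    | zero => exact ⟨0, zero_mem _, by simp⟩
    | add x y _ _ hx hy =>
      obtain ⟨a, ha, rfl⟩ := hx
      obtain ⟨b, hb, rfl⟩ := hy
      exact ⟨a + b, add_mem ha hb, (TensorProduct.add_tmul _ _ _).symm⟩
    | smul r x _ hx =>
      obtain ⟨a, ha, rfl⟩ := hx
      exact ⟨r • a, Submodule.smul_mem _ _ ha, rfl⟩
  · rintro ⟨a, ha, rfl⟩
    exact Submodule.subset_span ⟨a, ha, rfl⟩

end Complex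

section General

variable {K : Type*} [Field K] [Algebra K ℂ] [Algebra ℝ K]
    {A : Type*} [NonUnitalNonAssocRing A] [Module K A] [SMulCommClass K A A] [IsScalarTower K A A]
    {𝒜 : Γ → Submodule K A} {z : G → ℂ}

/-- If a homomorphism into `A ⊗ ℂ G` maps `ℬ g` into `A ⊗ z g g`, then it reflects degrees. -/
theorem mem_of_map_eq_tmul_single {B : Type*} [NonUnitalNonAssocRing B] [Module ℝ B]
    {ℬ : G → Submodule ℝ B} (h : IsGrading ℬ) (hz : ∀ g, z g ≠ 0)
    (ψ : B →+ A ⊗[K] MonoidAlgebra ℂ G) (hinj : Function.Injective ψ)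
    (hmem : ∀ g, ∀ x ∈ ℬ g, ∃ a : A, ψ x = a ⊗ₜ MonoidAlgebra.single g (z g)) {g : G} {x : B} {a : A}
    (hx : ψ x = a ⊗ₜ MonoidAlgebra.single g (z g)) : x ∈ ℬ g := by
  have key : ∀ k x, ψ (h.proj k x) =
      extract K A k (z k) (ψ x) ⊗ₜ MonoidAlgebra.single k (z k) := by
    intro k x
    refine h.induction x (fun m x hx => ?_) (by simp) (fun x y hx hy => ?_)
    · obtain ⟨a, ha⟩ := hmem m x hx
      by_cases hmk : m = k
      · subst hmk
        rw [h.proj_same hx, ha, extract_same m (hz m)]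
      · rw [h.proj_ne hx hmk, ha, extract_ne hmk, map_zero, TensorProduct.zero_tmul]
    · rw [map_add, map_add, map_add, map_add, hx, hy, TensorProduct.add_tmul]
  have : x = h.proj g x := h.ext fun k => hinj (by
    rw [h.proj_apply (h.proj_mem g x)]
    split_ifs with hk
    · subst hk; rfl
    · rw [key, hx, extract_ne hk, TensorProduct.zero_tmul, map_zero])
  rw [this]
  exact h.proj_mem g x

end General

section RealIso

variable {A : Type*} [NonUnitalNonAssocRing A] [Module ℝ A] [SMulCommClass ℝ A A]
  [IsScalarTower ℝ A A] {𝒜 : Γ → Submodule ℝ A} {χ : G →* Circle} {z : G → ℂ}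

/-- This trades the subalgebra and its grading for a map into the ambient algebra. A preimage of an
element of a component is homogeneous because such maps reflect degrees; conversely, the components
span the loop algebra. -/
theorem gradedIso_realLoopGrading_iff (h : IsGrading ℬ) (h𝒜 : IsGrading 𝒜)
    (hz : ∀ g, z g ≠ 0 ∧ z g = (χ g : ℂ) * (starRingEnd ℂ) (z g)) :
    GradedIso ℬ (realLoopGrading π χ h𝒜) ↔ ∃ ψ, IsLoopEmbedding ℬ π 𝒜 z ψ := by
  constructor
  · rintro ⟨φ, hφ, hdeg⟩
    let ψ : B →+ A ⊗[ℝ] MonoidAlgebra ℂ G :=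
      (realLoop π χ h𝒜).toSubmodule.subtype.toAddMonoidHom.comp (φ : B →+ realLoop π χ h𝒜)
    have hψ : ∀ x, ψ x = (φ x : A ⊗[ℝ] MonoidAlgebra ℂ G) := fun x => rfl
    have hinj : Function.Injective ψ := Subtype.val_injective.comp hφ.1
    have hmem : ∀ {g : G} {x : B}, x ∈ ℬ g →
        ∃ a ∈ 𝒜 (π g), ψ x = a ⊗ₜ MonoidAlgebra.single g (z g) := fun {g x} hx =>
      (mem_realLoopComponent hz).1 (hdeg g x hx)
    refine ⟨ψ, ⟨fun r x => ?_, fun x y => ?_, hinj, hmem, fun {g a} ha => ?_⟩⟩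
    · rw [hψ, hψ, map_smul]; rfl
    · rw [hψ, hψ, hψ, map_mul]; rfl
    · have hy : a ⊗ₜ MonoidAlgebra.single g (z g) ∈ realLoopComponent π χ 𝒜 g :=
        (mem_realLoopComponent hz).2 ⟨a, ha, rfl⟩
      obtain ⟨x, hx⟩ := hφ.2 ⟨_, (le_iSup (realLoopComponent π χ 𝒜) g) hy⟩
      have hx' : ψ x = a ⊗ₜ MonoidAlgebra.single g (z g) := congrArg Subtype.val hx
      exact ⟨x, mem_of_map_eq_tmul_single h (fun g => (hz g).1) ψ hinj
        (fun g x hx => (hmem hx).imp fun _ h => h.2) hx', hx'⟩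
  · rintro ⟨ψ, hψ⟩
    have hmem : ∀ {g x}, x ∈ ℬ g → ψ x ∈ realLoopComponent π χ 𝒜 g := fun hx =>
      (mem_realLoopComponent hz).2 (hψ.map_mem hx)
    have hmem' : ∀ x, ψ x ∈ realLoop π χ h𝒜 := fun x =>
      h.induction x (fun g x hx => le_iSup (realLoopComponent π χ 𝒜) g (hmem hx))
        (by rw [map_zero]; exact zero_mem _) (fun x y hx hy => by rw [map_add]; exact add_mem hx hy)
    refine ⟨{ toFun := fun x => ⟨ψ x, hmem' x⟩
              map_smul' := fun r x => Subtype.ext (hψ.map_smul r x)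
              map_zero' := Subtype.ext (map_zero ψ)
              map_add' := fun x y => Subtype.ext (map_add ψ x y)
              map_mul' := fun x y => Subtype.ext (hψ.map_mul x y) }, ⟨fun x y hxy => ?_, ?_⟩,
      fun g x hx => hmem hx⟩
    · exact hψ.injective (congrArg Subtype.val hxy)
    · have hle : (⨆ g, realLoopComponent π χ 𝒜 g).toAddSubgroup ≤ ψ.range := by
        intro y hy
        induction hy using Submodule.iSup_induction' with
        | mem g y hy =>
          obtain ⟨a, ha, rfl⟩ := (mem_realLoopComponent hz).1 hy
          obtain ⟨x, -, hx⟩ := hψ.surj ha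
          exact ⟨x, hx⟩
        | zero => exact zero_mem _
        | add x y _ _ hx hy => exact add_mem hx hy
      rintro ⟨y, hy⟩
      obtain ⟨x, hx⟩ := hle hy
      exact ⟨x, Subtype.ext hx⟩

end RealIso

section ComplexIso

variable {A : Type*} [NonUnitalNonAssocRing A] [Module ℂ A] [SMulCommClass ℂ A A]
  [IsScalarTower ℂ A A] {𝒜 : Γ → Submodule ℂ A}

theorem gradedIso_loopGradingReal_iff (h : IsGrading ℬ) (h𝒜 : IsGrading 𝒜) :
    GradedIso ℬ (loopGradingReal π h𝒜) ↔ ∃ ψ, IsLoopEmbedding ℬ π 𝒜 (fun _ => 1) ψ := by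
  constructor
  · rintro ⟨φ, hφ, hdeg⟩
    let ψ : B →+ A ⊗[ℂ] MonoidAlgebra ℂ G :=
      (loop π h𝒜).toSubmodule.subtype.toAddMonoidHom.comp (φ : B →+ loop π h𝒜)
    have hψ : ∀ x, ψ x = (φ x : A ⊗[ℂ] MonoidAlgebra ℂ G) := fun x => rfl
    have hinj : Function.Injective ψ := Subtype.val_injective.comp hφ.1
    have hmem : ∀ {g : G} {x : B}, x ∈ ℬ g →
        ∃ a ∈ 𝒜 (π g), ψ x = a ⊗ₜ MonoidAlgebra.single g (1 : ℂ) := fun {g x} hx =>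
      mem_loopComponent.1 (hdeg g x hx)
    refine ⟨ψ, ⟨fun r x => ?_, fun x y => ?_, hinj, hmem, fun {g a} ha => ?_⟩⟩
    · rw [hψ, hψ, map_smul]; rfl
    · rw [hψ, hψ, hψ, map_mul]; rfl
    · have hy : a ⊗ₜ MonoidAlgebra.single g (1 : ℂ) ∈ loopComponent π 𝒜 g :=
        mem_loopComponent.2 ⟨a, ha, rfl⟩
      obtain ⟨x, hx⟩ := hφ.2 ⟨_, (le_iSup (loopComponent π 𝒜) g) hy⟩
      have hx' : ψ x = a ⊗ₜ MonoidAlgebra.single g (1 : ℂ) := congrArg Subtype.val hx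
      exact ⟨x, mem_of_map_eq_tmul_single (z := fun _ => 1) h (fun g => one_ne_zero) ψ hinj
        (fun g x hx => (hmem hx).imp fun _ h => h.2) hx', hx'⟩
  · rintro ⟨ψ, hψ⟩
    have hmem : ∀ {g x}, x ∈ ℬ g → ψ x ∈ loopComponent π 𝒜 g := fun hx =>
      mem_loopComponent.2 (hψ.map_mem hx)
    have hmem' : ∀ x, ψ x ∈ loop π h𝒜 := fun x =>
      h.induction x (fun g x hx => le_iSup (loopComponent π 𝒜) g (hmem hx))
        (by rw [map_zero]; exact zero_mem _) (fun x y hx hy => by rw [map_add]; exact add_mem hx hy)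
    refine ⟨{ toFun := fun x => ⟨ψ x, hmem' x⟩
              map_smul' := fun r x => Subtype.ext (hψ.map_smul r x)
              map_zero' := Subtype.ext (map_zero ψ)
              map_add' := fun x y => Subtype.ext (map_add ψ x y)
              map_mul' := fun x y => Subtype.ext (hψ.map_mul x y) }, ⟨fun x y hxy => ?_, ?_⟩,
      fun g x hx => hmem hx⟩
    · exact hψ.injective (congrArg Subtype.val hxy)
    · have hle : (⨆ g, loopComponent π 𝒜 g).toAddSubgroup ≤ ψ.range := by
        intro y hy
        induction hy using Submodule.iSup_induction' with
        | mem g y hy =>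
          obtain ⟨a, ha, rfl⟩ := mem_loopComponent.1 hy
          obtain ⟨x, -, hx⟩ := hψ.surj ha
          exact ⟨x, hx⟩
        | zero => exact zero_mem _
        | add x y _ _ hx hy => exact add_mem hx hy
      rintro ⟨y, hy⟩
      obtain ⟨x, hx⟩ := hle hy
      exact ⟨x, Subtype.ext hx⟩

end ComplexIso

end LoopEmbedding

/-! ### Maps defined on homogeneous components -/

section Homogeneous

variable {F : Type*} [Field F] {G : Type*} [CommGroup G]
  {A : Type*} [NonUnitalNonAssocRing A] [Module F A] {𝒜 : G → Submodule F A}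

open Classical in
theorem IsGrading.exists_addMonoidHom (h : IsGrading 𝒜) {M : Type*} [AddCommMonoid M]
    (φ : G → A →+ M) : ∃ Φ : A →+ M, ∀ g, ∀ x ∈ 𝒜 g, Φ x = φ g x := by
  let e := LinearEquiv.ofBijective (DirectSum.coeLinearMap 𝒜) h.isInternal
  refine ⟨(DirectSum.toAddMonoid fun g => (φ g).comp (𝒜 g).subtype.toAddMonoidHom).comp
    e.symm.toLinearMap.toAddMonoidHom, fun g x hx => ?_⟩
  have h1 : e.symm x = DirectSum.of (fun g => 𝒜 g) g ⟨x, hx⟩ := by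
    rw [LinearEquiv.symm_apply_eq]
    exact (DirectSum.coeLinearMap_lof 𝒜 g ⟨x, hx⟩).symm
  change DirectSum.toAddMonoid _ (e.symm x) = _
  rw [h1, DirectSum.toAddMonoid_of]
  rfl

theorem IsGrading.map_mul_of_homogeneous (h : IsGrading 𝒜) {R : Type*}
    [NonUnitalNonAssocSemiring R] (Φ : A →+ R)
    (hΦ : ∀ g k, ∀ x ∈ 𝒜 g, ∀ y ∈ 𝒜 k, Φ (x * y) = Φ x * Φ y) (x y : A) :
    Φ (x * y) = Φ x * Φ y := by
  refine h.induction x (fun g x hx => ?_) (by simp) (fun x x' hx hx' => ?_)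
  · refine h.induction y (fun k y hy => hΦ g k x hx y hy) (by simp) (fun y y' hy hy' => ?_)
    rw [mul_add, map_add, map_add, mul_add, hy, hy']
  · rw [add_mul, map_add, map_add, add_mul, hx, hx']

end Homogeneous

/-! ### Loop data over the real numbers -/

section RealDatum

variable {G : Type*} [CommGroup G]
  {B : Type*} [NonAssocCommRing B] [Module ℝ B] [SMulCommClass ℝ B B] [IsScalarTower ℝ B B]
  {ℬ : G → Submodule ℝ B} {z : G → ℂ} {t : B →ₗ[Center ℝ B] Center ℝ B}

/-- A loop datum over `K = ℝ`. -/
abbrev IsRealDatum (ℬ : G → Submodule ℝ B) (ρ : Center ℝ B →+* ℂ) (z : G → ℂ) : Prop :=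
  IsLoopDatum ℬ ℝ (algebraMap ℝ (Center ℝ B)) ρ z

theorem algebraMap_center (r : ℝ) : algebraMap ℝ (Center ℝ B) r = r • (1 : Center ℝ B) :=
  Algebra.algebraMap_eq_smul_one r

theorem CenterOneIsReal.mem_iff (hR : CenterOneIsReal ℬ) (c : Center ℝ B) :
    c ∈ centerGrading ℬ 1 ↔ ∃ r : ℝ, algebraMap ℝ (Center ℝ B) r = c := by
  rw [show centerGrading ℬ 1 = Submodule.span ℝ {1} from hR, Submodule.mem_span_singleton]
  simp only [algebraMap_center]

/-- The quotient `l c⁻¹` has degree `e`, so it is a real scalar. -/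
theorem CenterOneIsReal.exists_smul_eq (hR : CenterOneIsReal ℬ) (h : IsGrading ℬ)
    (hs : IsGradedSimple ℬ) {g : G} {c l : Center ℝ B} (hc : c ∈ centerGrading ℬ g) (hc0 : c ≠ 0)
    (hl : l ∈ centerGrading ℬ g) : ∃ r : ℝ, l = r • c := by
  obtain ⟨d, hd, hcd⟩ := hs.exists_inv h hc hc0
  have h1 : l * d ∈ centerGrading ℬ 1 := by
    have := h.center.mul_mem hl hd
    rwa [mul_inv_cancel] at this
  obtain ⟨r, hr⟩ := (hR.mem_iff _).1 h1
  refine ⟨r, ?_⟩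
  rw [← mul_one l, ← hcd, mul_comm c, ← mul_assoc, ← hr, ← Algebra.smul_def]

theorem CenterOneIsReal.exists_datum (hR : CenterOneIsReal ℬ) (hz0 : ∀ g, z g ≠ 0)
    (hz : ∀ g k, ∃ a : ℝ, z g * z k = a • z (g * k)) (φ : Center ℝ B →+ ℂ)
    (hsmul : ∀ (r : ℝ) c, φ (r • c) = r • φ c) (hmul : ∀ x y, φ (x * y) = φ x * φ y)
    (h1 : φ 1 ≠ 0) (hmem : ∀ g, ∀ l ∈ centerGrading ℬ g, ∃ a : ℝ, φ l = a • z g) :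
    ∃ ρ : Center ℝ B →+* ℂ, (∀ l, ρ l = φ l) ∧ IsRealDatum ℬ ρ z := by
  -- `φ 1` is a nonzero idempotent of `ℂ`.
  have h1' : φ 1 = 1 := by
    have := hmul 1 1
    rw [one_mul] at this
    exact mul_left_cancel₀ h1 (this.symm.trans (mul_one _).symm)
  refine ⟨{ φ with map_one' := h1', map_mul' := hmul }, fun _ => rfl, ⟨fun k x => ?_, hR.mem_iff,
    fun k => ?_, hz0, hz, fun {g l} hl => hmem g l hl⟩⟩
  · rw [algebraMap_center, smul_assoc, one_smul]
  · change φ _ = _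
    rw [algebraMap_center, hsmul, h1', Complex.real_smul, mul_one]
    rfl

end RealDatum

section ScalarMap

variable {F V : Type*} [Field F] [AddCommGroup V] [Module F V] (b : LinearMap.BilinForm F V)

/-- The coefficient of `1`, as a linear map. -/
def FormAlgebra.scalarₗ : FormAlgebra b →ₗ[F] F where
  toFun x := x.scalar
  map_add' _ _ := rfl
  map_smul' _ _ := rfl

/-- The component in `V`, as a linear map. -/
def FormAlgebra.vectorₗ : FormAlgebra b →ₗ[F] V where
  toFun x := x.vector
  map_add' _ _ := rfl
  map_smul' _ _ := rfl

end ScalarMap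

section Augmentation

variable {G : Type*} [CommGroup G] {A : Type*} [AddCommGroup A] [Module ℝ A]

/-- The map `a ⊗ w g ↦ s(a) w`, where `s` is a linear function on `A`. -/
def augment (s : A →ₗ[ℝ] ℝ) : A ⊗[ℝ] MonoidAlgebra ℂ G →ₗ[ℝ] ℂ :=
  TensorProduct.lift ((LinearMap.lsmul ℝ (MonoidAlgebra ℂ G →ₗ[ℝ] ℂ)).flip
    ((MonoidAlgebra.lift ℂ ℂ G (1 : G →* ℂ)).toLinearMap.restrictScalars ℝ) ∘ₗ s)

theorem augment_tmul_single (s : A →ₗ[ℝ] ℝ) (a : A) (g : G) (w : ℂ) :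
    augment s (a ⊗ₜ MonoidAlgebra.single g w) = s a • w := by
  simp [augment]

end Augmentation

/-! ### Recovering a loop datum from an isomorphism -/

section Converse

variable {G : Type*} [CommGroup G]
  {B : Type*} [NonAssocCommRing B] [Module ℝ B] [SMulCommClass ℝ B B] [IsScalarTower ℝ B B]
  {ℬ : G → Submodule ℝ B} {z : G → ℂ} {t : B →ₗ[Center ℝ B] Center ℝ B}

/-- This shows that elements mapped to `1 ⊗ w` by an embedding are central. -/
theorem one_tmul_mul_assoc {A R : Type*} [NonAssocRing A] [Module ℝ A] [SMulCommClass ℝ A A]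
    [IsScalarTower ℝ A A] [Ring R] [Algebra ℝ R] (w : R) (P Q : A ⊗[ℝ] R) :
    (1 ⊗ₜ w) * (P * Q) = (1 ⊗ₜ w) * P * Q := by
  induction P with
  | zero => simp
  | add P P' hP hP' => rw [add_mul, mul_add, mul_add, add_mul, hP, hP']
  | tmul a p =>
    induction Q with
    | zero => simp
    | add Q Q' hQ hQ' => rw [mul_add, mul_add, mul_add, hQ, hQ']
    | tmul b q =>
      simp only [Algebra.TensorProduct.tmul_mul_tmul, one_mul, mul_assoc]

set_option maxHeartbeats 1000000 in
-- Any embedding respects the decomposition `L ⊕ V`: on `L` it yields `ρ`, and on each `V_g` an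
-- isometry onto the standard component. Uniqueness is thereby reduced to comparing two
-- homomorphisms `ρ`.
theorem IsLoopEmbedding.exists_datum (h : IsGrading ℬ) (hs : IsGradedSimple ℬ)
    (ht : IsCenterProj ℬ t) {H : Subgroup G} (hH : (H : Set G) = centerSupport ℬ)
    (hR : CenterOneIsReal ℬ) (hz0 : ∀ g, z g ≠ 0)
    (hz : ∀ g k, ∃ a : ℝ, z g * z k = a • z (g * k)) {κ : G ⧸ H → ℕ} {ε : G ⧸ H → ℕ → ℝ}
    {ψ : B →+ StdJordan κ ε ⊗[ℝ] MonoidAlgebra ℂ G}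
    (hψ : IsLoopEmbedding ℬ (QuotientGroup.mk' H) (stdJordanGrading κ ε) z ψ) :
    ∃ (ρ : Center ℝ B →+* ℂ) (hd : IsRealDatum ℬ ρ z) (f : G → B →ₗ[ℝ] StdSpace ℝ κ),
      (∀ g : G, ∀ v ∈ hd.vec h t g, f g v ∈ stdSpaceGrading ℝ κ (g : G ⧸ H)) ∧
      (∀ g, ∀ v ∈ hd.vec h t g, f g v = 0 → v = 0) ∧
      (∀ g : G, ∀ w ∈ stdSpaceGrading ℝ κ (g : G ⧸ H), ∃ v ∈ hd.vec h t g, f g v = w) ∧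
      ∀ g, ∀ v ∈ hd.vec h t g, stdForm κ ε (f g v) (f g v) = hd.form t g g v v := by
  -- If `L_g ≠ 0`, the preimage of `1 ⊗ z g g` is central of degree `g`, and `L_g` is a real line,
  -- so it spans `L_g`.
  have hone : ∀ {g : G} {l : Center ℝ B}, l ∈ centerGrading ℬ g →
      ∃ a : ℝ, ψ (l : B) = (a • (1 : StdJordan κ ε)) ⊗ₜ MonoidAlgebra.single g (z g) := by
    intro g l hl
    by_cases hl0 : l = 0
    · exact ⟨0, by simp [hl0]⟩
    have hg : (g : G ⧸ H) = 1 := by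
      rw [QuotientGroup.eq_one_iff, ← SetLike.mem_coe, hH]
      exact mem_centerSupport.2 ⟨l, hl, hl0⟩
    have h1 : (1 : StdJordan κ ε) ∈ stdJordanGrading κ ε (QuotientGroup.mk' H g) := by
      rw [QuotientGroup.mk'_apply, hg]
      exact FormAlgebra.one_mem_grading
    obtain ⟨y, hy, hψy⟩ := hψ.surj h1
    have hyc : y ∈ Center ℝ B := mem_center_of_assoc fun p q => hψ.injective (by
      rw [hψ.map_mul, hψ.map_mul, hψ.map_mul, hψ.map_mul, hψy, one_tmul_mul_assoc])
    have hy0 : (⟨y, hyc⟩ : Center ℝ B) ≠ 0 := by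
      intro h0
      have h0' : y = 0 := congrArg Subtype.val h0
      rw [h0', map_zero] at hψy
      have := congrArg FormAlgebra.scalar (tmul_single_injective g (hz0 g)
        (hψy.symm.trans (TensorProduct.zero_tmul _ _).symm))
      simp at this
    obtain ⟨r, hr⟩ := hR.exists_smul_eq h hs (c := ⟨y, hyc⟩) (mem_centerGrading.2 hy) hy0 hl
    refine ⟨r, ?_⟩
    have hr' : (l : B) = r • y := congrArg Subtype.val hr
    rw [hr', hψ.map_smul, hψy]
    rfl
  let φ : Center ℝ B →+ ℂ :=
    (augment (FormAlgebra.scalarₗ (stdForm κ ε))).toAddMonoidHom.comp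
      (ψ.comp (Center ℝ B).toSubmodule.subtype.toAddMonoidHom)
  have hφ_def : ∀ l : Center ℝ B, φ l = augment (FormAlgebra.scalarₗ (stdForm κ ε)) (ψ (l : B)) :=
    fun _ => rfl
  have hsc : ∀ a : ℝ, FormAlgebra.scalarₗ (stdForm κ ε) (a • 1) = a := fun a => by
    rw [LinearMap.map_smul]; exact mul_one a
  have hφ : ∀ {g : G} {l : Center ℝ B} {a : ℝ},
      ψ (l : B) = (a • (1 : StdJordan κ ε)) ⊗ₜ MonoidAlgebra.single g (z g) → φ l = a • z g := by
    intro g l a hl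
    rw [hφ_def, hl, augment_tmul_single, hsc]
  have hφmul : ∀ x y, φ (x * y) = φ x * φ y := by
    refine h.center.map_mul_of_homogeneous φ fun g k x hx y hy => ?_
    obtain ⟨a, ha⟩ := hone hx
    obtain ⟨b, hb⟩ := hone hy
    rw [hφ ha, hφ hb, hφ_def, center_coe_mul, hψ.map_mul, ha, hb,
      Algebra.TensorProduct.tmul_mul_tmul, MonoidAlgebra.single_mul_single, smul_mul_smul_comm,
      mul_one, augment_tmul_single, hsc, smul_mul_smul_comm]
  have h1L : (1 : Center ℝ B) ∈ centerGrading ℬ 1 := h.one_mem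
  have hφ1 : φ 1 ≠ 0 := by
    obtain ⟨a, ha⟩ := hone h1L
    rw [hφ ha]
    refine smul_ne_zero ?_ (hz0 1)
    rintro rfl
    rw [zero_smul, TensorProduct.zero_tmul] at ha
    have := hs.nontrivial
    exact one_ne_zero (hψ.injective (ha.trans (map_zero ψ).symm))
  obtain ⟨ρ, hρ, hd⟩ := hR.exists_datum hz0 hz φ
    (fun r c => by
      rw [hφ_def, hφ_def, ← LinearMap.map_smul]
      exact congrArg _ (hψ.map_smul r c)) hφmul hφ1
    (fun g l hl => (hone hl).imp fun a ha => hφ ha)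
  have hone' : ∀ {g : G} {l : Center ℝ B}, l ∈ centerGrading ℬ g → ψ (l : B) =
      (1 : StdJordan κ ε) ⊗ₜ MonoidAlgebra.single g (ρ l) := by
    intro g l hl
    obtain ⟨a, ha⟩ := hone hl
    rw [hρ, hφ ha, ha, tmul_single_smul]
  have hvec : ∀ {g : G} {v : B}, v ∈ hd.vec h t g → ∃ w ∈ stdSpaceGrading ℝ κ (g : G ⧸ H),
      ψ v = FormAlgebra.inr (stdForm κ ε) w ⊗ₜ MonoidAlgebra.single g (z g) := by
    intro g v hv
    obtain ⟨a, ha, hav⟩ := hψ.map_mem hv.1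
    have hsq : v * v = t (v * v) • (1 : B) := ht.mul_eq hv.2 hv.2
    obtain ⟨c, hc⟩ := hone (ht.map_mem (h.mul_mem hv.1 hv.1))
    -- With a nonzero scalar part, the centrality of `v²` forces the vector part to vanish. Then `v`
    -- is a nonzero multiple of an element of `L_g`, contrary to `t v = 0`.
    by_cases h0 : a.scalar = 0
    · refine ⟨a.vector, ha.2, ?_⟩
      rw [hav]
      conv_lhs => rw [a.eq_add, h0, zero_smul, zero_add]
    · exfalso
      have hg : (g : G ⧸ H) = 1 := by
        by_contra hg
        have := ha.1
        rw [trivialGrading, QuotientGroup.mk'_apply, if_neg hg, Submodule.mem_bot] at this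
        exact h0 this
      have h2 : a.vector = 0 := by
        rw [center_smul_one] at hsq
        rw [← hsq, hψ.map_mul, hav, Algebra.TensorProduct.tmul_mul_tmul,
          MonoidAlgebra.single_mul_single] at hc
        obtain ⟨r, hr⟩ := hz g g
        rw [hr, tmul_single_smul] at hc
        have h3 := congrArg FormAlgebra.vector (tmul_single_injective _ (hz0 _) hc)
        have hr0 : r ≠ 0 := by
          rintro rfl
          rw [zero_smul] at hr
          exact mul_ne_zero (hz0 g) (hz0 g) hr
        have h4 : (r * (2 * a.scalar)) • a.vector = 0 := by
          have : r • (a.scalar • a.vector + a.scalar • a.vector) = 0 := by simpa using h3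
          rw [← this]; module
        exact (smul_eq_zero.1 h4).resolve_left (by simp [hr0, h0])
      have hH' : g ∈ centerSupport ℬ := by
        rw [← hH]; exact (QuotientGroup.eq_one_iff g).1 hg
      obtain ⟨l, hl, hl0⟩ := mem_centerSupport.1 hH'
      obtain ⟨r, hr⟩ := hone hl
      have hr0 : r ≠ 0 := by
        rintro rfl
        rw [zero_smul, TensorProduct.zero_tmul] at hr
        exact hl0 (Subtype.ext (hψ.injective (hr.trans (map_zero ψ).symm)))
      have hv' : v = (a.scalar * r⁻¹) • (l : B) := hψ.injective (by
        rw [hψ.map_smul, hr, hav]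
        change _ = (a.scalar * r⁻¹) • _
        rw [TensorProduct.smul_tmul', smul_smul, mul_assoc, inv_mul_cancel₀ hr0, mul_one]
        conv_lhs => rw [a.eq_add, h2, map_zero, add_zero])
      have hlt : t (l : B) = l := by
        rw [← center_smul_one, ht.map_smul_one]
      have h5 := hv.2
      rw [hv', ← algebraMap_smul (Center ℝ B), t.map_smul, hlt, algebraMap_smul] at h5
      have := (smul_eq_zero.1 h5).resolve_right hl0
      exact mul_ne_zero h0 (inv_ne_zero hr0) this
  let ψl : B →ₗ[ℝ] StdJordan κ ε ⊗[ℝ] MonoidAlgebra ℂ G :=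
    { ψ with map_smul' := hψ.map_smul }
  let f : G → B →ₗ[ℝ] StdSpace ℝ κ := fun g =>
    FormAlgebra.vectorₗ (stdForm κ ε) ∘ₗ extract ℝ (StdJordan κ ε) g (z g) ∘ₗ ψl
  have hf : ∀ {g : G} {v : B} {a : StdJordan κ ε},
      ψ v = a ⊗ₜ MonoidAlgebra.single g (z g) → f g v = a.vector := by
    intro g v a hv
    change (extract ℝ (StdJordan κ ε) g (z g) (ψ v)).vector = _
    rw [hv, extract_same g (hz0 g)]
  refine ⟨ρ, hd, f, fun g v hv => ?_, fun g v hv h0 => ?_, fun g w hw => ?_, fun g v hv => ?_⟩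
  · obtain ⟨w, hw, hvw⟩ := hvec hv
    rw [hf hvw]; exact hw
  · obtain ⟨w, hw, hvw⟩ := hvec hv
    rw [hf hvw, FormAlgebra.vector_inr] at h0
    rw [h0, map_zero, TensorProduct.zero_tmul] at hvw
    exact hψ.injective (hvw.trans (map_zero ψ).symm)
  · obtain ⟨y, hy, hyw⟩ := hψ.surj (g := g) (FormAlgebra.inr_mem_grading (b := stdForm κ ε) hw)
    have hty := ht.map_mem hy
    -- Subtracting the central part moves `y` into `V_g` and does not affect the vector component of
    -- its image.
    have hy' : y + (-1 : ℝ) • (t y : B) ∈ hd.vec h t g := by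
      refine ⟨add_mem hy (Submodule.smul_mem _ _ hty), ?_⟩
      rw [map_add, ← algebraMap_smul (Center ℝ B), t.map_smul, ← center_smul_one, ht.map_smul_one,
        algebraMap_smul]
      have e0 : (1 : ℝ) • t y + (-1 : ℝ) • t y = 0 := by
        rw [← add_smul, add_neg_cancel, zero_smul]
      rwa [one_smul] at e0
    obtain ⟨w', hw', hyw'⟩ := hvec hy'
    refine ⟨_, hy', ?_⟩
    obtain ⟨a, ha⟩ := hone hty
    have e := hyw'
    rw [map_add, hψ.map_smul, ha, hyw] at e
    change _ + (-1 : ℝ) • _ = _ at e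
    rw [TensorProduct.smul_tmul', ← TensorProduct.add_tmul] at e
    have e2 := congrArg FormAlgebra.vector (tmul_single_injective g (hz0 g) e)
    rw [hf hyw']
    rw [FormAlgebra.vector_add, FormAlgebra.vector_smul, FormAlgebra.vector_smul,
      FormAlgebra.vector_one, smul_zero, smul_zero, add_zero] at e2
    exact e2.symm
  · obtain ⟨w, hw, hvw⟩ := hvec hv
    have h1 := hd.form_smul ht h hv.1 hv.1
    have h2 := hone' (ht.map_mem (h.mul_mem hv.1 hv.1))
    rw [← center_smul_one, ← ht.mul_eq hv.2 hv.2, hψ.map_mul, hvw, Algebra.TensorProduct.tmul_mul_tmul,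
      MonoidAlgebra.single_mul_single, FormAlgebra.inr_mul_inr, ← h1, tmul_single_smul] at h2
    have h3 := congrArg FormAlgebra.scalar (tmul_single_injective _ (mul_ne_zero (hz0 g) (hz0 g)) h2)
    rw [hf hvw]
    simpa using h3

end Converse

/-! ### The invariants `κ` and `σ` of a loop datum -/

section Invariants

variable {G : Type*} [CommGroup G]
  {B : Type*} [NonAssocCommRing B] [Module ℝ B] [SMulCommClass ℝ B B] [IsScalarTower ℝ B B]
  {ℬ : G → Submodule ℝ B} {K : Type*} [Field K] [Algebra K ℂ] [Module K B]
  {ι : K →+* Center ℝ B} {ρ ρ' : Center ℝ B →+* ℂ} {z : G → ℂ}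
  {t : B →ₗ[Center ℝ B] Center ℝ B} {H : Subgroup G}

theorem IsLoopDatum.form_comm (hd : IsLoopDatum ℬ K ι ρ z) (g k : G) (v w : B) :
    hd.form t g k v w = hd.form t k g w v := by
  rw [hd.form_apply, hd.form_apply, mul_comm v w, mul_comm (z g)]

/-- The dimensions of the components of the complement of the center. -/
def IsLoopDatum.dim (hd : IsLoopDatum ℬ K ι ρ z) (h : IsGrading ℬ)
    (t : B →ₗ[Center ℝ B] Center ℝ B) (x : G ⧸ H) : ℕ :=
  Module.finrank K (hd.vec h t x.out)

theorem out_mul_out_inv_mem (x : G ⧸ H) : x.out * (x⁻¹).out ∈ H := by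
  rw [← QuotientGroup.eq_one_iff, QuotientGroup.mk_mul, QuotientGroup.out_eq',
    QuotientGroup.out_eq', mul_inv_cancel]

theorem IsLoopDatum.form_out_nondegenerate (hd : IsLoopDatum ℬ K ι ρ z) (ht : IsCenterProj ℬ t)
    (h : IsGrading ℬ) (hs : IsGradedSimple ℬ) (hH : (H : Set G) = centerSupport ℬ) (x : G ⧸ H) :
    ∀ v ∈ hd.vec h t x.out,
      (∀ w ∈ hd.vec h t (x⁻¹).out, hd.form t x.out (x⁻¹).out v w = 0) → v = 0 :=
  fun _ hv hvw => hd.form_nondegenerate ht h hs hH (out_mul_out_inv_mem x) hv hvw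

theorem IsLoopDatum.dim_isBalanced [Module.Finite K B] (hd : IsLoopDatum ℬ K ι ρ z)
    (ht : IsCenterProj ℬ t) (h : IsGrading ℬ) (hs : IsGradedSimple ℬ)
    (hH : (H : Set G) = centerSupport ℬ) : IsBalanced (hd.dim h t : G ⧸ H → ℕ) := by
  have hle : ∀ x : G ⧸ H, hd.dim h t x ≤ hd.dim h t x⁻¹ := fun x =>
    finrank_le_of_pairing (hd.form t x.out (x⁻¹).out) _ _ (hd.form_out_nondegenerate ht h hs hH x)
  exact fun x => le_antisymm (by simpa using hle x⁻¹) (hle x)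

theorem IsLoopDatum.dim_support_finite [Module.Finite ℝ B] (hd : IsLoopDatum ℬ K ι ρ z)
    (h : IsGrading ℬ) : (hd.dim h t : G ⧸ H → ℕ).support.Finite := by
  obtain ⟨T, hT⟩ := h.exists_finset
  refine (T.finite_toSet.image fun g : G => (g : G ⧸ H)).subset fun x hx => ?_
  refine ⟨x.out, ?_, QuotientGroup.out_eq' x⟩
  by_contra hxT
  refine hx ?_
  have : hd.vec h t x.out = ⊥ := (Submodule.eq_bot_iff _).2 fun v hv => hT _ hxT v hv.1
  rw [IsLoopDatum.dim, this, finrank_bot]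

end Invariants

section RealInvariants

variable {G : Type*} [CommGroup G]
  {B : Type*} [NonAssocCommRing B] [Module ℝ B] [SMulCommClass ℝ B B] [IsScalarTower ℝ B B]
  [Module.Finite ℝ B] {ℬ : G → Submodule ℝ B}
  {ρ ρ' : Center ℝ B →+* ℂ} {z : G → ℂ}
  {t : B →ₗ[Center ℝ B] Center ℝ B} {H : Subgroup G}

/-- The signatures of the forms on the components of degrees of order at most two. -/
def IsLoopDatum.signature (hd : IsRealDatum ℬ ρ z) (h : IsGrading ℬ)
    (t : B →ₗ[Center ℝ B] Center ℝ B) (x : TwoTorsion (G ⧸ H)) : ℤ :=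
  2 * sigPos (restrictQuad (hd.form t x.1.out x.1.out) (hd.vec h t x.1.out)) - hd.dim h t x.1

theorem inv_eq_of_mem_twoTorsion {Γ : Type*} [CommGroup Γ] {x : Γ} (hx : x ∈ TwoTorsion Γ) :
    x⁻¹ = x := by
  rw [MonoidHom.mem_ker, powMonoidHom_apply, pow_two] at hx
  exact inv_eq_of_mul_eq_one_left hx

theorem IsLoopDatum.form_self_nondegenerate (hd : IsRealDatum ℬ ρ z) (ht : IsCenterProj ℬ t)
    (h : IsGrading ℬ) (hs : IsGradedSimple ℬ) (hH : (H : Set G) = centerSupport ℬ) {x : G ⧸ H}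
    (hx : x ∈ TwoTorsion (G ⧸ H)) : ∀ v ∈ hd.vec h t x.out,
      (∀ w ∈ hd.vec h t x.out, hd.form t x.out x.out v w = 0) → v = 0 := by
  have := hd.form_out_nondegenerate ht h hs hH x
  rwa [inv_eq_of_mem_twoTorsion hx] at this

theorem IsLoopDatum.isSignature (hd : IsRealDatum ℬ ρ z) (h : IsGrading ℬ) :
    IsSignature (hd.dim h t : G ⧸ H → ℕ) (hd.signature h t) := by
  intro x
  have hle : sigPos (restrictQuad (hd.form t x.1.out x.1.out) (hd.vec h t x.1.out)) ≤
      hd.dim h t x.1 := by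
    have := QuadraticForm.sigPos_add_sigNeg_add_radical
      (Q := restrictQuad (hd.form t x.1.out x.1.out) (hd.vec h t x.1.out))
    exact le_of_le_of_eq (by omega) this
  rw [IsLoopDatum.signature, abs_le, Int.ModEq]
  omega

theorem IsLoopDatum.exists_loopEmbedding (hd : IsRealDatum ℬ ρ z) (ht : IsCenterProj ℬ t)
    (h : IsGrading ℬ) (hs : IsGradedSimple ℬ) (hH : (H : Set G) = centerSupport ℬ) :
    ∃ ψ, IsLoopEmbedding ℬ (QuotientGroup.mk' H)
      (realJordanGrading (hd.dim h t : G ⧸ H → ℕ) (hd.signature h t)) z ψ := by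
  obtain ⟨f, hf1, hf2, hf3, hf4⟩ := exists_isometry_stdSpace
    (fun x : G ⧸ H => hd.vec h t x.out) (fun x => hd.form t x.out (x⁻¹).out)
    (fun x v w => by rw [inv_inv]; exact hd.form_comm _ _ v w)
    (hd.form_out_nondegenerate ht h hs hH)
    (realSign (hd.dim h t) (hd.signature h t))
    (fun x i => by rw [realSign]; split_ifs <;> norm_num)
    (fun x hx i => by
      rw [realSign, dif_neg]
      rwa [MonoidHom.mem_ker, powMonoidHom_apply, pow_two])
    (hd.dim h t) (fun x => rfl) (fun x hx => by
      have hx' : x ∈ TwoTorsion (G ⧸ H) := by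
        rwa [MonoidHom.mem_ker, powMonoidHom_apply, pow_two]
      obtain ⟨b, hb, hbb⟩ := exists_real_diag (hd.form t x.out x.out) (hd.vec h t x.out)
        (hd.form_comm _ _) (hd.form_self_nondegenerate ht h hs hH hx')
      refine ⟨b, hb, fun i hi j hj => ?_⟩
      rw [inv_eq_of_mem_twoTorsion hx', hbb i hi j hj, realSign, dif_pos hx',
        IsLoopDatum.signature]
      congr 1
      -- Dimension plus signature is twice `sigPos`, so the threshold in `realSign` becomes `i <
      -- sigPos`.
      refine if_congr ?_ rfl rfl
      dsimp only
      omega)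
  obtain ⟨ψ, h1, h2, h3, h4⟩ := hd.exists_hom ht h hs hH _ _ f hf1 hf2 hf3 hf4
  exact ⟨ψ.toAddMonoidHom, ⟨fun r x => ψ.map_smul r x, h1, h2, fun {g x} hx => h3 g x hx,
    fun {g a} ha => h4 g a ha⟩⟩

theorem IsLoopEmbedding.exists_invariants (h : IsGrading ℬ) (hs : IsGradedSimple ℬ)
    (ht : IsCenterProj ℬ t) (hH : (H : Set G) = centerSupport ℬ)
    (hR : CenterOneIsReal ℬ) (hz0 : ∀ g, z g ≠ 0)
    (hz : ∀ g k, ∃ a : ℝ, z g * z k = a • z (g * k)) {κ : G ⧸ H → ℕ} {σ : TwoTorsion (G ⧸ H) → ℤ}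
    (hσ : IsSignature κ σ) {ψ : B →+ RealJordan κ σ ⊗[ℝ] MonoidAlgebra ℂ G}
    (hψ : IsLoopEmbedding ℬ (QuotientGroup.mk' H) (realJordanGrading κ σ) z ψ) :
    ∃ (ρ : Center ℝ B →+* ℂ) (hd : IsRealDatum ℬ ρ z), κ = hd.dim h t ∧ σ = hd.signature h t := by
  obtain ⟨ρ, hd, f, h1, h2, h3, h4⟩ := hψ.exists_datum h hs ht hH hR hz0 hz
  have h1' : ∀ x : G ⧸ H, ∀ v ∈ hd.vec h t x.out, f x.out v ∈ stdSpaceGrading ℝ κ x :=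
    fun x v hv => by simpa only [QuotientGroup.out_eq'] using h1 x.out v hv
  have h3' : ∀ x : G ⧸ H, ∀ w ∈ stdSpaceGrading ℝ κ x, ∃ v ∈ hd.vec h t x.out, f x.out v = w :=
    fun x w hw => h3 x.out w (by simpa only [QuotientGroup.out_eq'] using hw)
  have hκ : κ = hd.dim h t := funext fun x => by
    obtain ⟨e, -⟩ := exists_coordinates x (hd.vec h t x.out) (f x.out) (h1' x) (h2 x.out) (h3' x)
    rw [IsLoopDatum.dim, e.finrank_eq, Module.finrank_fin_fun]
  refine ⟨ρ, hd, hκ, funext fun x => ?_⟩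
  have := two_mul_sigPos_of_stdForm hσ x (hd.form t x.1.out x.1.out) (hd.vec h t x.1.out)
    (f x.1.out) (h1' x) (h2 x.1.out) (h3' x) (h4 x.1.out)
  rw [IsLoopDatum.signature, this, hκ]
  omega

/-- Products of two vectors of degree `x.out` have `t`-values of degree `x.out²`, so only `ρ` on
that component enters the form. -/
theorem IsLoopDatum.signature_of_pos (hd : IsRealDatum ℬ ρ z) (hd' : IsRealDatum ℬ ρ' z)
    (h : IsGrading ℬ) (ht : IsCenterProj ℬ t) (x : TwoTorsion (G ⧸ H)) {c : ℝ} (hc : 0 < c)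
    (hρ : ∀ l ∈ centerGrading ℬ (x.1.out * x.1.out), ρ' l = c • ρ l) :
    hd'.signature h t x = hd.signature h t x := by
  have := sigPos_restrictQuad_of_pos (β := hd.form t x.1.out x.1.out)
    (β' := hd'.form t x.1.out x.1.out) (W := hd.vec h t x.1.out) hc (fun v hv => by
      rw [hd.form_apply, hd'.form_apply, hρ _ (ht.map_mem (h.mul_mem hv.1 hv.1)), mul_smul_comm,
        map_smul, smul_eq_mul])
  unfold IsLoopDatum.signature
  rw [← this]
  rfl

theorem IsLoopDatum.signature_of_neg (hd : IsRealDatum ℬ ρ z) (hd' : IsRealDatum ℬ ρ' z)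
    (h : IsGrading ℬ) (hs : IsGradedSimple ℬ) (ht : IsCenterProj ℬ t)
    (hH : (H : Set G) = centerSupport ℬ) (x : TwoTorsion (G ⧸ H)) {c : ℝ} (hc : c < 0)
    (hρ : ∀ l ∈ centerGrading ℬ (x.1.out * x.1.out), ρ' l = c • ρ l) :
    hd'.signature h t x = -hd.signature h t x := by
  have := sigPos_add_sigPos_restrictQuad_of_neg (β := hd.form t x.1.out x.1.out)
    (β' := hd'.form t x.1.out x.1.out) (W := hd.vec h t x.1.out) hc (fun v hv => by
      rw [hd.form_apply, hd'.form_apply, hρ _ (ht.map_mem (h.mul_mem hv.1 hv.1)), mul_smul_comm,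
        map_smul, smul_eq_mul]) (hd.form_comm _ _) (hd.form_self_nondegenerate ht h hs hH x.2)
  have e1 : hd'.signature h t x = 2 * sigPos (restrictQuad (hd'.form t x.1.out x.1.out)
    (hd.vec h t x.1.out)) - Module.finrank ℝ (hd.vec h t x.1.out) := rfl
  have e2 : hd.signature h t x = 2 * sigPos (restrictQuad (hd.form t x.1.out x.1.out)
    (hd.vec h t x.1.out)) - Module.finrank ℝ (hd.vec h t x.1.out) := rfl
  rw [e1, e2, ← this]
  push_cast
  ring

end RealInvariants

/-! ### Extension of characters -/

section Characters

/-- The circle is a quotient of `ℝ`, hence divisible, hence an injective abelian group. -/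
theorem exists_character_extension {G : Type*} [CommGroup G] (H : Subgroup G) (c : H →* Circle) :
    ∃ χ : G →* Circle, ∀ k : H, χ k = c k := by
  have : DivisibleBy (Additive Circle) ℤ :=
    Function.Surjective.divisibleBy Circle.expHom Circle.exp_surjective fun a n =>
      map_zsmul Circle.expHom n a
  obtain ⟨χ, hχ⟩ := (Module.Baer.of_divisible (Additive Circle)).extension_property_addMonoidHom
    (MonoidHom.toAdditive H.subtype) H.subtype_injective (MonoidHom.toAdditive c)
  exact ⟨MonoidHom.toAdditive.symm χ, fun k => DFunLike.congr_fun hχ (Additive.ofMul k)⟩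

/-- Homomorphisms between groups of exponent two extend. -/
theorem exists_comp_eq_of_ker_le {P Q R : Type*} [CommGroup P] [CommGroup Q] [CommGroup R]
    (hP : ∀ p : P, p ^ 2 = 1) (hQ : ∀ q : Q, q ^ 2 = 1) (hR : ∀ r : R, r ^ 2 = 1)
    (τ : P →* Q) (μ : P →* R) (hμ : ∀ p ∈ τ.ker, μ p = 1) : ∃ ν : Q →* R, ∀ p, ν (τ p) = μ p := by
  let _ : Module (ZMod 2) (Additive P) := AddCommGroup.zmodModule hP
  let _ : Module (ZMod 2) (Additive Q) := AddCommGroup.zmodModule hQ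
  let _ : Module (ZMod 2) (Additive R) := AddCommGroup.zmodModule hR
  let T : Additive P →ₗ[ZMod 2] Additive Q := (MonoidHom.toAdditive τ).toZModLinearMap 2
  let M : Additive P →ₗ[ZMod 2] Additive R := (MonoidHom.toAdditive μ).toZModLinearMap 2
  have hle : LinearMap.ker T ≤ LinearMap.ker M := fun p hp => hμ p.toMul hp
  -- Over the field with two elements the embedding of `P / ker τ` into `Q` has a linear left
  -- inverse.
  obtain ⟨S, hS⟩ := ((LinearMap.ker T).liftQ T le_rfl).exists_leftInverse_of_injective
    (Submodule.ker_liftQ_eq_bot _ _ _ le_rfl)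
  let N : Additive Q →ₗ[ZMod 2] Additive R := (LinearMap.ker T).liftQ M hle ∘ₗ S
  refine ⟨MonoidHom.toAdditive.symm N.toAddMonoidHom, fun p => ?_⟩
  have h1 : S (T (Additive.ofMul p)) = (LinearMap.ker T).mkQ (Additive.ofMul p) :=
    LinearMap.congr_fun hS ((LinearMap.ker T).mkQ (Additive.ofMul p))
  have h2 : N (T (Additive.ofMul p)) = M (Additive.ofMul p) := by
    change (LinearMap.ker T).liftQ M hle (S (T (Additive.ofMul p))) = _
    rw [h1]
    exact Submodule.liftQ_apply _ _ _
  exact h2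

end Characters

/-! ### Comparison of two loop data, and the role of `τ` -/

section Comparison

variable {G : Type*} [CommGroup G]
  {B : Type*} [NonAssocCommRing B] [Module ℝ B] [SMulCommClass ℝ B B] [IsScalarTower ℝ B B]
  {ℬ : G → Submodule ℝ B} {ρ ρ' : Center ℝ B →+* ℂ} {z : G → ℂ}
  {t : B →ₗ[Center ℝ B] Center ℝ B} {H : Subgroup G}

theorem IsLoopDatum.rho_smul (hd : IsRealDatum ℬ ρ z) (r : ℝ) (l : Center ℝ B) :
    ρ (r • l) = r • ρ l := by
  rw [Algebra.smul_def, map_mul, hd.rho_iota, Algebra.smul_def]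

theorem IsLoopDatum.exists_ratio (hd : IsRealDatum ℬ ρ z) (hd' : IsRealDatum ℬ ρ' z)
    (h : IsGrading ℬ) (hs : IsGradedSimple ℬ) (hR : CenterOneIsReal ℬ)
    (hH : (H : Set G) = centerSupport ℬ) (k : H) :
    ∃ c : ℝ, c ≠ 0 ∧ ∀ l ∈ centerGrading ℬ (k : G), ρ' l = c • ρ l := by
  obtain ⟨u, hu, hu0⟩ := mem_centerSupport.1 (hH ▸ k.2 : (k : G) ∈ centerSupport ℬ)
  obtain ⟨a, ha⟩ := hd.rho_mem hu
  obtain ⟨a', ha'⟩ := hd'.rho_mem hu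
  have ha0 : a ≠ 0 := by
    rintro rfl
    rw [zero_smul] at ha
    exact IsLoopDatum.rho_ne_zero h hs hu hu0 ha
  have ha0' : a' ≠ 0 := by
    rintro rfl
    rw [zero_smul] at ha'
    exact IsLoopDatum.rho_ne_zero h hs hu hu0 ha'
  refine ⟨a' * a⁻¹, mul_ne_zero ha0' (inv_ne_zero ha0), fun l hl => ?_⟩
  obtain ⟨r, rfl⟩ := hR.exists_smul_eq h hs hu hu0 hl
  rw [hd.rho_smul, hd'.rho_smul, ha, ha', smul_smul, smul_smul, smul_smul]
  congr 1
  field_simp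

theorem center_mul_ne_zero (h : IsGrading ℬ) (hs : IsGradedSimple ℬ) {g : G} {u v : Center ℝ B}
    (hu : u ∈ centerGrading ℬ g) (hu0 : u ≠ 0) (hv0 : v ≠ 0) : u * v ≠ 0 := by
  intro h0
  rcases hs.center_smul_eq_zero h hu (x := (v : B)) (congrArg Subtype.val h0) with h1 | h1
  · exact hu0 h1
  · exact hv0 (Subtype.ext h1)

open Classical in
-- The ratio of `ρ'` to `ρ` on `L_k` is multiplicative in `k`, since products of nonzero homogeneous
-- central elements are nonzero.
theorem IsLoopDatum.exists_sign_hom (hd : IsRealDatum ℬ ρ z) (hd' : IsRealDatum ℬ ρ' z)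
    (h : IsGrading ℬ) (hs : IsGradedSimple ℬ) (hR : CenterOneIsReal ℬ)
    (hH : (H : Set G) = centerSupport ℬ) :
    ∃ ν : H →* ℤˣ, ∀ k : H, ∃ c : ℝ, (∀ l ∈ centerGrading ℬ (k : G), ρ' l = c • ρ l) ∧
      ((ν k = 1 ∧ 0 < c) ∨ (ν k = -1 ∧ c < 0)) := by
  choose c hc0 hc using hd.exists_ratio hd' h hs hR hH
  have hmul : ∀ k m, c (k * m) = c k * c m := by
    intro k m
    obtain ⟨u, hu, hu0⟩ := mem_centerSupport.1 (hH ▸ k.2 : (k : G) ∈ centerSupport ℬ)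
    obtain ⟨v, hv, hv0⟩ := mem_centerSupport.1 (hH ▸ m.2 : (m : G) ∈ centerSupport ℬ)
    have huv : u * v ∈ centerGrading ℬ ((k * m : H) : G) := h.center.mul_mem hu hv
    have h1 := hc (k * m) _ huv
    rw [map_mul ρ', hc k _ hu, hc m _ hv, smul_mul_smul_comm, ← map_mul ρ] at h1
    exact (smul_left_injective ℝ (IsLoopDatum.rho_ne_zero h hs huv
      (center_mul_ne_zero h hs hu hu0 hv0)) h1).symm
  refine ⟨MonoidHom.mk' (fun k => if 0 < c k then 1 else -1) fun k m => ?_,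
    fun k => ⟨c k, hc k, ?_⟩⟩
  · rw [hmul]
    rcases lt_or_gt_of_ne (hc0 k) with hk | hk <;> rcases lt_or_gt_of_ne (hc0 m) with hm | hm
    · rw [if_pos (mul_pos_of_neg_of_neg hk hm), if_neg hk.not_gt, if_neg hm.not_gt]; rfl
    · rw [if_neg (mul_neg_of_neg_of_pos hk hm).not_gt, if_neg hk.not_gt, if_pos hm]; rfl
    · rw [if_neg (mul_neg_of_pos_of_neg hk hm).not_gt, if_pos hk, if_neg hm.not_gt]; rfl
    · rw [if_pos (mul_pos hk hm), if_pos hk, if_pos hm]; rfl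
  · rcases lt_or_gt_of_ne (hc0 k) with hk | hk
    · exact Or.inr ⟨if_neg hk.not_gt, hk⟩
    · exact Or.inl ⟨if_pos hk, hk⟩

/-- The sign homomorphism kills squares, so it factors through `H / H^[2]`. At `x = gH` the form is
rescaled by the ratio in degree `g²`, which represents `τ(x)`; so `μ` is the composite with `τ`. -/
theorem IsLoopDatum.exists_signature_eq_mul [Module.Finite ℝ B] (hd : IsRealDatum ℬ ρ z)
    (hd' : IsRealDatum ℬ ρ' z) (h : IsGrading ℬ) (hs : IsGradedSimple ℬ) (ht : IsCenterProj ℬ t)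
    (hR : CenterOneIsReal ℬ) (hH : (H : Set G) = centerSupport ℬ) :
    ∃ μ : TwoTorsion (G ⧸ H) →* ℤˣ, (∀ x ∈ (tau H).ker, μ x = 1) ∧
      ∀ x, hd'.signature h t x = hd.signature h t x * (μ x : ℤ) := by
  obtain ⟨ν, hν⟩ := hd.exists_sign_hom hd' h hs hR hH
  have hker : Squares H ≤ ν.ker := by
    rintro _ ⟨k, rfl⟩
    rw [MonoidHom.mem_ker, powMonoidHom_apply, map_pow, Int.units_sq]
  refine ⟨(QuotientGroup.lift (Squares H) ν hker).comp (tau H), fun x hx => ?_, fun x => ?_⟩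
  · rw [MonoidHom.comp_apply, MonoidHom.mem_ker.1 hx, map_one]
  · have hx2 : x.1.out ^ 2 ∈ H :=
      sq_mem_of_mem_twoTorsion H (by rw [QuotientGroup.out_eq']; exact x.2)
    have hμ : (QuotientGroup.lift (Squares H) ν hker).comp (tau H) x = ν ⟨x.1.out ^ 2, hx2⟩ := rfl
    obtain ⟨c, hc, hs' | hs'⟩ := hν ⟨x.1.out ^ 2, hx2⟩
    · rw [hμ, hs'.1, Units.val_one, mul_one]
      exact hd.signature_of_pos hd' h ht x hs'.2 (by rwa [← pow_two])
    · rw [hμ, hs'.1, Units.val_neg, Units.val_one, mul_neg_one]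
      exact hd.signature_of_neg hd' h hs ht hH x hs'.2 (by rwa [← pow_two])

open Classical in
-- Since `μ` is trivial on `ker τ`, it factors as `ν ∘ τ`, and `ρ'` is `ρ` multiplied by the sign of
-- `ν` on each `L_h`.
theorem IsLoopDatum.exists_twist [Module.Finite ℝ B] (hd : IsRealDatum ℬ ρ z)
    (h : IsGrading ℬ) (hs : IsGradedSimple ℬ) (ht : IsCenterProj ℬ t)
    (hR : CenterOneIsReal ℬ) (hH : (H : Set G) = centerSupport ℬ)
    (μ : TwoTorsion (G ⧸ H) →* ℤˣ) (hμ : ∀ x ∈ (tau H).ker, μ x = 1) :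
    ∃ (ρ' : Center ℝ B →+* ℂ) (hd' : IsRealDatum ℬ ρ' z),
      ∀ x, hd'.signature h t x = hd.signature h t x * (μ x : ℤ) := by
  obtain ⟨ν, hν⟩ := exists_comp_eq_of_ker_le (fun x => Subtype.ext x.2)
    (fun q => by
      obtain ⟨k, rfl⟩ := QuotientGroup.mk_surjective q
      rw [← QuotientGroup.mk_pow, QuotientGroup.eq_one_iff]
      exact ⟨k, rfl⟩) Int.units_sq (tau H) μ hμ
  -- The value outside `H` is immaterial, because `L` vanishes there.
  let s : G → ℝ := fun g => if hg : g ∈ H then ((ν (QuotientGroup.mk ⟨g, hg⟩) : ℤˣ) : ℤ) else 1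
  have hs_mem : ∀ {g} (hg : g ∈ H), s g = ((ν (QuotientGroup.mk ⟨g, hg⟩) : ℤˣ) : ℤ) :=
    fun hg => dif_pos hg
  have hs_mul : ∀ {g k}, g ∈ H → k ∈ H → s (g * k) = s g * s k := by
    intro g k hg hk
    rw [hs_mem hg, hs_mem hk, hs_mem (H.mul_mem hg hk), ← Int.cast_mul, ← Units.val_mul,
      ← map_mul, ← QuotientGroup.mk_mul]
    rfl
  obtain ⟨φ, hφ⟩ := h.center.exists_addMonoidHom
    (fun g => ((LinearMap.lsmul ℝ ℂ (s g)).toAddMonoidHom.comp (ρ : Center ℝ B →+ ℂ)))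
  replace hφ : ∀ g, ∀ l ∈ centerGrading ℬ g, φ l = s g • ρ l := hφ
  have hsupp : ∀ {g} {l : Center ℝ B}, l ∈ centerGrading ℬ g → l ≠ 0 → g ∈ H := fun hl hl0 => by
    rw [← SetLike.mem_coe, hH]; exact mem_centerSupport.2 ⟨_, hl, hl0⟩
  have h1 : φ 1 ≠ 0 := by
    rw [hφ 1 1 h.one_mem, map_one, hs_mem H.one_mem]
    exact smul_ne_zero (Int.cast_ne_zero.2 (Units.ne_zero _)) one_ne_zero
  obtain ⟨ρ', hρ', hd'⟩ := hR.exists_datum hd.z_ne_zero hd.z_mul φ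
    (fun r c => h.center.induction c
      (fun g c hc => by
        rw [hφ g _ (Submodule.smul_mem _ r hc), hφ g c hc, hd.rho_smul, smul_comm])
      (by simp) (fun x y hx hy => by rw [smul_add, map_add, map_add, smul_add, hx, hy]))
    (h.center.map_mul_of_homogeneous φ fun g k x hx y hy => by
      by_cases hx0 : x = 0
      · simp [hx0]
      by_cases hy0 : y = 0
      · simp [hy0]
      rw [hφ _ _ (h.center.mul_mem hx hy), hφ g x hx, hφ k y hy,
        hs_mul (hsupp hx hx0) (hsupp hy hy0), map_mul, smul_mul_smul_comm])
    h1 (fun g l hl => by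
      obtain ⟨a, ha⟩ := hd.rho_mem hl
      exact ⟨s g * a, by rw [hφ g l hl, ha, smul_smul]⟩)
  refine ⟨ρ', hd', fun x => ?_⟩
  have hx2 : x.1.out * x.1.out ∈ H := by
    rw [← pow_two]
    exact sq_mem_of_mem_twoTorsion H (by rw [QuotientGroup.out_eq']; exact x.2)
  have hsx : s (x.1.out * x.1.out) = ((μ x : ℤˣ) : ℤ) := by
    rw [hs_mem hx2, ← hν x]
    congr 3
    simp only [← pow_two]
    rfl
  have hρx : ∀ l ∈ centerGrading ℬ (x.1.out * x.1.out), ρ' l = ((μ x : ℤ) : ℝ) • ρ l :=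
    fun l hl => by rw [hρ', hφ _ l hl, hsx]
  rcases Int.units_eq_one_or (μ x) with hx | hx
  · rw [hx] at hρx ⊢
    rw [Units.val_one, mul_one]
    exact hd.signature_of_pos hd' h ht x (c := ((1 : ℤˣ) : ℤ)) (by simp) hρx
  · rw [hx] at hρx ⊢
    rw [Units.val_neg, Units.val_one, mul_neg_one]
    exact hd.signature_of_neg hd' h hs ht hH x (c := ((-1 : ℤˣ) : ℤ)) (by simp) hρx

end Comparison

/-! ### Loop data and embeddings of the center -/

section CenterLoop

variable {G : Type*} [CommGroup G]
  {B : Type*} [NonAssocCommRing B] [Module ℝ B] [SMulCommClass ℝ B B] [IsScalarTower ℝ B B]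
  {ℬ : G → Submodule ℝ B} {ρ : Center ℝ B →+* ℂ} {z : G → ℂ} {H : Subgroup G}

theorem IsLoopDatum.exists_center_loopEmbedding (hd : IsRealDatum ℬ ρ z) (h : IsGrading ℬ)
    (hs : IsGradedSimple ℬ) (hH : (H : Set G) = centerSupport ℬ) :
    ∃ ψ, IsLoopEmbedding (centerGrading ℬ) (QuotientGroup.mk' H) (trivialGrading ℝ (G ⧸ H)) z ψ := by
  obtain ⟨ψ, hψ⟩ := h.center.exists_addMonoidHom (M := ℝ ⊗[ℝ] MonoidAlgebra ℂ G)
    (fun g =>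
      { toFun := fun l => (1 : ℝ) ⊗ₜ MonoidAlgebra.single g (ρ l)
        map_zero' := by rw [map_zero, MonoidAlgebra.single_zero, TensorProduct.tmul_zero]
        map_add' := fun l m => by rw [map_add, MonoidAlgebra.single_add, TensorProduct.tmul_add] })
  replace hψ : ∀ g, ∀ l ∈ centerGrading ℬ g, ψ l = 1 ⊗ₜ MonoidAlgebra.single g (ρ l) := hψ
  have hψa : ∀ {g} {l : Center ℝ B} {a : ℝ}, l ∈ centerGrading ℬ g → ρ l = a • z g →
      ψ l = a ⊗ₜ MonoidAlgebra.single g (z g) := by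
    intro g l a hl ha
    rw [hψ g l hl, ha, tmul_single_smul, smul_eq_mul, mul_one]
  have hproj : ∀ g l, extract ℝ ℝ g (z g) (ψ l) • z g = ρ (h.center.proj g l) := by
    intro g l
    refine h.center.induction l (fun k l hl => ?_) (by simp) (fun x y hx hy => ?_)
    · obtain ⟨a, ha⟩ := hd.rho_mem hl
      by_cases hk : k = g
      · subst hk
        rw [hψa hl ha, extract_same k (hd.z_ne_zero k), h.center.proj_same hl, ha]
      · rw [hψa hl ha, extract_ne hk, zero_smul, h.center.proj_ne hl hk, map_zero]
    · rw [map_add, map_add, add_smul, hx, hy, map_add, map_add]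
  refine ⟨ψ, ⟨fun r x => ?_, h.center.map_mul_of_homogeneous ψ fun g k x hx y hy => ?_, ?_,
    fun {g l} hl => ?_, fun {g a} ha => ?_⟩⟩
  · refine h.center.induction x (fun g x hx => ?_) (by simp) (fun x y hx hy => ?_)
    · rw [hψ g _ (Submodule.smul_mem _ r hx), hψ g x hx, hd.rho_smul, ← MonoidAlgebra.smul_single,
        TensorProduct.tmul_smul]
      rfl
    · rw [smul_add, map_add, map_add, smul_add, hx, hy]
  · rw [hψ _ _ (h.center.mul_mem hx hy), hψ g x hx, hψ k y hy,
      Algebra.TensorProduct.tmul_mul_tmul, MonoidAlgebra.single_mul_single, map_mul, mul_one]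
  · rw [injective_iff_map_eq_zero]
    intro l hl
    refine h.center.ext fun g => ?_
    rw [map_zero]
    by_contra hne
    refine IsLoopDatum.rho_ne_zero (ρ := ρ) h hs (h.center.proj_mem g l) hne ?_
    rw [← hproj, hl, map_zero, zero_smul]
  · by_cases hl0 : l = 0
    · exact ⟨0, zero_mem _, by simp [hl0]⟩
    obtain ⟨a, ha⟩ := hd.rho_mem hl
    refine ⟨a, ?_, hψa hl ha⟩
    have hg : QuotientGroup.mk' H g = 1 := by
      rw [QuotientGroup.mk'_apply, QuotientGroup.eq_one_iff, ← SetLike.mem_coe, hH]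
      exact mem_centerSupport.2 ⟨l, hl, hl0⟩
    rw [trivialGrading, if_pos hg]
    trivial
  · by_cases hg : QuotientGroup.mk' H g = 1
    · have hgH : g ∈ centerSupport ℬ := by
        rw [← hH]; exact (QuotientGroup.eq_one_iff g).1 hg
      obtain ⟨u, hu, hu0⟩ := mem_centerSupport.1 hgH
      obtain ⟨b, hb⟩ := hd.rho_mem hu
      have hb0 : b ≠ 0 := by
        rintro rfl
        rw [zero_smul] at hb
        exact IsLoopDatum.rho_ne_zero h hs hu hu0 hb
      have hx : (a * b⁻¹) • u ∈ centerGrading ℬ g := Submodule.smul_mem _ _ hu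
      refine ⟨_, hx, hψa hx ?_⟩
      rw [hd.rho_smul, hb, smul_smul, mul_assoc, inv_mul_cancel₀ hb0, mul_one]
    · rw [trivialGrading, if_neg hg, Submodule.mem_bot] at ha
      exact ⟨0, zero_mem _, by simp [ha]⟩

/-- An isomorphism of `L` with the loop algebra of `ℝ` enters the classification only through the
homomorphism `ρ` that it provides, adapted to the given character. -/
theorem IsLoopEmbedding.exists_center_datum (h : IsGrading ℬ) (hs : IsGradedSimple ℬ)
    (hR : CenterOneIsReal ℬ) (hz0 : ∀ g, z g ≠ 0)
    (hz : ∀ g k, ∃ a : ℝ, z g * z k = a • z (g * k))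
    {ψ : Center ℝ B →+ ℝ ⊗[ℝ] MonoidAlgebra ℂ G}
    (hψ : IsLoopEmbedding (centerGrading ℬ) (QuotientGroup.mk' H) (trivialGrading ℝ (G ⧸ H)) z ψ) :
    ∃ ρ : Center ℝ B →+* ℂ, IsRealDatum ℬ ρ z := by
  let φ : Center ℝ B →+ ℂ := (augment (LinearMap.id : ℝ →ₗ[ℝ] ℝ)).toAddMonoidHom.comp ψ
  have hφ : ∀ {g : G} {l : Center ℝ B} {a : ℝ}, ψ l = a ⊗ₜ MonoidAlgebra.single g (z g) →
      φ l = a • z g := fun {g l a} ha => by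
    change augment LinearMap.id (ψ l) = _
    rw [ha, augment_tmul_single, LinearMap.id_apply]
  obtain ⟨ρ, -, hd⟩ := hR.exists_datum hz0 hz φ
    (fun r c => by
      change augment LinearMap.id (ψ (r • c)) = r • augment LinearMap.id (ψ c)
      rw [← LinearMap.map_smul]
      exact congrArg _ (hψ.map_smul r c))
    (h.center.map_mul_of_homogeneous φ fun g k x hx y hy => by
      obtain ⟨a, -, ha⟩ := hψ.map_mem hx
      obtain ⟨b, -, hb⟩ := hψ.map_mem hy
      rw [hφ ha, hφ hb]
      change augment LinearMap.id (ψ (x * y)) = _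
      rw [hψ.map_mul, ha, hb, Algebra.TensorProduct.tmul_mul_tmul,
        MonoidAlgebra.single_mul_single, augment_tmul_single, LinearMap.id_apply,
        smul_mul_smul_comm])
    (by
      obtain ⟨a, -, ha⟩ := hψ.map_mem (show (1 : Center ℝ B) ∈ centerGrading ℬ 1 from h.one_mem)
      rw [hφ ha]
      refine smul_ne_zero ?_ (hz0 1)
      rintro rfl
      rw [TensorProduct.zero_tmul] at ha
      have := hs.nontrivial
      have h0 : (1 : Center ℝ B) = 0 := hψ.injective (ha.trans (map_zero ψ).symm)
      exact one_ne_zero (congrArg Subtype.val h0 : (1 : B) = 0))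
    (fun g l hl => by
      obtain ⟨a, -, ha⟩ := hψ.map_mem hl
      exact ⟨a, hφ ha⟩)
  exact ⟨ρ, hd⟩

end CenterLoop

/-! ### Existence of `ρ` and `χ`, and the two possibilities for `L_e` -/

section Existence

/-- A residue field of `L` is algebraic over `K`, so it embeds into `ℂ`. -/
theorem exists_algHom_complex (K L : Type*) [Field K] [CommRing L] [Nontrivial L] [Algebra K L]
    [Module.Finite K L] [Algebra K ℂ] : Nonempty (L →ₐ[K] ℂ) := by
  obtain ⟨m, hm⟩ := Ideal.exists_maximal L
  let _ : Field (L ⧸ m) := Ideal.Quotient.field m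
  have : Algebra.IsAlgebraic K (L ⧸ m) := Algebra.IsAlgebraic.of_finite K _
  exact ⟨(IsAlgClosed.lift (M := ℂ) (R := K) (S := L ⧸ m)).comp (Ideal.Quotient.mkₐ K m)⟩

variable {G : Type*} [CommGroup G]
  {B : Type*} [NonAssocCommRing B] [Module ℝ B] [SMulCommClass ℝ B B] [IsScalarTower ℝ B B]
  [Module.Finite ℝ B] {ℬ : G → Submodule ℝ B} {H : Subgroup G}

theorem exists_fixed_family (χ : G →* Circle) :
    ∃ z : G → ℂ, ∀ g, z g ≠ 0 ∧ z g = (χ g : ℂ) * (starRingEnd ℂ) (z g) := by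
  choose z hz using fun g => exists_circle_sqrt (χ g)
  exact ⟨z, hz⟩

theorem fixed_family_mul {χ : G →* Circle} {z : G → ℂ}
    (hz : ∀ g, z g ≠ 0 ∧ z g = (χ g : ℂ) * (starRingEnd ℂ) (z g)) (g k : G) :
    ∃ a : ℝ, z g * z k = a • z (g * k) :=
  exists_real_smul_of_fixed (hz (g * k)).1 (hz (g * k)).2 (by
    rw [map_mul χ, Circle.coe_mul, map_mul, mul_mul_mul_comm, ← (hz g).2, ← (hz k).2])

/-- For `0 ≠ l ∈ L_h` the quotient `ρ(l) / conj ρ(l)` does not depend on `l`, as `L_h` is a real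
line, and it is multiplicative in `h`. The resulting character of `H` extends to `G`. -/
theorem CenterOneIsReal.exists_character (hR : CenterOneIsReal ℬ) (h : IsGrading ℬ)
    (hs : IsGradedSimple ℬ) (hH : (H : Set G) = centerSupport ℬ) :
    ∃ (χ : G →* Circle) (ρ : Center ℝ B →+* ℂ), ∀ z : G → ℂ,
      (∀ g, z g ≠ 0 ∧ z g = (χ g : ℂ) * (starRingEnd ℂ) (z g)) → IsRealDatum ℬ ρ z := by
  have := hs.nontrivial
  have : Nontrivial (Center ℝ B) := ⟨⟨1, 0, fun h0 => one_ne_zero (congrArg Subtype.val h0 : (1 : B) = 0)⟩⟩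
  obtain ⟨ρ⟩ := exists_algHom_complex ℝ (Center ℝ B)
  have hne : ∀ {g} {l : Center ℝ B}, l ∈ centerGrading ℬ g → l ≠ 0 → ρ l ≠ 0 := fun hl hl0 =>
    IsLoopDatum.rho_ne_zero (ρ := (ρ : Center ℝ B →+* ℂ)) h hs hl hl0
  have hc : ∀ k : H, ∃ c : Circle, ∀ l ∈ centerGrading ℬ (k : G),
      ρ l = (c : ℂ) * (starRingEnd ℂ) (ρ l) := by
    intro k
    obtain ⟨u, hu, hu0⟩ := mem_centerSupport.1 (hH ▸ k.2 : (k : G) ∈ centerSupport ℬ)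
    have h0 : (starRingEnd ℂ) (ρ u) ≠ 0 := (map_ne_zero _).2 (hne hu hu0)
    refine ⟨Circle.ofConjDivSelf _ h0, fun l hl => ?_⟩
    obtain ⟨r, rfl⟩ := hR.exists_smul_eq h hs hu hu0 hl
    have e : ((Circle.ofConjDivSelf _ h0 : Circle) : ℂ) =
      (starRingEnd ℂ) ((starRingEnd ℂ) (ρ u)) / (starRingEnd ℂ) (ρ u) := rfl
    rw [e, Complex.conj_conj, map_smul, Complex.real_smul, map_mul, Complex.conj_ofReal]
    field_simp
  choose c hc using hc
  have hmul : ∀ k m, c (k * m) = c k * c m := by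
    intro k m
    obtain ⟨u, hu, hu0⟩ := mem_centerSupport.1 (hH ▸ k.2 : (k : G) ∈ centerSupport ℬ)
    obtain ⟨v, hv, hv0⟩ := mem_centerSupport.1 (hH ▸ m.2 : (m : G) ∈ centerSupport ℬ)
    have huv : u * v ∈ centerGrading ℬ ((k * m : H) : G) := h.center.mul_mem hu hv
    have h1 := hc (k * m) _ huv
    have h2 : ρ (u * v) = (c k * c m : ℂ) * (starRingEnd ℂ) (ρ (u * v)) := by
      rw [map_mul ρ, map_mul, mul_mul_mul_comm, ← hc k u hu, ← hc m v hv]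
    have h0 : (starRingEnd ℂ) (ρ (u * v)) ≠ 0 :=
      (map_ne_zero _).2 (hne huv (center_mul_ne_zero h hs hu hu0 hv0))
    exact Circle.ext ((mul_right_cancel₀ h0 (h1.symm.trans h2)).trans (Circle.coe_mul _ _).symm)
  obtain ⟨χ, hχ⟩ := exists_character_extension H (MonoidHom.mk' c hmul)
  refine ⟨χ, ρ, fun z hz => ⟨fun k x => ?_, hR.mem_iff, fun k => ρ.commutes k, fun g => (hz g).1,
    fixed_family_mul hz, fun {g l} hl => ?_⟩⟩
  · rw [algebraMap_center, smul_assoc, one_smul]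
  · by_cases hl0 : l = 0
    · exact ⟨0, by simp [hl0]⟩
    have hg : g ∈ H := by
      rw [← SetLike.mem_coe, hH]; exact mem_centerSupport.2 ⟨l, hl, hl0⟩
    refine exists_real_smul_of_fixed (hz g).1 (hz g).2 ?_
    have := hc ⟨g, hg⟩ l hl
    rwa [show c ⟨g, hg⟩ = χ g from (hχ ⟨g, hg⟩).symm] at this

/-- The inverse of an element of degree `e` has degree `e`, so `L_e` is a finite field extension of
`ℝ`. -/
theorem centerOneIsReal_or_centerOneIsComplex (h : IsGrading ℬ) (hs : IsGradedSimple ℬ) :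
    CenterOneIsReal ℬ ∨ CenterOneIsComplex ℬ := by
  have := hs.nontrivial
  let S : Subalgebra ℝ (Center ℝ B) :=
    { centerGrading ℬ 1 with
      mul_mem' := fun {a b} ha hb => by
        have := h.center.mul_mem (g := 1) (h := 1) ha hb
        rwa [one_mul] at this
      algebraMap_mem' := fun r => by
        rw [algebraMap_center]
        exact Submodule.smul_mem _ r (show (1 : Center ℝ B) ∈ centerGrading ℬ 1 from h.one_mem) }
  have hS : ∀ c, c ∈ S ↔ c ∈ centerGrading ℬ 1 := fun c => Iff.rfl
  have hfield : IsField S :=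
    { exists_pair_ne := ⟨1, 0, fun h0 => one_ne_zero
        (congrArg (fun x : S => ((x : Center ℝ B) : B)) h0 : (1 : B) = 0)⟩
      mul_comm := mul_comm
      mul_inv_cancel := fun {a} ha => by
        obtain ⟨d, hd, had⟩ := hs.exists_inv h a.2 (fun h0 => ha (Subtype.ext h0))
        rw [inv_one] at hd
        exact ⟨⟨d, hd⟩, Subtype.ext had⟩ }
  let _ : Field S := hfield.toField
  have : Module.Finite ℝ S := inferInstanceAs (Module.Finite ℝ S.toSubmodule)
  have : Algebra.IsAlgebraic ℝ S := Algebra.IsAlgebraic.of_finite ℝ S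
  rcases Real.nonempty_algEquiv_or S with ⟨⟨e⟩⟩ | ⟨⟨e⟩⟩
  · left
    refine le_antisymm (fun c hc => ?_) ?_
    · rw [Submodule.mem_span_singleton]
      refine ⟨e ⟨c, hc⟩, ?_⟩
      have h1 : (⟨c, hc⟩ : S) = algebraMap ℝ S (e ⟨c, hc⟩) := by
        apply e.injective
        rw [e.commutes]; rfl
      rw [← algebraMap_center]
      exact (congrArg Subtype.val h1).symm
    · rw [Submodule.span_singleton_le_iff_mem]
      exact h.one_mem
  · right
    let φ : ℂ →ₐ[ℝ] Center ℝ B := S.val.comp e.symm.toAlgHom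
    refine ⟨{ toFun := φ
              map_smul' := φ.toLinearMap.map_smul
              map_zero' := φ.toLinearMap.map_zero
              map_add' := φ.toLinearMap.map_add
              map_mul' := φ.map_mul' }, ?_, ?_⟩
    · exact Subtype.val_injective.comp e.symm.injective
    · ext c
      constructor
      · rintro ⟨w, rfl⟩
        exact (e.symm w).2
      · intro hc
        exact ⟨e ⟨c, hc⟩, congrArg Subtype.val (e.symm_apply_apply ⟨c, hc⟩)⟩

end Existence

/-! ### The case `L_e = ℝ` -/

section RealCase

variable {G : Type*} [CommGroup G]
  {B : Type*} [NonAssocCommRing B] [Module ℝ B] [SMulCommClass ℝ B B] [IsScalarTower ℝ B B]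
  [Module.Finite ℝ B] {ℬ : G → Submodule ℝ B}
  {t : B →ₗ[Center ℝ B] Center ℝ B} {H : Subgroup G}

theorem exists_gradedIso_center (h : IsGrading ℬ) (hs : IsGradedSimple ℬ)
    (hH : (H : Set G) = centerSupport ℬ) (hR : CenterOneIsReal ℬ) :
    ∃ χ : G →* Circle, GradedIso (centerGrading ℬ)
      (realLoopGrading (QuotientGroup.mk' H) χ (isGrading_trivialGrading ℝ (G ⧸ H))) := by
  obtain ⟨χ, ρ, hχ⟩ := hR.exists_character h hs hH
  obtain ⟨z, hz⟩ := exists_fixed_family χ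
  exact ⟨χ, (gradedIso_realLoopGrading_iff h.center _ hz).2
    ((hχ z hz).exists_center_loopEmbedding h hs hH)⟩

/-- One `ρ` provides `κ` and `σ`. Any other isomorphism provides a second `ρ'` with the same `z`,
and the twists of `ρ` realize all admissible `σ'`. -/
theorem exists_real_invariants (h : IsGrading ℬ) (hs : IsGradedSimple ℬ) (ht : IsCenterProj ℬ t)
    (hH : (H : Set G) = centerSupport ℬ) (hR : CenterOneIsReal ℬ) (χ : G →* Circle)
    (hχ : GradedIso (centerGrading ℬ)
      (realLoopGrading (QuotientGroup.mk' H) χ (isGrading_trivialGrading ℝ (G ⧸ H)))) :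
    ∃ (κ : G ⧸ H → ℕ) (σ : TwoTorsion (G ⧸ H) → ℤ),
      (IsBalanced κ ∧ κ.support.Finite ∧ IsSignature κ σ ∧
        GradedIso ℬ (realLoopGrading (QuotientGroup.mk' H) χ (isGrading_realJordanGrading κ σ))) ∧
      ∀ (κ' : G ⧸ H → ℕ) (σ' : TwoTorsion (G ⧸ H) → ℤ),
        IsBalanced κ' → κ'.support.Finite → IsSignature κ' σ' →
        (GradedIso ℬ (realLoopGrading (QuotientGroup.mk' H) χ
            (isGrading_realJordanGrading κ' σ')) ↔
          κ' = κ ∧ ∃ μ : TwoTorsion (G ⧸ H) →* ℤˣ, (∀ x ∈ (tau H).ker, μ x = 1) ∧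
            ∀ x, σ' x = σ x * (μ x : ℤ)) := by
  obtain ⟨z, hz⟩ := exists_fixed_family χ
  have hz0 : ∀ g, z g ≠ 0 := fun g => (hz g).1
  obtain ⟨ψ, hψ⟩ := (gradedIso_realLoopGrading_iff h.center _ hz).1 hχ
  obtain ⟨ρ, hd⟩ := hψ.exists_center_datum h hs hR hz0 (fixed_family_mul hz)
  refine ⟨hd.dim h t, hd.signature h t, ⟨hd.dim_isBalanced ht h hs hH, hd.dim_support_finite h,
    hd.isSignature h, (gradedIso_realLoopGrading_iff h _ hz).2
      (hd.exists_loopEmbedding ht h hs hH)⟩, fun κ' σ' _ _ hσ' => ⟨fun hiso => ?_, ?_⟩⟩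
  · obtain ⟨ψ', hψ'⟩ := (gradedIso_realLoopGrading_iff h _ hz).1 hiso
    obtain ⟨ρ', hd', rfl, rfl⟩ :=
      hψ'.exists_invariants h hs ht hH hR hz0 (fixed_family_mul hz) hσ'
    exact ⟨rfl, hd.exists_signature_eq_mul hd' h hs ht hR hH⟩
  · rintro ⟨rfl, μ, hμ, hσμ⟩
    obtain ⟨ρ', hd', hd'σ⟩ := hd.exists_twist h hs ht hR hH μ hμ
    obtain rfl : σ' = hd'.signature h t := funext fun x => (hσμ x).trans (hd'σ x).symm
    exact (gradedIso_realLoopGrading_iff h _ hz).2 (hd'.exists_loopEmbedding ht h hs hH)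

end RealCase

/-! ### The case `L_e ≅ ℂ` -/

section ComplexCase

theorem finrank_stdJordanGrading {Γ K : Type*} [CommGroup Γ] [Field K] (κ : Γ → ℕ)
    (ε : Γ → ℕ → K) (x : Γ) : Module.finrank K (stdJordanGrading κ ε x) =
      Module.finrank K (trivialGrading K Γ x) + κ x := by
  obtain ⟨e, -⟩ := exists_coordinates x (stdSpaceGrading K κ x) LinearMap.id (fun _ hv => hv)
    (fun _ _ h0 => h0) (fun w hw => ⟨w, hw, rfl⟩)
  have : Module.Finite K (stdSpaceGrading K κ x) := Module.Finite.equiv e.symm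
  have : Module.Free K (stdSpaceGrading K κ x) := Module.Free.of_equiv e.symm
  let e' : stdJordanGrading κ ε x ≃ₗ[K] trivialGrading K Γ x × stdSpaceGrading K κ x :=
    { toFun := fun a => (⟨a.1.scalar, a.2.1⟩, ⟨a.1.vector, a.2.2⟩)
      invFun := fun p => ⟨⟨p.1, p.2⟩, p.1.2, p.2.2⟩
      map_add' := fun _ _ => rfl
      map_smul' := fun _ _ => rfl
      left_inv := fun _ => rfl
      right_inv := fun _ => rfl }
  rw [e'.finrank_eq, Module.finrank_prod, e.finrank_eq, Module.finrank_fin_fun]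

variable {G : Type*} [CommGroup G]

/-- The contribution of the scalars does not depend on `κ`, so the dimensions of the `B_g` determine
`κ`. -/
theorem IsLoopEmbedding.finrank_eq {B : Type*} [NonUnitalNonAssocRing B] [Module ℝ B]
    {ℬ : G → Submodule ℝ B} {H : Subgroup G} {κ : G ⧸ H → ℕ}
    {ψ : B →+ ComplexJordan κ ⊗[ℂ] MonoidAlgebra ℂ G}
    (hψ : IsLoopEmbedding ℬ (QuotientGroup.mk' H) (complexJordanGrading κ) (fun _ => 1) ψ) (g : G) :
    Module.finrank ℝ (ℬ g) =
      2 * (Module.finrank ℂ (trivialGrading ℂ (G ⧸ H) (g : G ⧸ H)) + κ (g : G ⧸ H)) := by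
  have hext : ∀ {x : B} {a : ComplexJordan κ}, ψ x = a ⊗ₜ MonoidAlgebra.single g (1 : ℂ) →
      extract ℂ (ComplexJordan κ) g 1 (ψ x) = a := fun {x a} hx => by
    rw [hx, extract_same g one_ne_zero]
  let φ : ℬ g →ₗ[ℝ] complexJordanGrading κ (g : G ⧸ H) :=
    { toFun := fun x => ⟨extract ℂ (ComplexJordan κ) g 1 (ψ x), by
        obtain ⟨a, ha, hxa⟩ := hψ.map_mem x.2
        rw [hext hxa]; exact ha⟩
      map_add' := fun x y => Subtype.ext (by simp)
      map_smul' := fun r x => Subtype.ext (by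
        change extract ℂ (ComplexJordan κ) g 1 (ψ (r • (x : B))) = _
        rw [hψ.map_smul, LinearMap.map_smul]
        rfl) }
  have hφ : Function.Bijective φ := by
    constructor
    · intro x y hxy
      obtain ⟨a, -, hxa⟩ := hψ.map_mem x.2
      obtain ⟨b, -, hyb⟩ := hψ.map_mem y.2
      have e : extract ℂ (ComplexJordan κ) g 1 (ψ x) = extract ℂ (ComplexJordan κ) g 1 (ψ y) :=
        congrArg Subtype.val hxy
      rw [hext hxa, hext hyb] at e
      exact Subtype.ext (hψ.injective (by rw [hxa, hyb, e]))
    · rintro ⟨a, ha⟩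
      obtain ⟨x, hx, hxa⟩ := hψ.surj (g := g) ha
      exact ⟨⟨x, hx⟩, Subtype.ext (hext hxa)⟩
  rw [(LinearEquiv.ofBijective φ hφ).finrank_eq, finrank_real_of_complex, finrank_stdJordanGrading]

variable {B : Type*} [NonAssocCommRing B] [Module ℝ B] [SMulCommClass ℝ B B] [IsScalarTower ℝ B B]
  [Module.Finite ℝ B] {ℬ : G → Submodule ℝ B}
  {t : B →ₗ[Center ℝ B] Center ℝ B} {H : Subgroup G}

theorem IsLoopDatum.exists_complex_loopEmbedding [Module ℂ B] [Module.Finite ℂ B]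
    {ι : ℂ →+* Center ℝ B} {ρ : Center ℝ B →+* ℂ} (hd : IsLoopDatum ℬ ℂ ι ρ (fun _ => 1))
    (hι : ∀ r : ℝ, ι r = r • (1 : Center ℝ B)) (ht : IsCenterProj ℬ t)
    (h : IsGrading ℬ) (hs : IsGradedSimple ℬ) (hH : (H : Set G) = centerSupport ℬ) :
    ∃ ψ, IsLoopEmbedding ℬ (QuotientGroup.mk' H)
      (complexJordanGrading (hd.dim h t : G ⧸ H → ℕ)) (fun _ => 1) ψ := by
  obtain ⟨f, hf1, hf2, hf3, hf4⟩ := exists_isometry_stdSpace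
    (fun x : G ⧸ H => hd.vec h t x.out) (fun x => hd.form t x.out (x⁻¹).out)
    (fun x v w => by rw [inv_inv]; exact hd.form_comm _ _ v w)
    (hd.form_out_nondegenerate ht h hs hH) (fun _ _ => 1)
    (fun _ _ => one_ne_zero) (fun _ _ _ => rfl) (hd.dim h t) (fun x => rfl) (fun x hx => by
      have hx' : x⁻¹ = x := inv_eq_of_mul_eq_one_left hx
      have hnd := hd.form_out_nondegenerate ht h hs hH x
      rw [hx'] at hnd ⊢
      exact exists_complex_diag (hd.form t x.out x.out) (hd.vec h t x.out)
        (hd.form_comm _ _) hnd)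
  obtain ⟨ψ, h1, h2, h3, h4⟩ := hd.exists_hom ht h hs hH _ _ f hf1 hf2 hf3 hf4
  refine ⟨ψ.toAddMonoidHom, ⟨fun r x => ?_, h1, h2, fun {g x} hx => h3 g x hx,
    fun {g a} ha => h4 g a ha⟩⟩
  rw [show r • x = (r : ℂ) • x by rw [hd.smul_eq, hι, smul_assoc, one_smul]]
  exact ψ.map_smul (r : ℂ) x

/-- With `L` viewed as a finite `ℂ`-algebra through `ι`, the homomorphism `ρ` can be chosen
`ℂ`-linear, that is, with `ρ ∘ ι = id`. -/
theorem CenterOneIsComplex.exists_datum (hC : CenterOneIsComplex ℬ) (h : IsGrading ℬ)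
    (hs : IsGradedSimple ℬ) : ∃ (ι : ℂ →+* Center ℝ B) (ρ : Center ℝ B →+* ℂ),
      (∀ r : ℝ, ι r = r • (1 : Center ℝ B)) ∧ (∀ w, ρ (ι w) = w) ∧
      ∀ c : Center ℝ B, c ∈ centerGrading ℬ 1 ↔ ∃ w, ι w = c := by
  obtain ⟨ψ, -, hr⟩ := hC
  have hmem : ∀ c : Center ℝ B, c ∈ centerGrading ℬ 1 ↔ ∃ w, ψ w = c := fun c => by
    rw [← SetLike.mem_coe, ← hr]; rfl
  have h1 : ψ 1 = 1 := by
    obtain ⟨w, hw⟩ := (hmem 1).1 h.one_mem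
    rw [← mul_one (ψ 1), ← hw, ← map_mul, one_mul]
  let ι : ℂ →+* Center ℝ B :=
    { toFun := ψ
      map_one' := h1
      map_mul' := map_mul ψ
      map_zero' := map_zero ψ
      map_add' := map_add ψ }
  have hι : ∀ (r : ℝ) (w : ℂ), ι (r • w) = r • ι w := fun r w => map_smul ψ r w
  have := hs.nontrivial
  have : Nontrivial (Center ℝ B) :=
    ⟨⟨1, 0, fun h0 => one_ne_zero (congrArg Subtype.val h0 : (1 : B) = 0)⟩⟩
  let _ : Algebra ℂ (Center ℝ B) := ι.toAlgebra
  have : IsScalarTower ℝ ℂ (Center ℝ B) := ⟨fun r w c => by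
    change ι (r • w) * c = r • (ι w * c)
    rw [hι, smul_mul_assoc]⟩
  have : Module.Finite ℂ (Center ℝ B) := Module.Finite.of_restrictScalars_finite ℝ ℂ _
  obtain ⟨ρ⟩ := exists_algHom_complex ℂ (Center ℝ B)
  refine ⟨ι, ρ, fun r => ?_, fun w => ρ.commutes w, hmem⟩
  rw [← map_one ι, ← hι, Complex.real_smul, mul_one]

theorem existsUnique_complex_invariant (h : IsGrading ℬ) (hs : IsGradedSimple ℬ)
    (ht : IsCenterProj ℬ t) (hH : (H : Set G) = centerSupport ℬ) (hC : CenterOneIsComplex ℬ) :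
    ∃! κ : G ⧸ H → ℕ, IsBalanced κ ∧ κ.support.Finite ∧
      GradedIso ℬ (loopGradingReal (QuotientGroup.mk' H) (isGrading_complexJordanGrading κ)) := by
  obtain ⟨ι, ρ, hι, hρι, hmem⟩ := hC.exists_datum h hs
  -- The action of `L_e` makes `B` a complex vector space; for `K = ℂ` the constant family `z = 1`
  -- satisfies every condition on `z`.
  let _ : Module ℂ B := Module.compHom B ι
  have hd : IsLoopDatum ℬ ℂ ι ρ (fun _ => 1) :=
    { smul_eq := fun _ _ => rfl
      mem_iff := hmem
      rho_iota := hρι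
      z_ne_zero := fun _ => one_ne_zero
      z_mul := fun _ _ => ⟨1, by simp⟩
      rho_mem := fun {_ l} _ => ⟨ρ l, by simp⟩ }
  have : IsScalarTower ℝ ℂ B := ⟨fun r w x => by
    rw [hd.smul_eq, hd.smul_eq, ← smul_assoc, Complex.real_smul, map_mul, hι, smul_mul_assoc,
      one_mul]⟩
  have : Module.Finite ℂ B := Module.Finite.of_restrictScalars_finite ℝ ℂ _
  refine ⟨hd.dim h t, ⟨hd.dim_isBalanced ht h hs hH, hd.dim_support_finite h,
    (gradedIso_loopGradingReal_iff h _).2 (hd.exists_complex_loopEmbedding hι ht h hs hH)⟩, ?_⟩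
  rintro κ' ⟨-, -, hiso⟩
  obtain ⟨ψ', hψ'⟩ := (gradedIso_loopGradingReal_iff h _).1 hiso
  obtain ⟨ψ, hψ⟩ := hd.exists_complex_loopEmbedding hι ht h hs hH
  funext x
  obtain ⟨g, rfl⟩ := QuotientGroup.mk_surjective x
  have h1 := hψ.finrank_eq g
  have h2 := hψ'.finrank_eq g
  omega

end ComplexCase

end GradedJordan

end

/-! ### The classification theorem -/

theorem theorem5p2 {G : Type*} [CommGroup G] {B : Type*} [NonAssocCommRing B] [IsCommJordan B]
    [Module ℝ B] [SMulCommClass ℝ B B] [IsScalarTower ℝ B B] [Module.Finite ℝ B]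
    (ℬ : G → Submodule ℝ B) (hgrading : IsGrading ℬ) (hsimple : IsGradedSimple ℬ)
    (hdegree : HasDegreeOverCenter ℝ B 2) :
    ∃ H : Subgroup G, (H : Set G) = centerSupport ℬ ∧
      (CenterOneIsReal ℬ ∨ CenterOneIsComplex ℬ) ∧
      (CenterOneIsReal ℬ →
        (∃ χ : G →* Circle, GradedIso (centerGrading ℬ)
          (realLoopGrading (QuotientGroup.mk' H) χ (isGrading_trivialGrading ℝ (G ⧸ H)))) ∧
        ∀ χ : G →* Circle, GradedIso (centerGrading ℬ)
          (realLoopGrading (QuotientGroup.mk' H) χ (isGrading_trivialGrading ℝ (G ⧸ H))) →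
          ∃ (κ : G ⧸ H → ℕ) (σ : TwoTorsion (G ⧸ H) → ℤ),
            (IsBalanced κ ∧ κ.support.Finite ∧ IsSignature κ σ ∧
              GradedIso ℬ (realLoopGrading (QuotientGroup.mk' H) χ
                (isGrading_realJordanGrading κ σ))) ∧
            ∀ (κ' : G ⧸ H → ℕ) (σ' : TwoTorsion (G ⧸ H) → ℤ),
              IsBalanced κ' → κ'.support.Finite → IsSignature κ' σ' →
              (GradedIso ℬ (realLoopGrading (QuotientGroup.mk' H) χ
                  (isGrading_realJordanGrading κ' σ')) ↔
                κ' = κ ∧ ∃ μ : TwoTorsion (G ⧸ H) →* ℤˣ, (∀ x ∈ (tau H).ker, μ x = 1) ∧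
                  ∀ x, σ' x = σ x * (μ x : ℤ))) ∧
      (CenterOneIsComplex ℬ →
        ∃! κ : G ⧸ H → ℕ, IsBalanced κ ∧ κ.support.Finite ∧
          GradedIso ℬ (loopGradingReal (QuotientGroup.mk' H)
            (isGrading_complexJordanGrading κ))) := by
  obtain ⟨t, ht⟩ := hsimple.exists_isCenterProj hgrading (hsimple.sq_eq hgrading hdegree)
  have hH : (supportSubgroup hgrading hsimple : Set G) = centerSupport ℬ := rfl
  exact ⟨supportSubgroup hgrading hsimple, hH,
    centerOneIsReal_or_centerOneIsComplex hgrading hsimple,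
    fun hR => ⟨exists_gradedIso_center hgrading hsimple hH hR,
      exists_real_invariants hgrading hsimple ht hH hR⟩,
    existsUnique_complex_invariant hgrading hsimple ht hH⟩
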